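/- **Theorem.** Let $F$ be a quadratically closed field, i.e. every polynomial of degree $2$ over $F$ has a root in $F$. Let $V$ be a finite-dimensional vector space over $F$ and let $f:V\times V\to F$ be a non-degenerate bilinear form. Let $\sigma\in \mathrm{GL}(V)$ be the asymmetry of $f$, i.e. the unique element satisfying $f(v,u)=f(u,\sigma v)$ for all $u,v\in V$, and suppose that $f$ is split, i.e. that the minimal polynomial of $\sigma$ splits over $F$. Let $J_m(\lambda)$ be the lower triangular $m\times m$ Jordan block with eigenvalue $\lambda$ (with $1$'s just below the diagonal). Let $\Gamma_n$ be the $n\times n$ matrix whose $(i,j)$ entry is $(-1)^{n-i}$ if $i+j\in\{n+1,n+2\}$ and $0$ otherwise. For odd $n$, let $\Gamma_n^0$ be the $n\times n$ matrix whose $(i,j)$ entry is $1$ if $i+j=n+1$, or if $i+j=n+2$ and $i>(n+1)/2$, and $0$ otherwise. For $m\ge 1$ and $\lambda\in F$ put $$H_{2m}(\lambda)=\begin{pmatrix}0&J_m(\lambda)\\ I_m&0\end{pmatrix}.$$ Consider the following matrices, where $n,m\ge 1$: - $A_n=\Gamma_n$, for $n$ odd and $\mathrm{char}(F)\ne2$;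 - $B_n=\Gamma^0_n$, for $n$ odd and $\mathrm{char}(F)=2$; - $C_n=\Gamma_n$, for $n$ even and $\mathrm{char}(F)\neq 2$; - $D_{2m}=H_{2m}(1)$, for $m$ even; - $E_{2m}=H_{2m}(1)$, for $m$ odd and $\mathrm{char}(F)=2$; - $F_{2m}=H_{2m}(-1)$, for $m$ odd and $\mathrm{char}(F)\ne2$; - $G_{2m}(\lambda)=H_{2m}(\lambda)$, for $\lambda\in F$ with $\lambda\ne 0$ and $\lambda^2\neq1$. Call a finite family of these matrices admissible if there is no odd $\ell$ such that both $B_\ell$ and $E_{2\ell}$ (for the same $\ell$) occur in it. Then: 1. There is a basis of $V$ relative to which the Gram matrix of $f$ is the direct sum of an admissible family of these matrices, each of which is indecomposable under congruence (that is, not congruent to a direct sum of two smaller square matrices). 2. The summands are uniquely determined by $f$, up to order and up to interchanging $G_{2m}(\lambda)$ and $G_{2m}(\lambda^{-1})$: if the direct sum of an admissible family $s$ is a Gram matrix of $f$, then the direct sum of an admissible family $t$ is also a Gram matrix of $f$ if and only if $t$ is obtained from $s$ by permuting the summands and replacing some of the summands $G_{2m}(\lambda)$ by $G_{2m}(\lambda^{-1})$.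 -/

import Mathlib

open Polynomial

namespace BilinNormalForm

universe u v w

/-- A field is quadratically closed if it has no quadratic extension, that is, if every
polynomial of degree two over it has a root in it. (In characteristic two this is stronger than
asking for square roots.) -/
def QuadraticallyClosed (F : Type u) [Field F] : Prop :=
  ∀ p : F[X], p.degree = 2 → ∃ x : F, p.IsRoot x

section Forms

variable {F : Type u} [Field F] {V : Type v} [AddCommGroup V] [Module F V]

/-- The asymmetry of a non-degenerate bilinear form `f`: the only `σ ∈ GL(V)` satisfying
`f v u = f u (σ v)` for all `u`, `v` (see `apply_asymmetry` and `eq_asymmetry`). -/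
noncomputable def asymmetry [FiniteDimensional F V] (f : LinearMap.BilinForm F V)
    (hf : f.Nondegenerate) : V ≃ₗ[F] V :=
  (f.toDual hf).trans (f.flip.toDual hf.flip).symm

theorem apply_asymmetry [FiniteDimensional F V] (f : LinearMap.BilinForm F V)
    (hf : f.Nondegenerate) (u v : V) : f u (asymmetry f hf v) = f v u := by
  have h := LinearMap.BilinForm.apply_toDual_symm_apply (hB := hf.flip) (f.toDual hf v) u
  rw [LinearMap.BilinForm.toDual_def] at h
  exact h

theorem eq_asymmetry [FiniteDimensional F V] (f : LinearMap.BilinForm F V)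
    (hf : f.Nondegenerate) (σ : V → V) (hσ : ∀ u v, f v u = f u (σ v)) (v : V) :
    σ v = asymmetry f hf v := by
  refine sub_eq_zero.mp (hf.2 _ fun u => ?_)
  rw [map_sub, apply_asymmetry, ← hσ, sub_self]

/-- A non-degenerate bilinear form is split if the minimal polynomial of its asymmetry splits
over the ground field. -/
def IsSplit [FiniteDimensional F V] (f : LinearMap.BilinForm F V) (hf : f.Nondegenerate) : Prop :=
  (minpoly F (asymmetry f hf : Module.End F V)).Splits

/-- `f` admits `A` as Gram matrix relative to some basis of `V`. -/
def AdmitsGramMatrix {ι : Type w} (f : LinearMap.BilinForm F V) (A : Matrix ι ι F) : Prop :=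
  ∃ b : Module.Basis ι F V, ∀ i j, f (b i) (b j) = A i j

end Forms

section Matrices

variable {F : Type u} [Field F]

/-- A (nonempty) square matrix is indecomposable under congruence if it is not congruent to the
direct sum of two smaller square matrices. -/
def IsIndecomposable {ι : Type w} [Fintype ι] [DecidableEq ι] (A : Matrix ι ι F) : Prop :=
  Nonempty ι ∧
    ¬ ∃ (p q : ℕ) (e : Fin p ⊕ Fin q ≃ ι) (B : Matrix (Fin p) (Fin p) F)
        (C : Matrix (Fin q) (Fin q) F) (X : Matrix ι ι F),
      0 < p ∧ 0 < q ∧ IsUnit X ∧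
        X.transpose * A * X = Matrix.reindex e e (Matrix.fromBlocks B 0 0 C)

/-- The lower triangular Jordan block `J_m(c)`. -/
def jordanBlock (m : ℕ) (c : F) : Matrix (Fin m) (Fin m) F :=
  Matrix.of fun i j => if i = j then c else if i.val = j.val + 1 then 1 else 0

/-- The matrix `Γ_n`. With rows and columns numbered from `1`, the entries `(i, j)` with
`i + j = n + 1` or `i + j = n + 2` are `(-1) ^ (n - i)`, and all others are zero. -/
def Gam (F : Type u) [Field F] (n : ℕ) : Matrix (Fin n) (Fin n) F :=
  Matrix.of fun i j =>
    if i.val + j.val + 1 = n ∨ i.val + j.val = n then (-1) ^ (n - (i.val + 1)) else 0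

/-- The matrix `Γ_n^0` (`n` odd). With rows and columns numbered from `1`, the entries `(i, j)`
with `i + j = n + 1` are `1`, those with `i + j = n + 2` and `i > (n + 1) / 2` are `1`, and all
others are zero. -/
def GamZero (F : Type u) [Field F] (n : ℕ) : Matrix (Fin n) (Fin n) F :=
  Matrix.of fun i j =>
    if i.val + j.val + 1 = n ∨ (i.val + j.val = n ∧ n + 1 < 2 * (i.val + 1)) then 1 else 0

/-- The matrix `(0, J_m(c); I_m, 0)` of size `2 m`. -/
def hypBlock (m : ℕ) (c : F) : Matrix (Fin m ⊕ Fin m) (Fin m ⊕ Fin m) F :=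
  Matrix.fromBlocks 0 (jordanBlock m c) 1 0

end Matrices

/-- Labels for the canonical blocks: `A n`, `B n`, `C n` stand for the blocks `A_n`, `B_n`, `C_n`
of size `n`, and `D m`, `E m`, `F m`, `G m c` for the blocks `D_{2m}`, `E_{2m}`, `F_{2m}`,
`G_{2m}(c)` of size `2 m`. -/
inductive Block (K : Type u) : Type u
  | A (n : ℕ)
  | B (n : ℕ)
  | C (n : ℕ)
  | D (m : ℕ)
  | E (m : ℕ)
  | F (m : ℕ)
  | G (m : ℕ) (c : K)

namespace Block

variable {K : Type u}

/-- The set indexing the rows and columns of a block. -/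
def Index : Block K → Type
  | A n => Fin n
  | B n => Fin n
  | C n => Fin n
  | D m => Fin m ⊕ Fin m
  | E m => Fin m ⊕ Fin m
  | F m => Fin m ⊕ Fin m
  | G m _ => Fin m ⊕ Fin m

instance instFintypeIndex : (b : Block K) → Fintype b.Index
  | A n => inferInstanceAs (Fintype (Fin n))
  | B n => inferInstanceAs (Fintype (Fin n))
  | C n => inferInstanceAs (Fintype (Fin n))
  | D m => inferInstanceAs (Fintype (Fin m ⊕ Fin m))
  | E m => inferInstanceAs (Fintype (Fin m ⊕ Fin m))
  | F m => inferInstanceAs (Fintype (Fin m ⊕ Fin m))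
  | G m _ => inferInstanceAs (Fintype (Fin m ⊕ Fin m))

instance instDecidableEqIndex : (b : Block K) → DecidableEq b.Index
  | A n => inferInstanceAs (DecidableEq (Fin n))
  | B n => inferInstanceAs (DecidableEq (Fin n))
  | C n => inferInstanceAs (DecidableEq (Fin n))
  | D m => inferInstanceAs (DecidableEq (Fin m ⊕ Fin m))
  | E m => inferInstanceAs (DecidableEq (Fin m ⊕ Fin m))
  | F m => inferInstanceAs (DecidableEq (Fin m ⊕ Fin m))
  | G m _ => inferInstanceAs (DecidableEq (Fin m ⊕ Fin m))

variable [Field K]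

/-- The matrix of a block. -/
def matrix : (b : Block K) → Matrix b.Index b.Index K
  | A n => Gam K n
  | B n => GamZero K n
  | C n => Gam K n
  | D m => hypBlock m (1 : K)
  | E m => hypBlock m (1 : K)
  | F m => hypBlock m (-1 : K)
  | G m c => hypBlock m c

/-- The conditions under which a label denotes one of the canonical blocks. The values
`c = 1` and `c = -1` are excluded for `G m c`: they are covered by the other blocks, or give
decomposable matrices. -/
def Valid : Block K → Prop
  | A n => Odd n ∧ ringChar K ≠ 2
  | B n => Odd n ∧ ringChar K = 2
  | C n => Even n ∧ 0 < n ∧ ringChar K ≠ 2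
  | D m => Even m ∧ 0 < m
  | E m => Odd m ∧ ringChar K = 2
  | F m => Odd m ∧ ringChar K ≠ 2
  | G m c => 0 < m ∧ c ≠ 0 ∧ c ^ 2 ≠ 1

/-- Two blocks are interchangeable if they are equal, or are `G_{2m}(c)` and `G_{2m}(c⁻¹)`. -/
def Interchangeable (b b' : Block K) : Prop :=
  b = b' ∨ ∃ (m : ℕ) (c : K), b = G m c ∧ b' = G m c⁻¹

/-- A finite family of canonical blocks that does not contain both `B_ℓ` and `E_{2ℓ}`, for
any `ℓ`. (Both can be valid only if `ℓ` is odd and the characteristic is two.) -/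
def Admissible {k : ℕ} (s : Fin k → Block K) : Prop :=
  (∀ i, (s i).Valid) ∧ ¬ ∃ (l : ℕ) (i j : Fin k), s i = B l ∧ s j = E l

/-- The direct sum of a finite family of blocks. -/
def directSum {k : ℕ} (s : Fin k → Block K) :
    Matrix (Σ i, (s i).Index) (Σ i, (s i).Index) K :=
  Matrix.blockDiagonal' fun i => (s i).matrix

end Block

end BilinNormalForm

/-! Write `N_c = σ - c`. Since `σ` preserves `f`, its adjoint is `σ⁻¹`, so `N_μ` is adjoint, up to a
unit factor, to `N_λ` when `μλ = 1`. Hence the numbers `f (N_μ^j b) (N_λ^k a)` satisfy a two-term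
recurrence: they vanish on high antidiagonals and are fixed up to a scalar on the top one.
Generalized eigenspaces for `λ` and `λ⁻¹` are in duality, and those with `λ² ≠ 1` are totally
isotropic.

Existence is by induction on the dimension. Pick an eigenvalue `c` and the maximal height `n + 1` of
its generalized eigenvectors. If `c² ≠ 1`, two dual cyclic subspaces span a block `G`. If `c = ±1`,
the top form `(a, b) ↦ f a (N^n b)` on the kernel of `N^(n+1)` is `c(-1)^n`-symmetric. If it is
alternating, a dual pair can be corrected until both cyclic subspaces are totally isotropic, which
yields `D`, `E` or `F`. Otherwise a vector that is anisotropic for it generates, after correction, a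
copy of `A`, `B` or `C`. The corrections are in `IsAsymmetry.exists_isotropic`, the only place
besides rescaling where quadratic equations are solved; in characteristic two the equation is of
Artin–Schreier type. In each case the range of the embedding is `σ`-invariant and nondegenerate, so
it splits off orthogonally.

Admissibility matters only in characteristic two, where `B_ℓ ⊥ E_{2ℓ}` is isometric to three copies
of `B_ℓ`. If two top-orthogonal, top-anisotropic vectors exist, the complement of `B_ℓ` again
contains a `B_ℓ`, hence by induction no `E_{2ℓ}`; if none exist, an `E_{2ℓ}` in the complement would
produce them.

For uniqueness, second differences of `dim ker (σ - μ)^k` count Jordan blocks, and these counts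
determine the multiplicity of every block other than `B` and `E`. For those two they only give `#B_ℓ
+ 2 #E_{2ℓ}`; whether the top form is alternating at height `ℓ` tells whether a `B_ℓ` occurs, and
admissibility settles the rest. Indecomposability follows from the existence theorem applied to the
two parts, together with the same invariants. -/

namespace BilinNormalForm

/-! ### The asymmetry and the recurrence for pairings of cyclic vectors. -/

section Asymmetry

variable {F : Type*} [Field F] {V W : Type*} [AddCommGroup V] [Module F V] [AddCommGroup W]
  [Module F W]

/-- `σ` is an asymmetry of `f` if `f v u = f u (σ v)` for all `u`, `v`. -/
def IsAsymmetry (f : LinearMap.BilinForm F V) (σ : Module.End F V) : Prop :=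
  ∀ u v, f v u = f u (σ v)

/-- The endomorphism `σ - c`. -/
def shift (σ : Module.End F V) (c : F) : Module.End F V := σ - c • 1

@[simp]
theorem shift_apply (σ : Module.End F V) (c : F) (v : V) : shift σ c v = σ v - c • v := rfl

theorem apply_eq_shift_add (σ : Module.End F V) (c : F) (v : V) :
    σ v = shift σ c v + c • v := by simp

theorem IsAsymmetry.apply_apply {f : LinearMap.BilinForm F V} {σ : Module.End F V}
    (h : IsAsymmetry f σ) (u v : V) : f (σ u) (σ v) = f u v := by
  rw [← h, ← h]

/-- A sequence of pairings satisfying a two-term recurrence is determined, near its top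
diagonal, by its zeroth row. -/
theorem eq_zero_of_recurrence {R : Type*} [Ring R] {c : ℕ → ℕ → R} {α β : R} {K i : ℕ}
    (h : ∀ j k, c (j + 1) k = α * c j (k + 1) + β * c (j + 1) (k + 1))
    (hK : ∀ j k, K ≤ k → c j k = 0) (h0 : ∀ k, i ≤ k → c 0 k = 0) :
    ∀ j k, i ≤ j + k → c j k = 0 := by
  intro j
  induction j with
  | zero => intro k hk; exact h0 k (by omega)
  | succ j ih =>
    -- Within row `j + 1`, descending induction on `k` from the bound `K`, with `d` the distance
    -- still to cover.
    have key : ∀ d k, K ≤ k + d → i ≤ j + 1 + k → c (j + 1) k = 0 := by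
      intro d
      induction d with
      | zero => intro k hk _; exact hK _ _ hk
      | succ d ihd =>
        intro k hk hi
        rw [h, ih (k + 1) (by omega), ihd (k + 1) (by omega) (by omega)]
        simp
    intro k hk
    exact key K k (by omega) hk

/-- On the antidiagonal `j + k = i` the `β` term lies one diagonal higher, where everything
vanishes, so each step down a row multiplies by `α`. -/
theorem eq_pow_mul_of_recurrence {R : Type*} [Ring R] {c : ℕ → ℕ → R} {α β : R} {K i : ℕ}
    (h : ∀ j k, c (j + 1) k = α * c j (k + 1) + β * c (j + 1) (k + 1))
    (hK : ∀ j k, K ≤ k → c j k = 0) (h0 : ∀ k, i + 1 ≤ k → c 0 k = 0) :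
    ∀ j k, j + k = i → c j k = α ^ j * c 0 i := by
  intro j
  induction j with
  | zero => intro k hk; simp at hk; simp [hk]
  | succ j ih =>
    intro k hk
    rw [h, ih (k + 1) (by omega), eq_zero_of_recurrence h hK h0 (j + 1) (k + 1) (by omega),
      pow_succ']
    simp [mul_assoc]

variable {f : LinearMap.BilinForm F V} {σ : Module.End F V}

/-- When `σ` is invertible this says that the adjoint of `σ - μ` is `σ⁻¹ - μ = -μ σ⁻¹ (σ - λ)`, with
`σ⁻¹` moved back to the left as `σ = (σ - μ) + μ`. -/
theorem IsAsymmetry.shift_left (h : IsAsymmetry f σ) {lam μ : F} (hμ : μ * lam = 1) (x y : V) :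
    f (shift σ μ x) y =
      -μ ^ 2 * f x (shift σ lam y) + -μ * f (shift σ μ x) (shift σ lam y) := by
  simp only [shift_apply, map_sub, map_smul, LinearMap.sub_apply, LinearMap.smul_apply,
    smul_eq_mul, h.apply_apply]
  linear_combination (-f (σ x) y) * hμ

theorem IsAsymmetry.shift_right (h : IsAsymmetry f σ) {lam μ : F} (hμ : μ * lam = 1) (x y : V) :
    f x (shift σ lam y) =
      -lam ^ 2 * f (shift σ μ x) y + -lam * f (shift σ μ x) (shift σ lam y) := by
  rw [h.shift_left hμ]
  linear_combination (-(lam * f (shift σ μ x) (shift σ lam y))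
    - (1 + μ * lam) * f x (shift σ lam y)) * hμ

theorem pow_apply_eq_zero_of_le {N : Module.End F V} {m k : ℕ} {a : V} (ha : (N ^ m) a = 0)
    (h : m ≤ k) : (N ^ k) a = 0 := by
  obtain ⟨r, rfl⟩ := Nat.exists_eq_add_of_le' h
  rw [pow_add, Module.End.mul_apply, ha, map_zero]

theorem IsAsymmetry.recurrence (h : IsAsymmetry f σ) {lam μ : F} (hμ : μ * lam = 1) (b a : V)
    (j k : ℕ) : f ((shift σ μ ^ (j + 1)) b) ((shift σ lam ^ k) a) =
      -μ ^ 2 * f ((shift σ μ ^ j) b) ((shift σ lam ^ (k + 1)) a) +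
      -μ * f ((shift σ μ ^ (j + 1)) b) ((shift σ lam ^ (k + 1)) a) := by
  simp only [pow_succ' (shift σ μ) j, pow_succ' (shift σ lam) k, Module.End.mul_apply]
  exact h.shift_left hμ _ _

theorem IsAsymmetry.recurrence' (h : IsAsymmetry f σ) {lam μ : F} (hμ : μ * lam = 1) (b a : V)
    (j k : ℕ) : f ((shift σ μ ^ k) b) ((shift σ lam ^ (j + 1)) a) =
      -lam ^ 2 * f ((shift σ μ ^ (k + 1)) b) ((shift σ lam ^ j) a) +
      -lam * f ((shift σ μ ^ (k + 1)) b) ((shift σ lam ^ (j + 1)) a) := by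
  simp only [pow_succ' (shift σ μ) k, pow_succ' (shift σ lam) j, Module.End.mul_apply]
  exact h.shift_right hμ _ _

theorem IsAsymmetry.pairing_eq_zero (h : IsAsymmetry f σ) {lam μ : F} (hμ : μ * lam = 1)
    {b a : V} {m : ℕ} (ha : (shift σ lam ^ m) a = 0) {j k : ℕ} (hjk : m ≤ j + k) :
    f ((shift σ μ ^ j) b) ((shift σ lam ^ k) a) = 0 :=
  eq_zero_of_recurrence (c := fun j k => f ((shift σ μ ^ j) b) ((shift σ lam ^ k) a))
    (K := m) (h.recurrence hμ b a)
    (fun j k hk => by simp only [pow_apply_eq_zero_of_le ha hk, map_zero])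
    (fun k hk => by simp only [pow_apply_eq_zero_of_le ha hk, map_zero]) j k hjk

theorem IsAsymmetry.pairing_eq_zero' (h : IsAsymmetry f σ) {lam μ : F} (hμ : μ * lam = 1)
    {b a : V} {m : ℕ} (hb : (shift σ μ ^ m) b = 0) {j k : ℕ} (hjk : m ≤ j + k) :
    f ((shift σ μ ^ j) b) ((shift σ lam ^ k) a) = 0 :=
  eq_zero_of_recurrence (c := fun k j => f ((shift σ μ ^ j) b) ((shift σ lam ^ k) a))
    (K := m) (i := m) (h.recurrence' hμ b a)
    (fun j k hk => by simp only [pow_apply_eq_zero_of_le hb hk, map_zero, LinearMap.zero_apply])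
    (fun k hk => by simp only [pow_apply_eq_zero_of_le hb hk, map_zero, LinearMap.zero_apply])
    k j (by omega)

/-- Pairings of total degree `n` all reduce to a single number, so one nonzero pairing puts the two
cyclic subspaces in duality. -/
theorem IsAsymmetry.pairing_top (h : IsAsymmetry f σ) {lam μ : F} (hμ : μ * lam = 1)
    {b a : V} {n : ℕ} (ha : (shift σ lam ^ (n + 1)) a = 0) {j k : ℕ} (hjk : j + k = n) :
    f ((shift σ μ ^ j) b) ((shift σ lam ^ k) a) = (-μ ^ 2) ^ j * f b ((shift σ lam ^ n) a) :=
  eq_pow_mul_of_recurrence (c := fun j k => f ((shift σ μ ^ j) b) ((shift σ lam ^ k) a))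
    (K := n + 1) (h.recurrence hμ b a)
    (fun j k hk => by simp only [pow_apply_eq_zero_of_le ha hk, map_zero])
    (fun k hk => by simp only [pow_apply_eq_zero_of_le ha hk, map_zero]) j k hjk

/-! ### Eigenvalues ±1: symmetry of the top form and isotropic corrections. -/

section Unipotent

variable {ε : F}

theorem IsAsymmetry.apply_swap (h : IsAsymmetry f σ) (ε : F) (x y : V) :
    f x y = ε * f y x + f y (shift σ ε x) := by
  rw [h y x]; simp

theorem IsAsymmetry.self_pairing_eq_zero (h : IsAsymmetry f σ) (hε : ε * ε = 1) {a : V}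
    {m i : ℕ} (ha : (shift σ ε ^ m) a = 0)
    (hi : ∀ k, i ≤ k → f a ((shift σ ε ^ k) a) = 0) {j k : ℕ} (hjk : i ≤ j + k) :
    f ((shift σ ε ^ j) a) ((shift σ ε ^ k) a) = 0 :=
  eq_zero_of_recurrence (c := fun j k => f ((shift σ ε ^ j) a) ((shift σ ε ^ k) a))
    (K := m) (h.recurrence hε a a)
    (fun j k hk => by simp only [pow_apply_eq_zero_of_le ha hk, map_zero]) hi j k hjk

theorem IsAsymmetry.self_pairing_top (h : IsAsymmetry f σ) (hε : ε * ε = 1) {a : V}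
    {m i : ℕ} (ha : (shift σ ε ^ m) a = 0)
    (hi : ∀ k, i + 1 ≤ k → f a ((shift σ ε ^ k) a) = 0) {j k : ℕ} (hjk : j + k = i) :
    f ((shift σ ε ^ j) a) ((shift σ ε ^ k) a) = (-1) ^ j * f a ((shift σ ε ^ i) a) := by
  have := eq_pow_mul_of_recurrence
    (c := fun j k => f ((shift σ ε ^ j) a) ((shift σ ε ^ k) a))
    (K := m) (h.recurrence hε a a)
    (fun j k hk => by simp only [pow_apply_eq_zero_of_le ha hk, map_zero]) hi j k hjk
  simpa [sq, hε] using this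

/-- The symmetry of the form `(a, b) ↦ f a (N ^ n b)`, where `N = σ - ε`. -/
theorem IsAsymmetry.top_swap (h : IsAsymmetry f σ) (hε : ε * ε = 1) {a b : V} {n : ℕ}
    (hb : (shift σ ε ^ (n + 1)) b = 0) :
    f b ((shift σ ε ^ n) a) = ε * (-1) ^ n * f a ((shift σ ε ^ n) b) := by
  have h1 := h.pairing_top hε (b := a) hb (j := n) (k := 0) (by omega)
  have h2 := h.pairing_eq_zero hε (b := a) hb (j := n) (k := 1) (by omega)
  simp only [pow_zero, Module.End.one_apply, pow_one, sq, hε] at h1 h2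
  have h3 := h.apply_swap ε b ((shift σ ε ^ n) a)
  rw [h1, h2] at h3
  rw [h3]; ring

/-- Outside characteristic two, a nonzero leading self-pairing at degree `i` forces `ε (-1)^i = 1`.
-/
theorem IsAsymmetry.self_swap (h : IsAsymmetry f σ) (hε : ε * ε = 1) {a : V}
    {m i : ℕ} (ha : (shift σ ε ^ m) a = 0)
    (hi : ∀ k, i + 1 ≤ k → f a ((shift σ ε ^ k) a) = 0) :
    f a ((shift σ ε ^ i) a) = ε * (-1) ^ i * f a ((shift σ ε ^ i) a) := by
  have h1 := h.self_pairing_top hε ha hi (j := i) (k := 0) (by omega)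
  have h2 := h.self_pairing_eq_zero hε ha hi (j := i) (k := 1) (by omega)
  simp only [pow_zero, Module.End.one_apply, pow_one] at h1 h2
  have h3 := h.apply_swap ε a ((shift σ ε ^ i) a)
  rw [h1, h2] at h3
  nth_rewrite 1 [h3]
  ring

theorem IsAsymmetry.apply_shift_one (h : IsAsymmetry f σ) (w : V) : f w (shift σ 1 w) = 0 := by
  have := h.apply_swap 1 w w
  linear_combination -this

/-- For `i = 2l + 1` and `w = N^l a`, the pairing equals `± f w (N w)`, which is zero because `f w
(σ w) = f w w`. This supplies the parity information that the sign argument loses in characteristic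
two. -/
theorem IsAsymmetry.self_odd (h : IsAsymmetry f σ) {a : V}
    {m i : ℕ} (ha : (shift σ 1 ^ m) a = 0) (hodd : Odd i)
    (hi : ∀ k, i + 1 ≤ k → f a ((shift σ 1 ^ k) a) = 0) :
    f a ((shift σ 1 ^ i) a) = 0 := by
  obtain ⟨l, rfl⟩ := hodd
  have h1 := h.self_pairing_top (one_mul 1) ha hi (j := l) (k := l + 1) (by omega)
  rw [pow_succ', Module.End.mul_apply, h.apply_shift_one] at h1
  rcases mul_eq_zero.mp h1.symm with h2 | h2
  · simp at h2
  · exact h2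

/-- The degenerate case `p = 0` is included because the leading coefficient met in
`exists_isotropic_step` may vanish. -/
theorem QuadraticallyClosed.exists_quadratic (hF : QuadraticallyClosed F) (p q r : F)
    (hpq : p ≠ 0 ∨ q ≠ 0) : ∃ t, p * t ^ 2 + q * t + r = 0 := by
  by_cases hp : p = 0
  · have hq : q ≠ 0 := by tauto
    exact ⟨-r / q, by rw [hp]; field_simp; ring⟩
  · obtain ⟨t, ht⟩ := hF (C p * X ^ 2 + C q * X + C r) (degree_quadratic hp)
    exact ⟨t, by simpa using ht⟩

theorem IsAsymmetry.expand_add_smul (f : LinearMap.BilinForm F V) (N : Module.End F V) (a b : V)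
    (t : F) (j k : ℕ) : f (a + t • (N ^ j) b) ((N ^ k) (a + t • (N ^ j) b)) =
      f a ((N ^ k) a) + t * (f a ((N ^ (k + j)) b) + f ((N ^ j) b) ((N ^ k) a)) +
        t ^ 2 * f ((N ^ j) b) ((N ^ (k + j)) b) := by
  simp only [map_add, map_smul, LinearMap.add_apply, LinearMap.smul_apply, smul_eq_mul,
    pow_add, Module.End.mul_apply]
  ring

/-- One more self-pairing of `a` is killed by adding `t N^j b`. The exponent `j` is chosen so that
the coefficient of `t` at degree `i` is a nonzero multiple of `γ = f a (N^n b)` while all higher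
degrees stay zero. -/
theorem IsAsymmetry.exists_isotropic_step (hF : QuadraticallyClosed F) (h : IsAsymmetry f σ)
    (hε : ε * ε = 1) {n i : ℕ} {a b : V} (ha : (shift σ ε ^ (n + 1)) a = 0)
    (hb : (shift σ ε ^ (n + 1)) b = 0) (hab : f a ((shift σ ε ^ n) b) ≠ 0) (hin : i + 1 ≤ n)
    (hi : ∀ k, i + 1 ≤ k → f a ((shift σ ε ^ k) a) = 0) :
    ∃ (t : F) (j : ℕ), f (a + t • (shift σ ε ^ j) b) ((shift σ ε ^ n) b) ≠ 0 ∧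
      ∀ k, i ≤ k → f (a + t • (shift σ ε ^ j) b)
        ((shift σ ε ^ k) (a + t • (shift σ ε ^ j) b)) = 0 := by
  by_cases hauto : f a ((shift σ ε ^ i) a) = 0
  · refine ⟨0, 0, by simpa using hab, fun k hk => ?_⟩
    rcases hk.eq_or_lt with rfl | hk
    · simpa using hauto
    · simpa using hi k hk
  set γ := f a ((shift σ ε ^ n) b) with hγ
  have hd0 : ∀ {x y : V}, (shift σ ε ^ (n + 1)) y = 0 → ∀ {j k : ℕ}, n + 1 ≤ j + k →
      f ((shift σ ε ^ j) x) ((shift σ ε ^ k) y) = 0 :=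
    fun hy _ _ hjk => h.pairing_eq_zero hε hy hjk
  have hd0' : ∀ {x y : V}, (shift σ ε ^ (n + 1)) y = 0 → ∀ {k : ℕ}, n + 1 ≤ k →
      f x ((shift σ ε ^ k) y) = 0 :=
    fun {x y} hy k hk => by simpa using hd0 (x := x) hy (j := 0) (k := k) (by omega)
  have hba : f b ((shift σ ε ^ n) a) = ε * (-1) ^ n * γ := h.top_swap hε hb
  by_cases h2 : (2 : F) = 0
  · -- characteristic two
    have hε1 : ε = 1 := by
      have : (ε - 1) ^ 2 = 0 := by linear_combination hε + (1 - ε) * h2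
      exact sub_eq_zero.mp (pow_eq_zero_iff (two_ne_zero) |>.mp this)
    subst hε1
    have hneg : ∀ x : F, -x = x := fun x => by linear_combination -x * h2
    have heven : Even i := by
      by_contra hodd
      exact hauto (h.self_odd ha (Nat.not_even_iff_odd.mp hodd) hi)
    -- With `j = n - i` the two cross terms would be `γ + γ = 0`, so `j` is one smaller and the
    -- cross terms are read off one diagonal below the top.
    obtain ⟨j, hj⟩ : ∃ j, i + 1 + j = n := ⟨n - (i + 1), by omega⟩
    have top : ∀ {x y : V}, (shift σ 1 ^ (n + 1)) y = 0 → ∀ {j k : ℕ}, j + k = n →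
      f ((shift σ 1 ^ j) x) ((shift σ 1 ^ k) y) = f x ((shift σ 1 ^ n) y) := fun hy j k hjk => by
      rw [h.pairing_top hε hy hjk, hneg]; simp
    have hγ' : f b ((shift σ 1 ^ n) a) = γ := by
      rw [hba]; rcases neg_one_pow_eq_or F n with h' | h' <;> rw [h'] <;> simp [hneg]
    -- the second diagonal
    have hdiag : ∀ l k, l + 1 + k = n → f ((shift σ 1 ^ l) a) ((shift σ 1 ^ k) b) =
        f a ((shift σ 1 ^ (n - 1)) b) + l * γ := by
      intro l
      induction l with
      | zero => intro k hk; simp [show k = n - 1 by omega]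
      | succ l ih =>
        intro k hk
        rw [h.recurrence hε, ih (k + 1) (by omega), top hb (by omega), hneg, hneg]
        push_cast; ring
    -- Swapping the second term gives a value on the second diagonal, shifted by `iγ`, plus one top
    -- value `γ`. Since `i` is even, everything but that `γ` cancels modulo 2.
    have hcross : f a ((shift σ 1 ^ (i + j)) b) + f ((shift σ 1 ^ j) b) ((shift σ 1 ^ i) a) = γ := by
      rw [h.apply_swap 1 ((shift σ 1 ^ j) b), ← Module.End.mul_apply, ← pow_succ',
        top (k := j + 1) hb (by omega), hdiag i j (by omega), show i + j = n - 1 by omega]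
      obtain ⟨r, rfl⟩ := heven
      push_cast
      linear_combination (f a ((shift σ 1 ^ (n - 1)) b) + r * γ) * h2
    obtain ⟨t, ht⟩ := hF.exists_quadratic (f ((shift σ 1 ^ j) b) ((shift σ 1 ^ (i + j)) b)) γ
      (f a ((shift σ 1 ^ i) a)) (Or.inr hab)
    -- If `j = 0` then `n = i + 1` is odd, which removes the top self-pairing of `b` that degree
    -- reasons do not.
    have hbb : j = 0 → f b ((shift σ 1 ^ n) b) = 0 := fun hj0 =>
      h.self_odd hb (by subst hj0; rw [← hj]; exact heven.add_one) fun k hk => hd0' hb hk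
    refine ⟨t, j, ?_, fun k hk => ?_⟩
    · rw [map_add, LinearMap.add_apply, map_smul, LinearMap.smul_apply]
      rcases Nat.eq_zero_or_pos j with hj0 | hj0
      · subst hj0; simpa [hbb rfl] using hab
      · rw [hd0 hb (by omega)]; simpa using hab
    · rw [expand_add_smul]
      rcases hk.eq_or_lt with rfl | hk
      · rw [hcross]; linear_combination ht
      · rw [hi k hk]
        rcases Nat.lt_or_ge (i + 1) k with hk' | hk'
        · rw [hd0' hb (by omega), hd0 ha (by omega), hd0 hb (by omega)]; simp
        -- At degree `i + 1` the cross terms are two top values, whose sum is `2γ = 0`.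
        · obtain rfl : k = i + 1 := by omega
          have e1 : f ((shift σ 1 ^ j) b) ((shift σ 1 ^ (i + 1 + j)) b) = 0 := by
            rcases Nat.eq_zero_or_pos j with hj0 | hj0
            · subst hj0; simpa [← hj] using hbb rfl
            · exact hd0 hb (by omega)
          rw [hj, ← hγ, top ha (by omega), hγ', ← hj, e1]
          linear_combination t * γ * h2
  -- Here both cross terms lie on the top diagonal and add up to `2γ`. As `j ≥ 1`, the quadratic
  -- term vanishes and the equation for `t` is linear.
  · obtain ⟨j, hj⟩ : ∃ j, i + j = n := ⟨n - i, by omega⟩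
    have hsign : ε * (-1) ^ i = 1 := by
      have h1 := h.self_swap hε ha hi
      exact (mul_right_cancel₀ hauto ((one_mul _).trans h1)).symm
    have hcross : f a ((shift σ ε ^ (i + j)) b) + f ((shift σ ε ^ j) b) ((shift σ ε ^ i) a) =
        2 * γ := by
      rw [h.pairing_top hε ha (show j + i = n by omega), hba, hj, ← hγ, ← hj, pow_add]
      have : ((-1 : F) ^ j) * (-1) ^ j = 1 := by rw [← mul_pow]; simp
      simp only [sq, hε]
      linear_combination γ * this + γ * (-1 : F) ^ j * (-1) ^ j * hsign
    refine ⟨-f a ((shift σ ε ^ i) a) / (2 * γ), j, ?_, fun k hk => ?_⟩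
    · rw [map_add, LinearMap.add_apply, map_smul, LinearMap.smul_apply, hd0 hb (by omega)]
      simpa using hab
    · rw [expand_add_smul]
      rcases hk.eq_or_lt with rfl | hk
      · rw [hcross, hd0 hb (by omega)]
        field_simp; ring
      · rw [hi k hk, hd0' hb (by omega), hd0 ha (by omega), hd0 hb (by omega)]; simp

/-- A vector `a` with `f a (N ^ n a) = 0` can be moved by an element of the cyclic subspace of `b`
so that the cyclic subspace of the new vector is totally isotropic. -/
theorem IsAsymmetry.exists_isotropic (hF : QuadraticallyClosed F) (h : IsAsymmetry f σ)
    (hε : ε * ε = 1) {n : ℕ} {a b : V} (ha : (shift σ ε ^ (n + 1)) a = 0)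
    (hb : (shift σ ε ^ (n + 1)) b = 0) (hab : f a ((shift σ ε ^ n) b) ≠ 0)
    (haa : f a ((shift σ ε ^ n) a) = 0) (S : Submodule F V) (hbS : b ∈ S)
    (hS : ∀ x ∈ S, shift σ ε x ∈ S) :
    ∃ a', a' - a ∈ S ∧ (shift σ ε ^ (n + 1)) a' = 0 ∧ f a' ((shift σ ε ^ n) b) ≠ 0 ∧
      ∀ i, f a' ((shift σ ε ^ i) a') = 0 := by
  have hpow : ∀ j, (shift σ ε ^ j) b ∈ S := fun j => by
    induction j with
    | zero => simpa using hbS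
    | succ j ih => rw [pow_succ', Module.End.mul_apply]; exact hS _ ih
  have key : ∀ r ≤ n, ∃ a', a' - a ∈ S ∧ (shift σ ε ^ (n + 1)) a' = 0 ∧
      f a' ((shift σ ε ^ n) b) ≠ 0 ∧ ∀ i, n - r ≤ i → f a' ((shift σ ε ^ i) a') = 0 := by
    intro r
    induction r with
    | zero =>
      refine fun _ => ⟨a, by simp, ha, hab, fun i hi => ?_⟩
      rcases (show n ≤ i from hi).eq_or_lt with rfl | hi
      · exact haa
      · rw [pow_apply_eq_zero_of_le ha hi, map_zero]
    | succ r ih =>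
      intro hr
      obtain ⟨a₁, h1, h2, h3, h4⟩ := ih (by omega)
      obtain ⟨t, j, h5, h6⟩ := h.exists_isotropic_step hF hε h2 hb h3
        (i := n - (r + 1)) (by omega) fun k hk => h4 k (by omega)
      refine ⟨_, ?_, ?_, h5, h6⟩
      · rw [add_sub_right_comm]
        exact S.add_mem h1 (S.smul_mem _ (hpow j))
      · rw [map_add, h2, map_smul, ← Module.End.mul_apply, ← pow_add,
          pow_apply_eq_zero_of_le hb (by omega)]
        simp
  obtain ⟨a', h1, h2, h3, h4⟩ := key n le_rfl
  exact ⟨a', h1, h2, h3, fun i => h4 i (by omega)⟩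

end Unipotent

end Asymmetry

/-! ### Isometries, orthogonal sums and Gram matrices. -/

section Isometry

variable {F : Type*} [Field F] {V W U : Type*} [AddCommGroup V] [Module F V] [AddCommGroup W]
  [Module F W] [AddCommGroup U] [Module F U]

/-- Two bilinear forms are isometric if a linear equivalence carries one to the other. -/
def Isometric (f : LinearMap.BilinForm F V) (g : LinearMap.BilinForm F W) : Prop :=
  ∃ φ : V ≃ₗ[F] W, ∀ u v, g (φ u) (φ v) = f u v

theorem Isometric.refl (f : LinearMap.BilinForm F V) : Isometric f f :=
  ⟨LinearEquiv.refl F V, fun _ _ => rfl⟩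

theorem Isometric.symm {f : LinearMap.BilinForm F V} {g : LinearMap.BilinForm F W} :
    Isometric f g → Isometric g f := fun ⟨φ, h⟩ => ⟨φ.symm, fun u v => by simp [← h]⟩

theorem Isometric.trans {f : LinearMap.BilinForm F V} {g : LinearMap.BilinForm F W}
    {k : LinearMap.BilinForm F U} : Isometric f g → Isometric g k → Isometric f k :=
  fun ⟨φ, h⟩ ⟨ψ, h'⟩ => ⟨φ.trans ψ, fun u v => by simp [h, h']⟩

theorem admitsGramMatrix_iff {ι : Type*} [Fintype ι] [DecidableEq ι] {f : LinearMap.BilinForm F V}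
    {A : Matrix ι ι F} : AdmitsGramMatrix f A ↔ Isometric f (Matrix.toBilin' A) := by
  constructor
  · rintro ⟨b, hb⟩
    refine ⟨b.equivFun, fun u v => ?_⟩
    have : (Matrix.toBilin' A).compl₁₂ b.equivFun.toLinearMap b.equivFun.toLinearMap = f := by
      refine LinearMap.ext_basis b b fun i j => ?_
      simp [hb, Matrix.toBilin'_single, Finsupp.single_eq_pi_single]
    exact LinearMap.congr_fun₂ this u v
  · rintro ⟨φ, h⟩
    refine ⟨Module.Basis.ofEquivFun φ, fun i j => ?_⟩
    rw [← h]
    simp [Matrix.toBilin'_single]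

/-- The orthogonal sum of two forms. -/
def prodForm (f : LinearMap.BilinForm F V) (g : LinearMap.BilinForm F W) :
    LinearMap.BilinForm F (V × W) :=
  f.compl₁₂ (LinearMap.fst F V W) (LinearMap.fst F V W) +
    g.compl₁₂ (LinearMap.snd F V W) (LinearMap.snd F V W)

@[simp]
theorem prodForm_apply (f : LinearMap.BilinForm F V) (g : LinearMap.BilinForm F W) (x y : V × W) :
    prodForm f g x y = f x.1 y.1 + g x.2 y.2 := rfl

theorem Isometric.prodForm {V' W' : Type*} [AddCommGroup V'] [Module F V'] [AddCommGroup W']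
    [Module F W'] {f : LinearMap.BilinForm F V} {g : LinearMap.BilinForm F W}
    {f' : LinearMap.BilinForm F V'} {g' : LinearMap.BilinForm F W'} :
    Isometric f f' → Isometric g g' → Isometric (prodForm f g) (prodForm f' g') :=
  fun ⟨φ, h⟩ ⟨ψ, h'⟩ => ⟨φ.prodCongr ψ, fun u v => by simp [h, h']⟩

/-- The orthogonal sum of a finite family of forms. -/
def piForm {κ : Type*} [Fintype κ] {M : κ → Type*} [∀ i, AddCommGroup (M i)] [∀ i, Module F (M i)]
    (f : ∀ i, LinearMap.BilinForm F (M i)) : LinearMap.BilinForm F (∀ i, M i) :=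
  ∑ i, (f i).compl₁₂ (LinearMap.proj i) (LinearMap.proj i)

section Pi

variable {κ κ' : Type*} [Fintype κ] [Fintype κ'] {M : κ → Type*} [∀ i, AddCommGroup (M i)]
  [∀ i, Module F (M i)] {M' : κ' → Type*} [∀ i, AddCommGroup (M' i)] [∀ i, Module F (M' i)]

@[simp]
theorem piForm_apply (f : ∀ i, LinearMap.BilinForm F (M i)) (x y : ∀ i, M i) :
    piForm f x y = ∑ i, f i (x i) (y i) := by
  simp [piForm, LinearMap.sum_apply]

theorem Isometric.piForm {M₂ : κ → Type*} [∀ i, AddCommGroup (M₂ i)]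
    [∀ i, Module F (M₂ i)] {f : ∀ i, LinearMap.BilinForm F (M i)}
    {g : ∀ i, LinearMap.BilinForm F (M₂ i)} (h : ∀ i, Isometric (f i) (g i)) :
    Isometric (piForm f) (piForm g) := by
  choose φ hφ using h
  exact ⟨LinearEquiv.piCongrRight φ, fun u v => by simp [hφ]⟩

theorem Isometric.piForm_reindex (e : κ ≃ κ') (f : ∀ i, LinearMap.BilinForm F (M' i)) :
    Isometric (BilinNormalForm.piForm fun i => f (e i)) (BilinNormalForm.piForm f) := by
  refine Isometric.symm ⟨(LinearEquiv.piCongrLeft F M' e).symm, fun u v => ?_⟩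
  rw [piForm_apply, piForm_apply]
  exact Fintype.sum_equiv e _ _ fun i => rfl

theorem Isometric.piForm_sum {M : κ ⊕ κ' → Type*} [∀ i, AddCommGroup (M i)]
    [∀ i, Module F (M i)] (f : ∀ i, LinearMap.BilinForm F (M i)) :
    Isometric (BilinNormalForm.piForm f)
      (BilinNormalForm.prodForm (BilinNormalForm.piForm fun i => f (Sum.inl i))
      (BilinNormalForm.piForm fun i => f (Sum.inr i))) :=
  ⟨LinearEquiv.sumPiEquivProdPi F κ κ' M, fun u v => by
    simp [Fintype.sum_sum_type]⟩

theorem Isometric.piForm_unique [Unique κ] (f : ∀ i, LinearMap.BilinForm F (M i)) :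
    Isometric (BilinNormalForm.piForm f) (f default) :=
  ⟨LinearEquiv.piUnique F M, fun u v => by simp⟩

end Pi

theorem Isometric.blockDiagonal' {κ : Type*} [Fintype κ] [DecidableEq κ] {ι : κ → Type*}
    [∀ i, Fintype (ι i)] [∀ i, DecidableEq (ι i)] (A : ∀ i, Matrix (ι i) (ι i) F) :
    Isometric (Matrix.toBilin' (Matrix.blockDiagonal' A))
      (BilinNormalForm.piForm fun i => Matrix.toBilin' (A i)) := by
  apply Isometric.symm
  refine admitsGramMatrix_iff.mp ⟨Pi.basis fun i => Pi.basisFun F (ι i), ?_⟩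
  rintro ⟨i, a⟩ ⟨j, b⟩
  rw [Pi.basis_apply, Pi.basis_apply, piForm_apply]
  rcases eq_or_ne i j with rfl | hij
  · rw [Finset.sum_eq_single i]
    · simp [Matrix.toBilin'_single]
    · intro k _ hk; simp [Pi.single_eq_of_ne hk]
    · simp
  · rw [Matrix.blockDiagonal'_apply_ne _ _ _ hij]
    refine Finset.sum_eq_zero fun k _ => ?_
    rcases eq_or_ne k i with rfl | hk
    · simp [Pi.single_eq_of_ne hij]
    · simp [Pi.single_eq_of_ne hk]

theorem Isometric.nondegenerate {f : LinearMap.BilinForm F V} {g : LinearMap.BilinForm F W}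
    (h : Isometric f g) (hf : f.Nondegenerate) : g.Nondegenerate := by
  obtain ⟨φ, h⟩ := h
  refine ⟨fun x hx => ?_, fun x hx => ?_⟩
  · have := hf.1 (φ.symm x) fun y => by rw [← h]; simpa using hx (φ y)
    simpa using this
  · have := hf.2 (φ.symm x) fun y => by rw [← h]; simpa using hx (φ y)
    simpa using this

theorem nondegenerate_of_prodForm_left {f : LinearMap.BilinForm F V} {g : LinearMap.BilinForm F W}
    (h : (prodForm f g).Nondegenerate) : f.Nondegenerate := by
  refine ⟨fun x hx => ?_, fun x hx => ?_⟩
  · exact congrArg Prod.fst (h.1 (x, 0) fun y => by simp [hx])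
  · exact congrArg Prod.fst (h.2 (x, 0) fun y => by simp [hx])

theorem nondegenerate_of_prodForm_right {f : LinearMap.BilinForm F V}
    {g : LinearMap.BilinForm F W}
    (h : (prodForm f g).Nondegenerate) : g.Nondegenerate := by
  refine ⟨fun x hx => ?_, fun x hx => ?_⟩
  · exact congrArg Prod.snd (h.1 (0, x) fun y => by simp [hx])
  · exact congrArg Prod.snd (h.2 (0, x) fun y => by simp [hx])

theorem exists_isAsymmetry [FiniteDimensional F V] {f : LinearMap.BilinForm F V}
    (hf : f.Nondegenerate) : ∃ σ, IsAsymmetry f σ :=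
  ⟨asymmetry f hf, fun u v => (apply_asymmetry f hf u v).symm⟩

theorem IsAsymmetry.eq_of_isometry {f : LinearMap.BilinForm F V} {g : LinearMap.BilinForm F W}
    {σ : Module.End F V} {τ : Module.End F W} (hσ : IsAsymmetry f σ) (hτ : IsAsymmetry g τ)
    (hg : g.Nondegenerate) (φ : V ≃ₗ[F] W) (h : ∀ u v, g (φ u) (φ v) = f u v) (v : V) :
    φ (σ v) = τ (φ v) := by
  refine sub_eq_zero.mp (hg.2 _ fun u => ?_)
  obtain ⟨u, rfl⟩ := φ.surjective u
  rw [map_sub, h, ← hσ, ← hτ, h, sub_self]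

theorem shift_pow_map {σ : Module.End F V} {τ : Module.End F W} (φ : V →ₗ[F] W)
    (h : ∀ v, φ (σ v) = τ (φ v)) (c : F) (k : ℕ) (v : V) :
    φ ((shift σ c ^ k) v) = (shift τ c ^ k) (φ v) := by
  induction k with
  | zero => simp
  | succ k ih => rw [pow_succ', pow_succ', Module.End.mul_apply, Module.End.mul_apply, ← ih]; simp [h]

theorem IsAsymmetry.injective {f : LinearMap.BilinForm F V} {σ : Module.End F V}
    (h : IsAsymmetry f σ) (hf : f.Nondegenerate) : Function.Injective σ := by
  rw [injective_iff_map_eq_zero]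
  intro x hx
  exact hf.1 x fun y => by rw [h, hx, map_zero]

end Isometry

/-! ### Embedding cyclic and hyperbolic models, and splitting them off. -/

section Embedding

variable {F : Type*} [Field F] {V W : Type*} [AddCommGroup V] [Module F V] [AddCommGroup W]
  [Module F W]

theorem det_ne_zero_of_antitriangular {n : ℕ} (M : Matrix (Fin n) (Fin n) F)
    (h0 : ∀ i j : Fin n, n ≤ i.val + j.val → M i j = 0)
    (h1 : ∀ i j : Fin n, i.val + j.val + 1 = n → M i j ≠ 0) : M.det ≠ 0 := by
  have h : (M.submatrix Fin.revPerm id).det ≠ 0 := by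
    rw [Matrix.det_of_isLowerTriangular]
    · refine Finset.prod_ne_zero_iff.mpr fun i _ => h1 _ _ ?_
      simp [Fin.val_rev]; omega
    · intro i j hij
      refine h0 _ _ ?_
      have : i < j := hij
      simp [Fin.val_rev]; omega
  rw [Matrix.det_permute] at h
  exact right_ne_zero_of_mul h

theorem linearIndependent_of_det_ne_zero (f : LinearMap.BilinForm F V) {ι : Type*} [Fintype ι]
    [DecidableEq ι] (y x : ι → V) (h : (Matrix.of fun i j => f (y i) (x j)).det ≠ 0) :
    LinearIndependent F x := by
  rw [Fintype.linearIndependent_iff]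
  intro c hc
  have : (Matrix.of fun i j => f (y i) (x j)).mulVec c = 0 := by
    ext i
    have := congrArg (f (y i)) hc
    simpa [Matrix.mulVec, dotProduct, mul_comm] using this
  exact congrFun (Matrix.eq_zero_of_mulVec_eq_zero h this)

/-- The Gram matrix of the two cyclic families is antitriangular, with nonzero multiples of the top
pairing on the antidiagonal. -/
theorem IsAsymmetry.pairing_det {f : LinearMap.BilinForm F V} {σ : Module.End F V}
    (h : IsAsymmetry f σ) {lam μ : F} (hμ : μ * lam = 1) {b a : V} {n : ℕ}
    (ha : (shift σ lam ^ (n + 1)) a = 0) (hba : f b ((shift σ lam ^ n) a) ≠ 0) :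
    (Matrix.of fun i j : Fin (n + 1) =>
      f ((shift σ μ ^ i.val) b) ((shift σ lam ^ j.val) a)).det ≠ 0 := by
  refine det_ne_zero_of_antitriangular _ (fun i j hij => h.pairing_eq_zero hμ ha hij)
    fun i j hij => ?_
  rw [Matrix.of_apply, h.pairing_top hμ ha (by omega)]
  exact mul_ne_zero (pow_ne_zero _ (by simpa using left_ne_zero_of_mul_eq_one hμ)) hba

/-- A vector `v` generating a cyclic module of the same height as a cyclic model space gives an
isometric, equivariant embedding of the model. -/
theorem IsAsymmetry.exists_cyclic_embedding (hF : QuadraticallyClosed F)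
    {f : LinearMap.BilinForm F V} {σ : Module.End F V} (h : IsAsymmetry f σ)
    {g : LinearMap.BilinForm F W} {τ : Module.End F W} (h' : IsAsymmetry g τ) {ε : F}
    (hε : ε * ε = 1) {n : ℕ} {v : V} (hv : (shift σ ε ^ (n + 1)) v = 0)
    (hvv : f v ((shift σ ε ^ n) v) ≠ 0) {w : W} (hw : (shift τ ε ^ (n + 1)) w = 0)
    (hww : g w ((shift τ ε ^ n) w) ≠ 0) (hdim : Module.finrank F W = n + 1) :
    ∃ φ : W →ₗ[F] V, (∀ x y, f (φ x) (φ y) = g x y) ∧ (∀ x, φ (τ x) = σ (φ x)) ∧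
      ∀ S : Submodule F V, v ∈ S → (∀ x ∈ S, shift σ ε x ∈ S) → φ w ∈ S := by
  -- Rescaling `v` by `c` matches its top self-pairing with that of `w`.
  obtain ⟨c, hc⟩ := hF.exists_quadratic (f v ((shift σ ε ^ n) v)) 0
    (-g w ((shift τ ε ^ n) w)) (Or.inl hvv)
  have hc0 : c ≠ 0 := by
    rintro rfl
    exact hww (by simpa using hc)
  -- A vector `(v', w)` with totally isotropic cyclic subspace in `V ⊥ (W, -g)` is exactly a `v'`
  -- whose powers have the same Gram matrix as those of `w`. So matching the two forms reduces to
  -- the isotropic correction, started at `(c v, w)`.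
  let q := prodForm f (-g)
  have hq : IsAsymmetry q (σ.prodMap τ) := fun x y => by simp [q, h x.1 y.1, h' x.2 y.2]
  have hpow : ∀ (k : ℕ) (x : V × W), (shift (σ.prodMap τ) ε ^ k) x =
      ((shift σ ε ^ k) x.1, (shift τ ε ^ k) x.2) := fun k x => Prod.ext
    (shift_pow_map (LinearMap.fst F V W) (fun _ => rfl) ε k x)
    (shift_pow_map (LinearMap.snd F V W) (fun _ => rfl) ε k x)
  let S₀ : Submodule F V := Submodule.span F (Set.range fun k => (shift σ ε ^ k) v)
  have hS₀ : ∀ S : Submodule F V, v ∈ S → (∀ x ∈ S, shift σ ε x ∈ S) → S₀ ≤ S := by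
    intro S hvS hS
    refine Submodule.span_le.mpr ?_
    rintro _ ⟨k, rfl⟩
    induction k with
    | zero => simpa using hvS
    | succ k ih => simp only [pow_succ', Module.End.mul_apply]; exact hS _ ih
  have hvS₀ : v ∈ S₀ := Submodule.subset_span ⟨0, by simp⟩
  have hS₀' : ∀ x ∈ S₀, shift σ ε x ∈ S₀ := by
    intro x hx
    have : S₀ ≤ S₀.comap (shift σ ε) := by
      refine Submodule.span_le.mpr ?_
      rintro _ ⟨k, rfl⟩
      exact Submodule.subset_span ⟨k + 1, by simp only [pow_succ', Module.End.mul_apply]⟩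
    exact this hx
  obtain ⟨⟨v', w'⟩, h1, h2, -, h4⟩ := hq.exists_isotropic hF hε (n := n) (a := (c • v, w))
    (b := (v, 0)) (by rw [hpow]; simp [hv, hw]) (by rw [hpow]; simp [hv])
    (by rw [hpow]; simp [q, hc0, hvv])
    (by rw [hpow]; simp only [q, prodForm_apply, map_smul, LinearMap.smul_apply,
          LinearMap.neg_apply, smul_eq_mul]; linear_combination hc)
    -- The correction is confined to the cyclic subspace of `v` in the first factor, so `w` itself
    -- is not changed.
    (S₀.prod ⊥) ⟨hvS₀, by simp⟩ (fun x hx => ⟨hS₀' _ hx.1, by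
      have : x.2 = 0 := hx.2
      simp [this]⟩)
  obtain rfl : w' = w := sub_eq_zero.mp h1.2
  have hv'S : v' ∈ S₀ := by
    have := S₀.add_mem h1.1 (S₀.smul_mem c hvS₀)
    simpa using this
  have hv' : (shift σ ε ^ (n + 1)) v' = 0 := by
    rw [hpow] at h2; exact congrArg Prod.fst h2
  have hgram : ∀ j k, f ((shift σ ε ^ j) v') ((shift σ ε ^ k) v') =
      g ((shift τ ε ^ j) w') ((shift τ ε ^ k) w') := fun j k => by
    have := hq.self_pairing_eq_zero hε h2 (i := 0) (fun k _ => h4 k) (j := j) (k := k) (by omega)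
    simp only [hpow, q, prodForm_apply, LinearMap.neg_apply] at this
    exact add_neg_eq_zero.mp this
  have hli := linearIndependent_of_det_ne_zero g _ _ (h'.pairing_det hε hw hww)
  have : FiniteDimensional F W := Module.finite_of_finrank_pos (by omega)
  let b := basisOfLinearIndependentOfCardEqFinrank hli (by simp [hdim])
  have hb : ∀ i, b i = (shift τ ε ^ i.val) w' := fun i => by simp [b]
  let φ : W →ₗ[F] V := b.constr F fun i => (shift σ ε ^ i.val) v'
  have hφb : ∀ i, φ (b i) = (shift σ ε ^ i.val) v' := fun i => by simp [φ]
  have hφ : ∀ k, φ ((shift τ ε ^ k) w') = (shift σ ε ^ k) v' := fun k => by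
    rcases Nat.lt_or_ge k (n + 1) with hk | hk
    · rw [← hφb ⟨k, hk⟩, hb]
    · rw [pow_apply_eq_zero_of_le hw hk, pow_apply_eq_zero_of_le hv' hk, map_zero]
  refine ⟨φ, fun x y => ?_, fun x => ?_, fun S hvS hS => ?_⟩
  · have : f.compl₁₂ φ φ = g := LinearMap.ext_basis b b fun i j => by
      rw [LinearMap.compl₁₂_apply, hφb, hφb, hgram, hb, hb]
    exact LinearMap.congr_fun₂ this x y
  · have : φ ∘ₗ τ = σ ∘ₗ φ := b.ext fun i => by
      rw [LinearMap.comp_apply, LinearMap.comp_apply, apply_eq_shift_add τ ε,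
        apply_eq_shift_add σ ε, map_add, map_smul, hφb, hb, ← Module.End.mul_apply, ← pow_succ',
        ← Module.End.mul_apply, ← pow_succ', hφ]
    exact LinearMap.congr_fun this x
  · have := hφ 0
    simp only [pow_zero, Module.End.one_apply] at this
    rw [this]
    exact hS₀ S hvS hS hv'S

/-- A pair of vectors generating totally isotropic cyclic subspaces that are in duality gives an
isometric embedding of a hyperbolic block. -/
theorem IsAsymmetry.exists_hyperbolic_embedding {f : LinearMap.BilinForm F V}
    {σ : Module.End F V} (h : IsAsymmetry f σ) {lam μ : F} (hμ : μ * lam = 1) {b a : V} {n : ℕ}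
    (ha : (shift σ lam ^ (n + 1)) a = 0) (hb : (shift σ μ ^ (n + 1)) b = 0)
    (hba : f b ((shift σ lam ^ n) a) ≠ 0)
    (haa : ∀ j k, f ((shift σ lam ^ j) a) ((shift σ lam ^ k) a) = 0)
    (hbb : ∀ j k, f ((shift σ μ ^ j) b) ((shift σ μ ^ k) b) = 0) :
    ∃ φ : (Fin (n + 1) ⊕ Fin (n + 1) → F) →ₗ[F] V,
      (∀ x y, f (φ x) (φ y) = Matrix.toBilin' (hypBlock (n + 1) lam) x y) ∧
      ∀ x, σ (φ x) ∈ LinearMap.range φ := by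
  -- The order is reversed so that `σ p_j = λ p_j + p_{j-1}`, which makes the Jordan block lower
  -- triangular.
  let p : Fin (n + 1) → V := fun i => (shift σ lam ^ (n - i.val)) a
  let q' : Fin (n + 1) → V := fun j => (shift σ μ ^ j.val) b
  let M : Matrix (Fin (n + 1)) (Fin (n + 1)) F := Matrix.of fun i j => f (q' i) (p j)
  have hM : M.det ≠ 0 := by
    have h1 := h.pairing_det hμ ha hba
    have : M = (Matrix.of fun i j : Fin (n + 1) =>
      f ((shift σ μ ^ i.val) b) ((shift σ lam ^ j.val) a)).submatrix id Fin.revPerm := by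
      ext i j
      simp [M, p, q', Fin.val_rev]
    rw [this, Matrix.det_permute']
    exact mul_ne_zero (by
      rcases Int.units_eq_one_or (Equiv.Perm.sign (Fin.revPerm (n := n + 1))) with h | h <;>
        simp [h]) h1
  have hMu : IsUnit M.det := isUnit_iff_ne_zero.mpr hM
  -- The basis of the cyclic subspace of `b` dual to `p`. Then `f p_i q_j = f q_j (σ p_i)` is the
  -- `(i, j)` entry of `J`.
  let q : Fin (n + 1) → V := fun i => ∑ k, M⁻¹ i k • q' k
  have hqp : ∀ i j, f (q i) (p j) = if i = j then 1 else 0 := fun i j => by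
    have : (M⁻¹ * M) i j = if i = j then 1 else 0 := by
      rw [Matrix.nonsing_inv_mul _ hMu, Matrix.one_apply]
    rw [← this, Matrix.mul_apply]
    simp [q, M, LinearMap.sum_apply]
  have hq'q : ∀ i, q' i = ∑ k, M i k • q k := fun i => by
    have : ∀ l, ∑ k, M i k * M⁻¹ k l = if i = l then 1 else 0 := fun l => by
      rw [← Matrix.mul_apply, Matrix.mul_nonsing_inv _ hMu, Matrix.one_apply]
    simp only [q, Finset.smul_sum, smul_smul]
    rw [Finset.sum_comm]
    simp only [← Finset.sum_smul, this]
    simp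
  have hσp : ∀ j : Fin (n + 1), σ (p j) = lam • p j +
      if hj : 0 < j.val then p ⟨j.val - 1, by omega⟩ else 0 := fun j => by
    rw [apply_eq_shift_add σ lam (p j), add_comm]
    congr 1
    simp only [p]
    rw [← Module.End.mul_apply, ← pow_succ']
    split_ifs with hj
    · congr 2; omega
    · rw [show n - j.val + 1 = n + 1 by omega, ha]
  let e : Fin (n + 1) ⊕ Fin (n + 1) → V := Sum.elim p q
  let φ := (Pi.basisFun F (Fin (n + 1) ⊕ Fin (n + 1))).constr F e
  have hφ : ∀ i, φ (Pi.single i 1) = e i := fun i => by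
    rw [← Pi.basisFun_apply, Module.Basis.constr_basis]
  refine ⟨φ, fun x y => ?_, fun x => ?_⟩
  · have : f.compl₁₂ φ φ = Matrix.toBilin' (hypBlock (n + 1) lam) := by
      refine LinearMap.ext_basis (Pi.basisFun F _) (Pi.basisFun F _) fun i j => ?_
      rw [LinearMap.compl₁₂_apply, Pi.basisFun_apply, Pi.basisFun_apply, hφ, hφ,
        Matrix.toBilin'_single]
      rcases i with i | i <;> rcases j with j | j
      · simp [e, hypBlock, p, haa]
      · simp only [e, hypBlock, Sum.elim_inl, Sum.elim_inr, Matrix.fromBlocks_apply₁₂, jordanBlock,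
          Matrix.of_apply]
        rw [h, hσp, map_add, map_smul, hqp]
        by_cases hi : 0 < i.val
        · simp only [dif_pos hi, hqp, Fin.ext_iff, smul_eq_mul]
          split_ifs <;> first | omega | simp
        · simp only [dif_neg hi, Fin.ext_iff, smul_eq_mul, map_zero]
          split_ifs <;> first | omega | simp
      · simp [e, hypBlock, hqp, Matrix.one_apply]
      · simp [e, hypBlock, q, q', LinearMap.sum_apply, hbb]
    exact LinearMap.congr_fun₂ this x y
  · have hmem : ∀ i, e i ∈ LinearMap.range φ := fun i => ⟨_, hφ i⟩
    have hq' : ∀ i, q' i ∈ LinearMap.range φ := fun i => by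
      rw [hq'q]
      exact Submodule.sum_mem _ fun k _ => Submodule.smul_mem _ _ (hmem (Sum.inr k))
    have hσq' : ∀ i, σ (q' i) ∈ LinearMap.range φ := fun i => by
      rw [apply_eq_shift_add σ μ (q' i)]
      refine Submodule.add_mem _ ?_ (Submodule.smul_mem _ _ (hq' i))
      simp only [q']
      rw [← Module.End.mul_apply, ← pow_succ']
      by_cases hi : i.val + 1 < n + 1
      · exact hq' ⟨i.val + 1, hi⟩
      · rw [show i.val + 1 = n + 1 by omega, hb]; exact Submodule.zero_mem _
    have hσe : ∀ i, σ (e i) ∈ LinearMap.range φ := by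
      rintro (i | i)
      · show σ (p i) ∈ _
        rw [hσp]
        refine Submodule.add_mem _ (Submodule.smul_mem _ _ (hmem (Sum.inl i))) ?_
        split_ifs
        · exact hmem (Sum.inl _)
        · exact Submodule.zero_mem _
      · show σ (q i) ∈ _
        simp only [q, map_sum, map_smul]
        exact Submodule.sum_mem _ fun k _ => Submodule.smul_mem _ _ (hσq' k)
    rw [← (Pi.basisFun F (Fin (n + 1) ⊕ Fin (n + 1))).sum_repr x]
    simp only [map_sum, map_smul, Pi.basisFun_apply, hφ]
    exact Submodule.sum_mem _ fun k _ => Submodule.smul_mem _ _ (hσe k)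

/-- An isometrically embedded non-degenerate space with invariant range is an orthogonal summand.
-/
theorem IsAsymmetry.exists_orthogonal_complement [FiniteDimensional F V] [FiniteDimensional F W]
    {f : LinearMap.BilinForm F V} (hf : f.Nondegenerate) {σ : Module.End F V}
    (h : IsAsymmetry f σ) {g : LinearMap.BilinForm F W} (hg : g.Nondegenerate) (φ : W →ₗ[F] V)
    (hφ : ∀ x y, f (φ x) (φ y) = g x y) (hσ : ∀ x, σ (φ x) ∈ LinearMap.range φ) :
    ∃ W' : Submodule F V, (∀ v ∈ W', σ v ∈ W') ∧ (∀ x, ∀ v ∈ W', f (φ x) v = 0 ∧ f v (φ x) = 0) ∧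
      (∀ v, ∃ x, ∃ w ∈ W', v = φ x + w) ∧ Isometric f (prodForm g (f.restrict W')) := by
  let W' : Submodule F V :=
    { carrier := {v | ∀ x, f (φ x) v = 0}
      add_mem' := fun {u v} hu hv x => by rw [map_add, hu x, hv x, add_zero]
      zero_mem' := fun x => map_zero _
      smul_mem' := fun c v hv x => by rw [map_smul, hv x, smul_zero] }
  have hinj : Function.Injective φ := by
    rw [injective_iff_map_eq_zero]
    exact fun x hx => hg.1 x fun y => by rw [← hφ, hx]; simp
  -- The right orthogonal is also the left one: `σ` maps the range onto itself, and `f v (σ (φ y)) =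
  -- f (φ y) v`.
  have hW' : ∀ x, ∀ v ∈ W', f (φ x) v = 0 ∧ f v (φ x) = 0 := by
    refine fun x v hv => ⟨hv x, ?_⟩
    have hle : (LinearMap.range φ).map σ ≤ LinearMap.range φ := by
      rintro _ ⟨_, ⟨y, rfl⟩, rfl⟩
      exact hσ y
    have heq : (LinearMap.range φ).map σ = LinearMap.range φ :=
      Submodule.eq_of_le_of_finrank_eq hle
        (LinearEquiv.finrank_eq (Submodule.equivMapOfInjective σ (h.injective hf) _)).symm
    obtain ⟨_, ⟨y, rfl⟩, hy⟩ : φ x ∈ (LinearMap.range φ).map σ := by rw [heq]; exact ⟨x, rfl⟩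
    rw [← hy, ← h]
    exact hv y
  -- The projection of `v` is the `φ y` for which `y` represents the functional `x ↦ f (φ x) v`
  -- through `g`.
  have hdec : ∀ v, ∃ x, ∃ w ∈ W', v = φ x + w := fun v => by
    let y := (g.flip.toDual hg.flip).symm ((f.flip v).comp φ)
    have hy : ∀ x, g x y = f (φ x) v := fun x =>
      LinearMap.BilinForm.apply_toDual_symm_apply (hB := hg.flip) ((f.flip v).comp φ) x
    exact ⟨y, v - φ y, fun x => by rw [map_sub, hφ, hy, sub_self], by simp⟩
  refine ⟨W', fun v hv x => ?_, hW', hdec, ?_⟩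
  · rw [← h]; exact (hW' x v hv).2
  · let ψ : (W × W') →ₗ[F] V := φ.coprod W'.subtype
    have hψ : Function.Bijective ψ := by
      constructor
      · rw [injective_iff_map_eq_zero]
        rintro ⟨x, w⟩ hx
        have hx' : φ x + w = 0 := hx
        have hx0 : x = 0 := hg.2 x fun y => by
          rw [← hφ]
          have := congrArg (f (φ y)) hx'
          rwa [map_add, (hW' y w w.2).1, add_zero, map_zero] at this
        subst hx0
        simpa using hx'
      · intro v
        obtain ⟨x, w, hw, rfl⟩ := hdec v
        exact ⟨(x, ⟨w, hw⟩), rfl⟩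
    refine Isometric.symm ⟨LinearEquiv.ofBijective ψ hψ, ?_⟩
    rintro ⟨x, w⟩ ⟨y, z⟩
    show f (φ x + w) (φ y + z) = g x y + f w z
    simp only [map_add, LinearMap.add_apply, hφ, (hW' _ _ z.2).1, (hW' _ _ w.2).2]
    ring

end Embedding

/-! ### Counting Jordan blocks by kernel dimensions; splitting over the ground field. -/

section KernelDimension

variable {F : Type*} [Field F] {V W : Type*} [AddCommGroup V] [Module F V] [AddCommGroup W]
  [Module F W]

/-- The dimension of the kernel of `(σ - c) ^ k`. -/
noncomputable def kerDim (σ : Module.End F V) (c : F) (k : ℕ) : ℕ :=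
  Module.finrank F (LinearMap.ker (shift σ c ^ k))

theorem kerDim_congr {σ : Module.End F V} {τ : Module.End F W} (φ : V ≃ₗ[F] W)
    (h : ∀ v, φ (σ v) = τ (φ v)) (c : F) (k : ℕ) : kerDim σ c k = kerDim τ c k := by
  refine LinearEquiv.finrank_eq (φ.ofSubmodules _ _ ?_)
  ext w
  obtain ⟨v, rfl⟩ := φ.surjective w
  rw [Submodule.mem_map_equiv, φ.symm_apply_apply, LinearMap.mem_ker, LinearMap.mem_ker,
    ← LinearEquiv.coe_coe φ, ← shift_pow_map φ.toLinearMap h, LinearEquiv.coe_coe,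
    LinearEquiv.map_eq_zero_iff]

theorem shift_prodMap_pow (σ : Module.End F V) (τ : Module.End F W) (c : F) (k : ℕ) (x : V × W) :
    (shift (σ.prodMap τ) c ^ k) x = ((shift σ c ^ k) x.1, (shift τ c ^ k) x.2) :=
  Prod.ext (shift_pow_map (LinearMap.fst F V W) (fun _ => rfl) c k x)
    (shift_pow_map (LinearMap.snd F V W) (fun _ => rfl) c k x)

theorem kerDim_prodMap [FiniteDimensional F V] [FiniteDimensional F W] (σ : Module.End F V)
    (τ : Module.End F W) (c : F) (k : ℕ) :
    kerDim (σ.prodMap τ) c k = kerDim σ c k + kerDim τ c k := by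
  have : LinearMap.ker (shift (σ.prodMap τ) c ^ k) =
      (LinearMap.ker (shift σ c ^ k)).prod (LinearMap.ker (shift τ c ^ k)) := by
    ext x
    simp [shift_prodMap_pow, Prod.ext_iff]
  rw [kerDim, this, kerDim, kerDim, ← Module.finrank_prod]
  exact LinearEquiv.finrank_eq
    { toFun := fun x => (⟨x.1.1, x.2.1⟩, ⟨x.1.2, x.2.2⟩)
      invFun := fun y => ⟨(y.1.1, y.2.1), ⟨y.1.2, y.2.2⟩⟩
      map_add' := fun _ _ => rfl
      map_smul' := fun _ _ => rfl
      left_inv := fun _ => rfl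
      right_inv := fun _ => rfl }

/-- The endomorphism of a product acting on each factor. -/
def piEnd {κ : Type*} {M : κ → Type*} [∀ i, AddCommGroup (M i)] [∀ i, Module F (M i)]
    (σ : ∀ i, Module.End F (M i)) : Module.End F (∀ i, M i) :=
  LinearMap.pi fun i => σ i ∘ₗ LinearMap.proj i

section Pi

variable {κ : Type*} {M : κ → Type*} [∀ i, AddCommGroup (M i)] [∀ i, Module F (M i)]

@[simp]
theorem piEnd_apply (σ : ∀ i, Module.End F (M i)) (x : ∀ i, M i) (i : κ) :
    piEnd σ x i = σ i (x i) := rfl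

theorem shift_piEnd_pow (σ : ∀ i, Module.End F (M i)) (c : F) (k : ℕ) (x : ∀ i, M i) (i : κ) :
    (shift (piEnd σ) c ^ k) x i = (shift (σ i) c ^ k) (x i) :=
  shift_pow_map (LinearMap.proj (R := F) (φ := M) i) (fun _ => rfl) c k x

theorem kerDim_piEnd [Fintype κ] [∀ i, FiniteDimensional F (M i)] (σ : ∀ i, Module.End F (M i))
    (c : F) (k : ℕ) : kerDim (piEnd σ) c k = ∑ i, kerDim (σ i) c k := by
  simp only [kerDim]
  rw [← Module.finrank_pi_fintype]
  refine LinearEquiv.finrank_eq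
    { toFun := fun x i => ⟨x.1 i, by
        rw [LinearMap.mem_ker, ← shift_piEnd_pow, LinearMap.mem_ker.mp x.2]; rfl⟩
      invFun := fun y => ⟨fun i => (y i).1, by
        rw [LinearMap.mem_ker]
        ext i
        rw [shift_piEnd_pow]
        exact (y i).2⟩
      map_add' := fun _ _ => rfl
      map_smul' := fun _ _ => rfl
      left_inv := fun _ => rfl
      right_inv := fun _ => rfl }

theorem IsAsymmetry.piEnd [Fintype κ] {f : ∀ i, LinearMap.BilinForm F (M i)}
    {σ : ∀ i, Module.End F (M i)} (h : ∀ i, IsAsymmetry (f i) (σ i)) :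
    IsAsymmetry (piForm f) (piEnd σ) := fun u v => by
  simp only [piForm_apply, piEnd_apply]
  exact Finset.sum_congr rfl fun i _ => h i _ _

theorem piForm_nondegenerate [Fintype κ] {f : ∀ i, LinearMap.BilinForm F (M i)}
    (h : ∀ i, (f i).Nondegenerate) : (piForm f).Nondegenerate := by
  classical
  refine ⟨fun x hx => funext fun i => (h i).1 _ fun y => ?_,
    fun x hx => funext fun i => (h i).2 _ fun y => ?_⟩
  · have := hx (Pi.single i y)
    rw [piForm_apply, Finset.sum_eq_single i] at this
    · simpa using this
    · intro j _ hj; simp [Pi.single_eq_of_ne hj]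
    · simp
  · have := hx (Pi.single i y)
    rw [piForm_apply, Finset.sum_eq_single i] at this
    · simpa using this
    · intro j _ hj; simp [Pi.single_eq_of_ne hj]
    · simp

end Pi

/-- The kernels of `N^0, …, N^(n+1)` increase strictly, and `n + 1` strict steps in dimension `n +
1` must each be by one. -/
theorem finrank_ker_pow_of_single [FiniteDimensional F V] {N : Module.End F V} {n : ℕ}
    (h0 : N ^ (n + 1) = 0) (h1 : N ^ n ≠ 0) (hdim : Module.finrank F V = n + 1) (k : ℕ) :
    Module.finrank F (LinearMap.ker (N ^ k)) = min k (n + 1) := by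
  have hmono : ∀ k, LinearMap.ker (N ^ k) ≤ LinearMap.ker (N ^ (k + 1)) := fun k v hv => by
    rw [LinearMap.mem_ker] at hv ⊢
    rw [pow_succ', Module.End.mul_apply, hv, map_zero]
  have hlt : ∀ k, k ≤ n → Module.finrank F (LinearMap.ker (N ^ k)) <
      Module.finrank F (LinearMap.ker (N ^ (k + 1))) := fun k hk => by
    refine Submodule.finrank_lt_finrank_of_lt (lt_of_le_of_ne (hmono k) fun heq => h1 ?_)
    have e1 := Module.End.ker_pow_constant heq (n - k)
    have e2 := Module.End.ker_pow_constant heq (n + 1 - k)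
    rw [show k + (n - k) = n by omega] at e1
    rw [show k + (n + 1 - k) = n + 1 by omega, h0, LinearMap.ker_zero, e1] at e2
    exact LinearMap.ker_eq_top.mp e2
  have hlow : ∀ k, k ≤ n + 1 → k ≤ Module.finrank F (LinearMap.ker (N ^ k)) := by
    intro k
    induction k with
    | zero => simp
    | succ k ih =>
      intro hk
      have := hlt k (by omega)
      have := ih (by omega)
      omega
  have hup : ∀ r, r ≤ n + 1 →
      Module.finrank F (LinearMap.ker (N ^ (n + 1 - r))) + r ≤ n + 1 := by
    intro r
    induction r with
    | zero => intro _; rw [← hdim]; exact Submodule.finrank_le _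
    | succ r ih =>
      intro hr
      have h2 := hlt (n + 1 - (r + 1)) (by omega)
      rw [show n + 1 - (r + 1) + 1 = n + 1 - r by omega] at h2
      have := ih (by omega)
      omega
  rcases Nat.lt_or_ge k (n + 1) with hk | hk
  · have := hlow k hk.le
    have h3 := hup (n + 1 - k) (by omega)
    rw [show n + 1 - (n + 1 - k) = k by omega] at h3
    omega
  · have : N ^ k = 0 := pow_eq_zero_of_le hk h0
    rw [this, LinearMap.ker_zero, finrank_top, hdim]; omega

theorem kerDim_of_nilpotent_ne {σ : Module.End F V} {ε μ : F} (h : μ ≠ ε) {n : ℕ}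
    (h0 : shift σ ε ^ n = 0) (k : ℕ) : kerDim σ μ k = 0 := by
  have hinj : Function.Injective (shift σ μ) := by
    rw [injective_iff_map_eq_zero]
    intro x hx
    have hx1 : shift σ ε x = (μ - ε) • x := by
      rw [shift_apply] at hx ⊢
      rw [sub_eq_zero.mp hx, sub_smul]
    have hx2 : ∀ k, (shift σ ε ^ k) x = (μ - ε) ^ k • x := fun k => by
      induction k with
      | zero => simp
      | succ k ih => rw [pow_succ', Module.End.mul_apply, ih, map_smul, hx1, smul_smul, pow_succ]
    have := hx2 n
    rw [h0, LinearMap.zero_apply] at this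
    exact (smul_eq_zero.mp this.symm).resolve_left (pow_ne_zero _ (sub_ne_zero.mpr h))
  have hk : LinearMap.ker (shift σ μ ^ k) = ⊥ := by
    rw [LinearMap.ker_eq_bot, Module.End.coe_pow]
    exact hinj.iterate k
  rw [kerDim, hk, finrank_bot]

open Classical in
/-- The number of Jordan blocks of size `k` and eigenvalue `μ` in a Jordan block of size `n` and
eigenvalue `ε`. -/
noncomputable def singleCount (n : ℕ) (ε : F) (k : ℕ) (μ : F) : ℕ := if k = n ∧ μ = ε then 1 else 0

/-- The second difference of `k ↦ min k (n + 1)` is concentrated at `n + 1`. This additive form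
avoids subtraction and passes to orthogonal sums term by term. -/
theorem kerDim_single [FiniteDimensional F V] {σ : Module.End F V} {ε : F} {n : ℕ}
    (h0 : shift σ ε ^ (n + 1) = 0) (h1 : shift σ ε ^ n ≠ 0)
    (hdim : Module.finrank F V = n + 1) (k : ℕ) (μ : F) :
    2 * kerDim σ μ (k + 1) =
      kerDim σ μ k + kerDim σ μ (k + 2) + singleCount (n + 1) ε (k + 1) μ := by
  unfold singleCount
  rcases eq_or_ne μ ε with rfl | hμ
  · simp only [kerDim, finrank_ker_pow_of_single h0 h1 hdim, and_true]
    split_ifs <;> omega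
  · simp [kerDim_of_nilpotent_ne hμ h0, hμ]

/-- Every nonzero invariant subspace contains an eigenvector. -/
def HasEigenvectors (σ : Module.End F V) : Prop :=
  ∀ W : Submodule F V, (∀ v ∈ W, σ v ∈ W) → W ≠ ⊥ → ∃ c : F, ∃ v ∈ W, v ≠ 0 ∧ σ v = c • v

/-- Apply the linear factors one after another to a nonzero vector of the invariant subspace: the
last value before zero is an eigenvector. -/
theorem hasEigenvectors_of_list {σ : Module.End F V} (l : List F)
    (h : (l.map (shift σ)).prod = 0) : HasEigenvectors σ := by
  intro W hW hne
  obtain ⟨v, hv, hv0⟩ := Submodule.exists_mem_ne_zero_of_ne_bot hne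
  have key : ∀ l : List F, (l.map (shift σ)).prod v = 0 ∨ (l.map (shift σ)).prod v ∈ W := by
    intro l
    induction l with
    | nil => right; simpa using hv
    | cons c l ih =>
      rw [List.map_cons, List.prod_cons, Module.End.mul_apply]
      rcases ih with ih | ih
      · left; rw [ih, map_zero]
      · right; rw [shift_apply]; exact W.sub_mem (hW _ ih) (W.smul_mem _ ih)
  have : (l.map (shift σ)).prod v = 0 := by rw [h]; rfl
  clear h
  induction l with
  | nil => exact absurd (by simpa using this) hv0
  | cons c l ih =>
    rw [List.map_cons, List.prod_cons, Module.End.mul_apply] at this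
    by_cases h0 : (l.map (shift σ)).prod v = 0
    · exact ih h0
    · exact ⟨c, _, (key l).resolve_left h0, h0, sub_eq_zero.mp this⟩

theorem HasEigenvectors.of_injective {σ : Module.End F V} {τ : Module.End F W} (φ : V →ₗ[F] W)
    (hφ : Function.Injective φ) (h : ∀ v, φ (σ v) = τ (φ v)) (hτ : HasEigenvectors τ) :
    HasEigenvectors σ := by
  intro U hU hne
  obtain ⟨c, v, ⟨u, hu, rfl⟩, hv0, hc⟩ := hτ (U.map φ) (by
    rintro _ ⟨u, hu, rfl⟩
    exact ⟨_, hU u hu, h u⟩) fun hb => hne (Submodule.map_injective_of_injective hφ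
      (by rw [hb, Submodule.map_bot]))
  exact ⟨c, u, hu, fun h0 => hv0 (by rw [h0, map_zero]), hφ (by rw [h, hc, map_smul])⟩

theorem hasEigenvectors_congr {σ : Module.End F V} {τ : Module.End F W} (φ : V ≃ₗ[F] W)
    (h : ∀ v, φ (σ v) = τ (φ v)) (hσ : HasEigenvectors σ) : HasEigenvectors τ :=
  hσ.of_injective φ.symm.toLinearMap φ.symm.injective fun w => φ.injective (by simp [h])

theorem HasEigenvectors.restrict {σ : Module.End F V} (hσ : HasEigenvectors σ) (U : Submodule F V)
    (hU : ∀ v ∈ U, σ v ∈ U) : HasEigenvectors (LinearMap.restrict σ hU) :=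
  hσ.of_injective U.subtype U.injective_subtype fun _ => rfl

theorem hasEigenvectors_of_splits [FiniteDimensional F V] {σ : Module.End F V}
    (h : (minpoly F σ).Splits) : HasEigenvectors σ := by
  refine hasEigenvectors_of_list (minpoly F σ).roots.toList ?_
  have h1 := h.eq_prod_roots_of_monic (minpoly.monic (Algebra.IsIntegral.isIntegral σ))
  have h2 : aeval σ (((minpoly F σ).roots.toList.map fun a => X - C a).prod) = 0 := by
    rw [← Multiset.prod_coe, ← Multiset.map_coe, Multiset.coe_toList, ← h1, minpoly.aeval]
  rw [map_list_prod, List.map_map] at h2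
  rw [← h2]
  congr 2
  ext c v
  simp [Module.algebraMap_end_apply]

end KernelDimension

/-! ### Forms with a single Jordan block, and alternation at a given height. -/

section CyclicForm

variable {F : Type*} [Field F] {V W : Type*} [AddCommGroup V] [Module F V] [AddCommGroup W]
  [Module F W]

theorem IsAsymmetry.eq {f : LinearMap.BilinForm F V} {σ τ : Module.End F V}
    (hσ : IsAsymmetry f σ) (hτ : IsAsymmetry f τ) (hf : f.Nondegenerate) : σ = τ :=
  LinearMap.ext (hσ.eq_of_isometry hτ hf (LinearEquiv.refl F V) fun _ _ => rfl)

/-- The form is alternating on the Jordan blocks of size `n + 1` and eigenvalue `1`. -/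
def IsAlternatingAt (f : LinearMap.BilinForm F V) (n : ℕ) : Prop :=
  ∀ σ, IsAsymmetry f σ → ∀ v, (shift σ 1 ^ (n + 1)) v = 0 → f v ((shift σ 1 ^ n) v) = 0

theorem IsAlternatingAt.congr {f : LinearMap.BilinForm F V} {g : LinearMap.BilinForm F W} {n : ℕ}
    (hf : IsAlternatingAt f n) (h : Isometric f g) : IsAlternatingAt g n := by
  obtain ⟨φ, hφ⟩ := h
  intro τ hτ w hw
  obtain ⟨v, rfl⟩ := φ.surjective w
  let σ : Module.End F V := φ.symm.toLinearMap ∘ₗ τ ∘ₗ φ.toLinearMap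
  have hσ : IsAsymmetry f σ := fun u v => by
    rw [← hφ, ← hφ]; simp [σ, hτ (φ u)]
  have hστ : ∀ v, φ.toLinearMap (σ v) = τ (φ.toLinearMap v) := fun v => by simp [σ]
  have h1 := fun k => shift_pow_map φ.toLinearMap hστ 1 k v
  simp only [LinearEquiv.coe_coe] at h1
  rw [← h1, hφ]
  refine hf σ hσ v ?_
  rwa [← h1, LinearEquiv.map_eq_zero_iff] at hw

theorem IsAlternatingAt.piForm {κ : Type*} [Fintype κ] {M : κ → Type*} [∀ i, AddCommGroup (M i)]
    [∀ i, Module F (M i)] [∀ i, FiniteDimensional F (M i)]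
    {f : ∀ i, LinearMap.BilinForm F (M i)} (hf : ∀ i, (f i).Nondegenerate) {n : ℕ}
    (h : ∀ i, IsAlternatingAt (f i) n) : IsAlternatingAt (piForm f) n := by
  intro σ hσ v hv
  choose τ hτ using fun i => exists_isAsymmetry (hf i)
  obtain rfl := hσ.eq (IsAsymmetry.piEnd hτ) (piForm_nondegenerate hf)
  rw [piForm_apply]
  refine Finset.sum_eq_zero fun i _ => ?_
  rw [shift_piEnd_pow]
  refine h i _ (hτ i) _ ?_
  rw [← shift_piEnd_pow, hv]; rfl

/-- Non-degenerate forms whose asymmetry is a single Jordan block of size `n + 1` and eigenvalue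
`ε`. -/
structure IsCyclicForm (g : LinearMap.BilinForm F W) (ε : F) (n : ℕ) : Prop where
  nondegenerate : g.Nondegenerate
  finrank_eq : Module.finrank F W = n + 1
  pow_eq_zero : ∀ τ, IsAsymmetry g τ → shift τ ε ^ (n + 1) = 0
  exists_generator : ∀ τ, IsAsymmetry g τ → ∃ w, g w ((shift τ ε ^ n) w) ≠ 0

theorem IsCyclicForm.pow_ne_zero {g : LinearMap.BilinForm F W} {ε : F} {n : ℕ}
    (h : IsCyclicForm g ε n) {τ : Module.End F W} (hτ : IsAsymmetry g τ) : shift τ ε ^ n ≠ 0 := by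
  obtain ⟨w, hw⟩ := h.exists_generator τ hτ
  exact fun h0 => hw (by rw [h0]; simp)

/-- For `m > n` the power `N^m` is zero. For `m < n`, a vector killed by `N^(m+1)` has the form
`N^(n-m) w`, and its self-pairing then has degree beyond its own height. -/
theorem IsCyclicForm.isAlternatingAt {g : LinearMap.BilinForm F W} {n m : ℕ}
    (h : IsCyclicForm g 1 n) (hm : m ≠ n) : IsAlternatingAt g m := by
  intro τ hτ v hv
  have : FiniteDimensional F W := Module.finite_of_finrank_pos (by rw [h.finrank_eq]; omega)
  have h0 := h.pow_eq_zero τ hτ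
  rcases Nat.lt_or_ge n m with hnm | hnm
  · rw [pow_eq_zero_of_le (show n + 1 ≤ m by omega) h0]; simp
  · have hle : LinearMap.range (shift τ 1 ^ (n - m)) ≤ LinearMap.ker (shift τ 1 ^ (m + 1)) := by
      rintro _ ⟨x, rfl⟩
      rw [LinearMap.mem_ker, ← Module.End.mul_apply, ← pow_add,
        show m + 1 + (n - m) = n + 1 by omega, h0, LinearMap.zero_apply]
    have hker := finrank_ker_pow_of_single h0 (h.pow_ne_zero hτ) h.finrank_eq
    have heq := Submodule.eq_of_le_of_finrank_eq hle (by
      have := LinearMap.finrank_range_add_finrank_ker (shift τ 1 ^ (n - m))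
      rw [hker, h.finrank_eq] at this
      rw [hker]
      omega)
    obtain ⟨w, hw⟩ : v ∈ LinearMap.range (shift τ 1 ^ (n - m)) := by rw [heq]; exact hv
    have := hτ.pairing_eq_zero (one_mul 1) (b := w) hv (j := n - m) (k := m) (by omega)
    rwa [hw] at this

end CyclicForm

/-! ### The matrices `Γ_n`, `Γ_n^0` and the Jordan blocks. -/

section Models

variable {F : Type*} [Field F]

/-- In matrix terms `σ - ε = A⁻¹ (Aᵀ - εA)`. Here `A` is antitriangular and `Aᵀ - εA` lives on the
next antidiagonal, without zeros there, so `σ - ε` is strictly triangular with nonzero entries next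
to the diagonal: a single Jordan block, generated by the last basis vector. -/
theorem isCyclicForm_toBilin' {n : ℕ} {ε : F} (A : Matrix (Fin (n + 1)) (Fin (n + 1)) F)
    (h0 : ∀ i j, i.val + j.val ≠ n → i.val + j.val ≠ n + 1 → A i j = 0)
    (h1 : ∀ i j, i.val + j.val = n → A i j ≠ 0)
    (h2 : ∀ i j, i.val + j.val = n → A j i = ε * A i j)
    (h3 : ∀ i j, i.val + j.val = n + 1 → A j i - ε * A i j ≠ 0) :
    IsCyclicForm (Matrix.toBilin' A) ε n := by
  have hdet : A.det ≠ 0 := by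
    rw [← Matrix.det_submatrix_equiv_self Fin.revPerm]
    refine det_ne_zero_of_antitriangular _ (fun i j hij => h0 _ _ ?_ ?_) fun i j hij => h1 _ _ ?_
    all_goals simp [Fin.val_rev]; omega
  have hnd : (Matrix.toBilin' A).Nondegenerate :=
    (Matrix.nondegenerate_of_det_ne_zero hdet).toBilin'
  set g := Matrix.toBilin' A with hg
  have hgx : ∀ (i : Fin (n + 1)) (x : Fin (n + 1) → F), g (Pi.single i 1) x = ∑ j, A i j * x j :=
    fun i x => by
      rw [hg, Matrix.toBilin'_apply', single_dotProduct, one_mul]; rfl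
  have hxg : ∀ (i : Fin (n + 1)) (x : Fin (n + 1) → F), g x (Pi.single i 1) = ∑ j, A j i * x j :=
    fun i x => by simp [g, Matrix.toBilin'_apply', dotProduct, mul_comm]
  have key : ∀ τ, IsAsymmetry g τ → ∀ (k : ℕ) (x : Fin (n + 1) → F),
      (∀ j : Fin (n + 1), k + 1 ≤ j.val → x j = 0) →
      (∀ j : Fin (n + 1), k ≤ j.val → shift τ ε x j = 0) ∧
      ∀ j j' : Fin (n + 1), j.val + 1 = k → j'.val = k → x j' ≠ 0 → shift τ ε x j ≠ 0 := by
    intro τ hτ k x hx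
    set y := shift τ ε x with hy
    have hpair : ∀ i : Fin (n + 1), ∑ j, A i j * y j = ∑ j, (A j i - ε * A i j) * x j := by
      intro i
      rw [← hgx, hy, shift_apply, map_sub, map_smul, ← hτ, hgx, hxg, smul_eq_mul,
        Finset.mul_sum, ← Finset.sum_sub_distrib]
      exact Finset.sum_congr rfl fun j _ => by ring
    -- evaluate the right-hand side and the left-hand side
    have hrhs : ∀ j : Fin (n + 1), ∀ i : Fin (n + 1), i.val + j.val = n → k ≤ j.val →
        ∑ l, (A l i - ε * A i l) * x l = 0 := fun j i hij hkj =>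
      Finset.sum_eq_zero fun l _ => by
        by_cases hl : k + 1 ≤ l.val
        · rw [hx l hl, mul_zero]
        · rcases eq_or_ne (i.val + l.val) n with h | h
          · rw [h2 i l h, sub_self, zero_mul]
          · rw [h0 i l h (by omega), h0 l i (by omega) (by omega)]; simp
    have hlhs : ∀ j i : Fin (n + 1), i.val + j.val = n →
        (∀ l : Fin (n + 1), l.val = j.val + 1 → y l = 0) → ∑ l, A i l * y l = A i j * y j :=
      fun j i hij hl => by
        rw [Finset.sum_eq_single j]
        · intro l _ hlj
          by_cases h : l.val = j.val + 1
          · rw [hl l h, mul_zero]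
          · have := Fin.val_ne_of_ne hlj
            rw [h0 i l (by omega) (by omega), zero_mul]
        · simp
    -- Back substitution in the antitriangular system `A y = (Aᵀ - εA) x`, from the last coordinate
    -- down.
    have hzero : ∀ r, ∀ j : Fin (n + 1), n ≤ j.val + r → k ≤ j.val → y j = 0 := by
      intro r
      induction r with
      | zero =>
        intro j hj hk
        have e1 := hlhs j ⟨n - j.val, by omega⟩ (by simp; omega) fun l hl => by omega
        rw [hpair, hrhs j _ (by simp; omega) hk] at e1
        exact (mul_eq_zero.mp e1.symm).resolve_left (h1 _ _ (by simp; omega))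
      | succ r ih =>
        intro j hj hk
        have e1 := hlhs j ⟨n - j.val, by omega⟩ (by simp; omega) fun l hl =>
          ih l (by omega) (by omega)
        rw [hpair, hrhs j _ (by simp; omega) hk] at e1
        exact (mul_eq_zero.mp e1.symm).resolve_left (h1 _ _ (by simp; omega))
    refine ⟨fun j hj => hzero n j (by omega) hj, fun j j' hj hj' hxj hyj => ?_⟩
    have e1 := hlhs j ⟨n - j.val, by omega⟩ (by simp; omega) fun l hl =>
      hzero n l (by omega) (by omega)
    rw [hpair, hyj, mul_zero, Finset.sum_eq_single j'] at e1
    · exact mul_ne_zero (h3 _ _ (by simp; omega)) hxj e1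
    · intro l _ hl
      by_cases hlk : k + 1 ≤ l.val
      · rw [hx l hlk, mul_zero]
      · have := Fin.val_ne_of_ne hl
        rcases eq_or_ne (n - j.val + l.val) n with h | h
        · rw [h2 _ _ h, sub_self, zero_mul]
        · rw [h0 _ l h (by simp; omega), h0 l _ (by simp; omega) (by simp; omega)]; simp
    · simp
  refine ⟨hnd, by simp, fun τ hτ => ?_, fun τ hτ => ⟨Pi.single (Fin.last n) 1, ?_⟩⟩
  · have : ∀ r (x : Fin (n + 1) → F), r ≤ n + 1 →
        ∀ j : Fin (n + 1), n + 1 ≤ j.val + r → (shift τ ε ^ r) x j = 0 := by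
      intro r x
      induction r with
      | zero => intro _ j hj; omega
      | succ r ih =>
        intro hr j hj
        rw [pow_succ', Module.End.mul_apply]
        exact (key τ hτ (n - r) _ fun j hj => ih (by omega) j (by omega)).1 j (by omega)
    exact LinearMap.ext fun x => funext fun j => this (n + 1) x le_rfl j (by omega)
  · have : ∀ r, r ≤ n →
        (∀ j : Fin (n + 1), n + 1 ≤ j.val + r →
          (shift τ ε ^ r) (Pi.single (Fin.last n) 1) j = 0) ∧
        ∀ j : Fin (n + 1), j.val + r = n →
          (shift τ ε ^ r) (Pi.single (Fin.last n) 1) j ≠ 0 := by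
      intro r
      induction r with
      | zero =>
        refine fun _ => ⟨fun j hj => by omega, fun j hj => ?_⟩
        obtain rfl : j = Fin.last n := Fin.ext (by simpa using hj)
        simp
      | succ r ih =>
        intro hr
        obtain ⟨i1, i2⟩ := ih (by omega)
        have := key τ hτ (n - r) ((shift τ ε ^ r) (Pi.single (Fin.last n) 1))
          fun j hj => i1 j (by omega)
        rw [pow_succ', Module.End.mul_apply]
        exact ⟨fun j hj => this.1 j (by omega), fun j hj => this.2 j ⟨n - r, by omega⟩ (by omega)
          rfl (i2 _ (by simp; omega))⟩
    obtain ⟨t1, t2⟩ := this n le_rfl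
    rw [hgx, Finset.sum_eq_single 0]
    · exact mul_ne_zero (h1 _ _ (by simp)) (t2 _ (by simp))
    · intro j _ hj
      have : j.val ≠ 0 := fun h => hj (Fin.ext h)
      rw [t1 j (by omega), mul_zero]
    · simp

theorem two_ne_zero_of_ringChar (h : ringChar F ≠ 2) : (2 : F) ≠ 0 := fun h2 =>
  h (CharP.ringChar_of_prime_eq_zero Nat.prime_two (by exact_mod_cast h2))

theorem two_eq_zero_of_ringChar (h : ringChar F = 2) : (2 : F) = 0 := by
  have := ringChar.Nat.cast_ringChar (R := F)
  rw [h] at this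
  exact_mod_cast this

/-- On the second antidiagonal `Aᵀ - εA` has entries `±2`, whence the restriction on the
characteristic. -/
theorem isCyclicForm_gam (h : ringChar F ≠ 2) (n : ℕ) :
    IsCyclicForm (Matrix.toBilin' (Gam F (n + 1))) ((-1) ^ n) n := by
  have h2 := two_ne_zero_of_ringChar h
  have hsq : ∀ k : ℕ, ((-1 : F) ^ k) * (-1) ^ k = 1 := fun k => by rw [← mul_pow]; simp
  refine isCyclicForm_toBilin' _ (fun i j h1 h2 => ?_) (fun i j h1 => ?_) (fun i j h1 => ?_)
    fun i j h1 => ?_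
  · simp only [Gam, Matrix.of_apply]
    rw [if_neg (by omega)]
  · simp only [Gam, Matrix.of_apply]
    rw [if_pos (by omega)]
    exact pow_ne_zero _ (by simp)
  · simp only [Gam, Matrix.of_apply]
    rw [if_pos (by omega), if_pos (by omega), show n + 1 - (j.val + 1) = i.val by omega,
      show n + 1 - (i.val + 1) = j.val by omega,
      show (-1 : F) ^ n = (-1) ^ i.val * (-1) ^ j.val by rw [← pow_add, h1]]
    linear_combination -(-1 : F) ^ i.val * hsq j.val
  · simp only [Gam, Matrix.of_apply]
    obtain ⟨a, ha⟩ : ∃ a, i.val = a + 1 := ⟨i.val - 1, by omega⟩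
    rw [if_pos (by omega), if_pos (by omega), show n + 1 - (j.val + 1) = a by omega,
      show n + 1 - (i.val + 1) = j.val - 1 by omega]
    obtain ⟨b, hb⟩ : ∃ b, j.val = b + 1 := ⟨j.val - 1, by omega⟩
    rw [show (-1 : F) ^ n = (-1) ^ (a + b + 1) by congr 1; omega, hb, Nat.add_sub_cancel, pow_succ, pow_add]
    have : (-1 : F) ^ a - (-1) ^ a * (-1) ^ b * -1 * (-1) ^ b = 2 * (-1) ^ a := by
      linear_combination (-1 : F) ^ a * hsq b
    rw [this]
    exact mul_ne_zero h2 (pow_ne_zero _ (by simp))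

/-- For even `n` the second antidiagonal `i + j = n + 1` misses the main diagonal, and of two
transposed entries on it exactly one is `1`; so `Aᵀ - A` has entries `±1` there. -/
theorem isCyclicForm_gamZero (n : ℕ) (hn : Even n) :
    IsCyclicForm (Matrix.toBilin' (GamZero F (n + 1))) 1 n := by
  obtain ⟨r, rfl⟩ := hn
  refine isCyclicForm_toBilin' _ (fun i j h1 h2 => ?_) (fun i j h1 => ?_) (fun i j h1 => ?_)
    fun i j h1 => ?_
  · simp only [GamZero, Matrix.of_apply]
    rw [if_neg (by omega)]
  · simp only [GamZero, Matrix.of_apply]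
    rw [if_pos (by omega)]
    exact one_ne_zero
  · simp only [GamZero, Matrix.of_apply]
    rw [if_pos (by omega), if_pos (by omega), one_mul]
  · simp only [GamZero, Matrix.of_apply]
    split_ifs
    · omega
    · simp
    · simp
    · omega

theorem jordanBlock_transpose_shift (m : ℕ) (c : F) (k : ℕ) (x : Fin m → F) (i : Fin m) :
    (shift (Matrix.toLin' (jordanBlock m c).transpose) c ^ k) x i =
      if h : i.val + k < m then x ⟨i.val + k, h⟩ else 0 := by
  have h1 : ∀ (x : Fin m → F) (i : Fin m),
      shift (Matrix.toLin' (jordanBlock m c).transpose) c x i =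
      if h : i.val + 1 < m then x ⟨i.val + 1, h⟩ else 0 := by
    intro x i
    have : ∀ j : Fin m, jordanBlock m c j i = (if j = i then c else 0) +
        if j.val = i.val + 1 then 1 else 0 := fun j => by
      simp only [jordanBlock, Matrix.of_apply, Fin.ext_iff]
      split_ifs <;> first | omega | simp
    simp only [shift_apply, Matrix.toLin'_apply, Matrix.mulVec, dotProduct, Pi.sub_apply,
      Matrix.transpose_apply, this, Pi.smul_apply, smul_eq_mul, add_mul, Finset.sum_add_distrib]
    have e1 : ∑ j : Fin m, (if j = i then c else 0) * x j = c * x i := by simp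
    rw [e1, add_sub_cancel_left]
    split_ifs with h
    · rw [Finset.sum_eq_single ⟨i.val + 1, h⟩]
      · simp
      · intro j _ hj
        rw [if_neg (fun h' => hj (Fin.ext h')), zero_mul]
      · simp
    · exact Finset.sum_eq_zero fun j _ => by rw [if_neg (by omega), zero_mul]
  induction k generalizing i with
  | zero => simp
  | succ k ih =>
    rw [pow_succ', Module.End.mul_apply, h1]
    split_ifs with h2 h3 h3
    · rw [ih, dif_pos (by simp; omega)]
      congr 1; ext; simp; omega
    · rw [ih, dif_neg (by simp; omega)]
    · omega
    · rfl

theorem jordanBlock_det (m : ℕ) (c : F) : (jordanBlock m c).det = c ^ m := by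
  rw [Matrix.det_of_isLowerTriangular]
  · simp [jordanBlock]
  · intro i j hij
    have : i < j := hij
    simp only [jordanBlock, Matrix.of_apply]
    rw [if_neg (by omega), if_neg (by omega)]

end Models

/-! ### Hyperbolic blocks: their asymmetry `Jᵀ ⊕ J⁻¹` and the exchange of `c` with `c⁻¹`. -/

section Hyperbolic

variable {F : Type*} [Field F]

/-- The form of a hyperbolic block, on a product of two coordinate spaces. -/
noncomputable def hypPair (m : ℕ) (c : F) : LinearMap.BilinForm F ((Fin m → F) × (Fin m → F)) :=
  (Matrix.toBilin' (hypBlock m c)).compl₁₂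
    (LinearEquiv.sumArrowLequivProdArrow (Fin m) (Fin m) F F).symm.toLinearMap
    (LinearEquiv.sumArrowLequivProdArrow (Fin m) (Fin m) F F).symm.toLinearMap

theorem hypPair_isometric (m : ℕ) (c : F) :
    Isometric (hypPair m c) (Matrix.toBilin' (hypBlock m c)) :=
  ⟨(LinearEquiv.sumArrowLequivProdArrow (Fin m) (Fin m) F F).symm, fun _ _ => rfl⟩

open Matrix in
theorem hypPair_apply (m : ℕ) (c : F) (x y : (Fin m → F) × (Fin m → F)) :
    hypPair m c x y = x.1 ⬝ᵥ (jordanBlock m c *ᵥ y.2) + x.2 ⬝ᵥ y.1 := by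
  have h : ∀ z : (Fin m → F) × (Fin m → F),
      (LinearEquiv.sumArrowLequivProdArrow (Fin m) (Fin m) F F).symm z = Sum.elim z.1 z.2 :=
    fun _ => rfl
  rw [hypPair, LinearMap.compl₁₂_apply, LinearEquiv.coe_coe, h, h, Matrix.toBilin'_apply', hypBlock,
    fromBlocks_mulVec, sumElim_dotProduct_sumElim]
  simp

/-- The asymmetry of `hypPair m c`. -/
noncomputable def hypEnd (m : ℕ) (c : F) : Module.End F ((Fin m → F) × (Fin m → F)) :=
  (Matrix.toLin' (jordanBlock m c).transpose).prodMap (Matrix.toLin' (jordanBlock m c)⁻¹)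

theorem isUnit_det_jordanBlock (m : ℕ) {c : F} (hc : c ≠ 0) : IsUnit (jordanBlock m c).det := by
  rw [jordanBlock_det]
  exact (IsUnit.mk0 c hc).pow m

theorem isAsymmetry_hypEnd (m : ℕ) {c : F} (hc : c ≠ 0) :
    IsAsymmetry (hypPair m c) (hypEnd m c) := fun u v => by
  rw [hypPair_apply, hypPair_apply]
  simp only [hypEnd, LinearMap.prodMap_apply, Matrix.toLin'_apply, Matrix.mulVec_mulVec,
    Matrix.mul_nonsing_inv _ (isUnit_det_jordanBlock m hc), Matrix.one_mulVec]
  rw [Matrix.dotProduct_mulVec, ← Matrix.mulVec_transpose, add_comm, dotProduct_comm v.2,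
    dotProduct_comm u.2]

theorem hypPair_nondegenerate (m : ℕ) {c : F} (hc : c ≠ 0) : (hypPair m c).Nondegenerate := by
  have hJ := isUnit_det_jordanBlock m hc
  refine ⟨fun x hx => ?_, fun x hx => ?_⟩
  · have h2 : x.2 = 0 := dotProduct_eq _ _ fun u => by
      have := hx (u, 0)
      rw [hypPair_apply] at this
      simpa using this
    have h1 : x.1 = 0 := dotProduct_eq _ _ fun u => by
      have := hx (0, (jordanBlock m c)⁻¹.mulVec u)
      rw [hypPair_apply, Matrix.mulVec_mulVec, Matrix.mul_nonsing_inv _ hJ] at this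
      simpa using this
    exact Prod.ext h1 h2
  · have h1 : x.1 = 0 := dotProduct_eq _ _ fun u => by
      have := hx (0, u)
      rw [hypPair_apply] at this
      simpa [dotProduct_comm] using this
    have h2 : (jordanBlock m c).mulVec x.2 = 0 := dotProduct_eq _ _ fun u => by
      have := hx (u, 0)
      rw [hypPair_apply] at this
      simpa [dotProduct_comm] using this
    exact Prod.ext h1 (Matrix.eq_zero_of_mulVec_eq_zero hJ.ne_zero h2)

theorem shift_toLin'_pow {m : ℕ} (M : Matrix (Fin m) (Fin m) F) (c : F) (k : ℕ) :
    shift (Matrix.toLin' M) c ^ k = Matrix.toLin' ((M - c • 1) ^ k) := by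
  rw [Matrix.toLin'_pow, map_sub, map_smul, Matrix.toLin'_one]; rfl

/-- `J⁻¹ - c⁻¹ = -c⁻¹ J⁻¹ (J - c)` with commuting factors, so `J⁻¹` is again a single Jordan block
of the same size. -/
theorem jordanBlock_inv_shift_pow_eq_zero_iff (m : ℕ) {c : F} (hc : c ≠ 0) (k : ℕ) :
    shift (Matrix.toLin' (jordanBlock m c)⁻¹) c⁻¹ ^ k = 0 ↔
      shift (Matrix.toLin' (jordanBlock m c).transpose) c ^ k = 0 := by
  have hJ := isUnit_det_jordanBlock m hc
  set J := jordanBlock m c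
  rw [shift_toLin'_pow, shift_toLin'_pow, LinearEquiv.map_eq_zero_iff,
    LinearEquiv.map_eq_zero_iff]
  have h1 : J.transpose - c • 1 = (J - c • 1).transpose := by simp
  have h2 : J⁻¹ - c⁻¹ • 1 = -c⁻¹ • (J⁻¹ * (J - c • 1)) := by
    rw [mul_sub, Matrix.nonsing_inv_mul _ hJ, smul_sub, mul_smul_comm, smul_smul, mul_one]
    simp [hc, sub_eq_add_neg, add_comm]
  have hcomm : Commute J⁻¹ (J - c • 1) := by
    refine Commute.sub_right ?_ ((Commute.one_right _).smul_right _)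
    rw [Commute, SemiconjBy, Matrix.nonsing_inv_mul _ hJ, Matrix.mul_nonsing_inv _ hJ]
  have hu : IsUnit (J⁻¹ ^ k) := ((Matrix.isUnit_nonsing_inv_iff).mpr
    ((Matrix.isUnit_iff_isUnit_det _).mpr hJ)).pow k
  rw [h1, h2, ← Matrix.transpose_pow, Matrix.transpose_eq_zero, _root_.smul_pow, hcomm.mul_pow,
    smul_eq_zero_iff_right (pow_ne_zero _ (neg_ne_zero.mpr (inv_ne_zero hc))), hu.mul_right_eq_zero]

theorem jordanBlock_transpose_shift_pow_eq_zero (m : ℕ) (c : F) :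
    shift (Matrix.toLin' (jordanBlock m c).transpose) c ^ m = 0 :=
  LinearMap.ext fun x => funext fun i => by
    rw [jordanBlock_transpose_shift, dif_neg (by omega)]; rfl

theorem jordanBlock_transpose_shift_pow_ne_zero (n : ℕ) (c : F) :
    shift (Matrix.toLin' (jordanBlock (n + 1) c).transpose) c ^ n ≠ 0 := fun h => by
  have := congrFun (LinearMap.congr_fun h (Pi.single (Fin.last n) 1)) 0
  rw [jordanBlock_transpose_shift, dif_pos (by simp)] at this
  have h2 : (⟨((0 : Fin (n + 1)) : ℕ) + n, by simp⟩ : Fin (n + 1)) = Fin.last n := Fin.ext (by simp)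
  rw [h2] at this
  simp at this

/-- The number of Jordan blocks of size `k` and eigenvalue `μ` in the asymmetry of
`hypBlock m c`. -/
noncomputable def hypCount (m : ℕ) (c : F) (k : ℕ) (μ : F) : ℕ :=
  singleCount m c k μ + singleCount m c⁻¹ k μ

theorem kerDim_hypEnd (n : ℕ) {c : F} (hc : c ≠ 0) (k : ℕ) (μ : F) :
    2 * kerDim (hypEnd (n + 1) c) μ (k + 1) = kerDim (hypEnd (n + 1) c) μ k +
      kerDim (hypEnd (n + 1) c) μ (k + 2) + hypCount (n + 1) c (k + 1) μ := by
  have h1 := kerDim_single (jordanBlock_transpose_shift_pow_eq_zero (n + 1) c)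
    (jordanBlock_transpose_shift_pow_ne_zero n c) (by simp) k μ
  have h2 := kerDim_single ((jordanBlock_inv_shift_pow_eq_zero_iff (n + 1) hc (n + 1)).mpr
    (jordanBlock_transpose_shift_pow_eq_zero (n + 1) c))
    (mt (jordanBlock_inv_shift_pow_eq_zero_iff (n + 1) hc n).mp
    (jordanBlock_transpose_shift_pow_ne_zero n c)) (by simp) k μ
  simp only [hypEnd, kerDim_prodMap, hypCount]
  omega

theorem hasEigenvectors_hypEnd (m : ℕ) {c : F} (hc : c ≠ 0) : HasEigenvectors (hypEnd m c) := by
  refine hasEigenvectors_of_list (List.replicate m c ++ List.replicate m c⁻¹) ?_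
  rw [List.map_append, List.prod_append, List.map_replicate, List.map_replicate,
    List.prod_replicate, List.prod_replicate]
  have h1 := jordanBlock_transpose_shift_pow_eq_zero m c
  have h2 := (jordanBlock_inv_shift_pow_eq_zero_iff m hc m).mpr h1
  refine LinearMap.ext fun x => ?_
  rw [Module.End.mul_apply]
  refine Prod.ext ?_ ?_
  · rw [hypEnd, shift_prodMap_pow, shift_prodMap_pow]
    simp [h1]
  · rw [hypEnd, shift_prodMap_pow, shift_prodMap_pow]
    simp [h2]

/-- Both factors are invariant and totally isotropic, so only the two cross terms remain. By
`top_swap` they agree up to sign, and their sum is zero in characteristic two. -/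
theorem hypPair_isAlternatingAt (h2 : (2 : F) = 0) (m : ℕ) {c : F} (hc : c ≠ 0) (n : ℕ) :
    IsAlternatingAt (hypPair m c) n := by
  intro τ hτ v hv
  obtain rfl := hτ.eq (isAsymmetry_hypEnd m hc) (hypPair_nondegenerate m hc)
  obtain ⟨p, q⟩ := v
  have hpow := fun x => shift_prodMap_pow (Matrix.toLin' (jordanBlock m c).transpose)
    (Matrix.toLin' (jordanBlock m c)⁻¹) 1 n x
  have hq : (shift (hypEnd m c) 1 ^ (n + 1)) (0, q) = 0 := by
    rw [hypEnd, shift_prodMap_pow] at hv ⊢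
    have := (Prod.ext_iff.mp hv).2
    exact Prod.ext (by simp) this
  have hswap := hτ.top_swap (one_mul 1) (a := (p, 0)) hq
  rw [one_mul] at hswap
  have hsplit : ((p, q) : (Fin m → F) × (Fin m → F)) = (p, 0) + (0, q) := by simp
  have hpp : hypPair m c (p, 0) ((shift (hypEnd m c) 1 ^ n) (p, 0)) = 0 := by
    rw [hypEnd, hpow, hypPair_apply]; simp
  have hqq : hypPair m c (0, q) ((shift (hypEnd m c) 1 ^ n) (0, q)) = 0 := by
    rw [hypEnd, hpow, hypPair_apply]; simp
  rw [hsplit]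
  simp only [map_add, LinearMap.add_apply, hpp, hqq, hswap]
  rcases neg_one_pow_eq_or F n with h | h <;> rw [h]
  · linear_combination (hypPair m c (p, 0) ((shift (hypEnd m c) 1 ^ n) (0, q))) * h2
  · ring

/-- The two isotropic factors trade roles: cyclic vectors, first for `c⁻¹` and then for `c`, embed
the block of `c⁻¹` into that of `c`, and the dimensions agree. -/
theorem hypBlock_inv_isometric (n : ℕ) {c : F} (hc : c ≠ 0) :
    Isometric (Matrix.toBilin' (hypBlock (n + 1) c⁻¹)) (Matrix.toBilin' (hypBlock (n + 1) c)) := by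
  refine Isometric.trans ?_ (hypPair_isometric (n + 1) c)
  have h1 := jordanBlock_transpose_shift_pow_eq_zero (n + 1) c
  have h2 := (jordanBlock_inv_shift_pow_eq_zero_iff (n + 1) hc (n + 1)).mpr h1
  have h3 := mt (jordanBlock_inv_shift_pow_eq_zero_iff (n + 1) hc n).mp
    (jordanBlock_transpose_shift_pow_ne_zero n c)
  obtain ⟨q, hq⟩ : ∃ q, (shift (Matrix.toLin' (jordanBlock (n + 1) c)⁻¹) c⁻¹ ^ n) q ≠ 0 := by
    by_contra! h
    exact h3 (LinearMap.ext h)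
  have hJq : (jordanBlock (n + 1) c).mulVec
      ((shift (Matrix.toLin' (jordanBlock (n + 1) c)⁻¹) c⁻¹ ^ n) q) ≠ 0 := fun h =>
    hq (Matrix.eq_zero_of_mulVec_eq_zero (isUnit_det_jordanBlock (n + 1) hc).ne_zero h)
  obtain ⟨i, hi⟩ := Function.ne_iff.mp hJq
  obtain ⟨φ, hφ, -⟩ := (isAsymmetry_hypEnd (n + 1) hc).exists_hyperbolic_embedding
    (lam := c⁻¹) (μ := c) (mul_inv_cancel₀ hc) (b := (Pi.single i 1, 0)) (a := (0, q)) (n := n)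
    (by rw [hypEnd, shift_prodMap_pow, h2]; simp)
    (by rw [hypEnd, shift_prodMap_pow, h1]; simp)
    (by rw [hypEnd, shift_prodMap_pow, hypPair_apply]; simpa using hi)
    (fun j k => by rw [hypEnd, shift_prodMap_pow, shift_prodMap_pow, hypPair_apply]; simp)
    (fun j k => by rw [hypEnd, shift_prodMap_pow, shift_prodMap_pow, hypPair_apply]; simp)
  have hinj : Function.Injective φ := by
    rw [injective_iff_map_eq_zero]
    have hnd := (hypPair_isometric (n + 1) c⁻¹).nondegenerate
      (hypPair_nondegenerate (n + 1) (inv_ne_zero hc))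
    exact fun x hx => hnd.1 x fun y => by rw [← hφ, hx]; simp
  exact ⟨LinearEquiv.ofInjectiveOfFinrankEq φ hinj (by simp), hφ⟩

end Hyperbolic

/-! ### The invariants of the canonical blocks and of their sums. -/

namespace Block

variable {K : Type*} [Field K]

/-- The bilinear form of a block. -/
noncomputable def form (b : Block K) : LinearMap.BilinForm K (b.Index → K) :=
  Matrix.toBilin' b.matrix

/-- The number of Jordan blocks of size `k` and eigenvalue `μ` in the asymmetry of a block. -/
noncomputable def jordanCount : Block K → ℕ → K → ℕ
  | A n => singleCount n 1
  | B n => singleCount n 1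
  | C n => singleCount n (-1)
  | D m => hypCount m 1
  | E m => hypCount m 1
  | F m => hypCount m (-1)
  | G m c => hypCount m c

/-- The seven families fall into two kinds, cyclic and hyperbolic, which suffice for nondegeneracy,
eigenvectors and Jordan counts. -/
theorem Valid.cases {b : Block K} (hb : b.Valid) :
    (∃ n ε, IsCyclicForm b.form ε n ∧ b.jordanCount = singleCount (n + 1) ε) ∨
    ∃ n c, c ≠ 0 ∧ Isometric (hypPair (n + 1) c) b.form ∧
      b.jordanCount = hypCount (n + 1) c := by
  rcases b with n | n | n | m | m | m | ⟨m, c⟩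
  · left
    obtain ⟨⟨r, rfl⟩, h⟩ := hb
    refine ⟨2 * r, 1, ?_, rfl⟩
    have := isCyclicForm_gam h (2 * r)
    rwa [pow_mul, neg_one_sq, one_pow] at this
  · left
    obtain ⟨⟨r, rfl⟩, h⟩ := hb
    exact ⟨2 * r, 1, isCyclicForm_gamZero (2 * r) (even_two_mul r), rfl⟩
  · left
    obtain ⟨⟨r, rfl⟩, h0, h⟩ := hb
    obtain ⟨r, rfl⟩ : ∃ t, r = t + 1 := ⟨r - 1, by omega⟩
    refine ⟨r + 1 + r, -1, ?_, rfl⟩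
    have := isCyclicForm_gam h (r + 1 + r)
    rwa [show (-1 : K) ^ (r + 1 + r) = -1 by
      rw [show r + 1 + r = 2 * r + 1 by ring, pow_succ, pow_mul]; simp] at this
  · right
    obtain ⟨n, rfl⟩ : ∃ n, m = n + 1 := ⟨m - 1, by have := hb.2; omega⟩
    exact ⟨n, 1, one_ne_zero, hypPair_isometric _ _, rfl⟩
  · right
    obtain ⟨n, rfl⟩ : ∃ n, m = n + 1 := ⟨m - 1, by have := hb.1.pos; omega⟩
    exact ⟨n, 1, one_ne_zero, hypPair_isometric _ _, rfl⟩
  · right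
    obtain ⟨n, rfl⟩ : ∃ n, m = n + 1 := ⟨m - 1, by have := hb.1.pos; omega⟩
    exact ⟨n, -1, neg_ne_zero.mpr one_ne_zero, hypPair_isometric _ _, rfl⟩
  · right
    obtain ⟨n, rfl⟩ : ∃ n, m = n + 1 := ⟨m - 1, by have := hb.1; omega⟩
    exact ⟨n, c, hb.2.1, hypPair_isometric _ _, rfl⟩

theorem Valid.nondegenerate {b : Block K} (hb : b.Valid) : b.form.Nondegenerate := by
  rcases hb.cases with ⟨n, ε, h, -⟩ | ⟨n, c, hc, h, -⟩
  · exact h.nondegenerate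
  · exact h.nondegenerate (hypPair_nondegenerate _ hc)

theorem Valid.kerDim {b : Block K} (hb : b.Valid) {τ : Module.End K (b.Index → K)}
    (hτ : IsAsymmetry b.form τ) (k : ℕ) (μ : K) :
    2 * kerDim τ μ (k + 1) =
      BilinNormalForm.kerDim τ μ k + BilinNormalForm.kerDim τ μ (k + 2) +
        b.jordanCount (k + 1) μ := by
  have hnd := hb.nondegenerate
  rcases hb.cases with ⟨n, ε, h, hj⟩ | ⟨n, c, hc, ⟨φ, hφ⟩, hj⟩
  · rw [hj]
    exact kerDim_single (h.pow_eq_zero τ hτ) (h.pow_ne_zero hτ) h.finrank_eq k μ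
  · rw [hj]
    have hint := (isAsymmetry_hypEnd (n + 1) hc).eq_of_isometry hτ hnd φ hφ
    simp only [← kerDim_congr φ hint]
    exact kerDim_hypEnd n hc k μ

theorem Valid.hasEigenvectors {b : Block K} (hb : b.Valid) {τ : Module.End K (b.Index → K)}
    (hτ : IsAsymmetry b.form τ) : HasEigenvectors τ := by
  rcases hb.cases with ⟨n, ε, h, -⟩ | ⟨n, c, hc, ⟨φ, hφ⟩, -⟩
  · refine hasEigenvectors_of_list (List.replicate (n + 1) ε) ?_
    rw [List.map_replicate, List.prod_replicate, h.pow_eq_zero τ hτ]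
  · exact hasEigenvectors_congr φ
      ((isAsymmetry_hypEnd (n + 1) hc).eq_of_isometry hτ hb.nondegenerate φ hφ)
      (hasEigenvectors_hypEnd _ hc)

theorem Valid.isAlternatingAt {b : Block K} (hb : b.Valid) (h2 : ringChar K = 2) {n : ℕ}
    (hbn : b ≠ B (n + 1)) : IsAlternatingAt b.form n := by
  have h20 := two_eq_zero_of_ringChar h2
  have hyp : ∀ (m : ℕ) (c : K), c ≠ 0 → IsAlternatingAt (Matrix.toBilin' (hypBlock m c)) n := fun m c hc =>
    (hypPair_isAlternatingAt h20 m hc n).congr (hypPair_isometric m c)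
  rcases b with m | m | m | m | m | m | ⟨m, c⟩
  · exact absurd h2 hb.2
  · obtain ⟨⟨r, rfl⟩, h⟩ := hb
    exact (isCyclicForm_gamZero (2 * r) (even_two_mul r)).isAlternatingAt
      fun h => hbn (by rw [h])
  · exact absurd h2 hb.2.2
  · exact hyp m 1 one_ne_zero
  · exact hyp m 1 one_ne_zero
  · exact absurd h2 hb.2
  · exact hyp m c hb.2.1

theorem Valid.not_isAlternatingAt {n : ℕ} (hb : (B (n + 1) : Block K).Valid) :
    ¬ IsAlternatingAt (B (n + 1) : Block K).form n := by
  obtain ⟨⟨r, hr⟩, h⟩ := hb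
  have hc : IsCyclicForm (B (n + 1) : Block K).form 1 n :=
    isCyclicForm_gamZero n ⟨r, by omega⟩
  obtain ⟨τ, hτ⟩ := exists_isAsymmetry hc.nondegenerate
  obtain ⟨w, hw⟩ := hc.exists_generator τ hτ
  exact fun hn => hw (hn τ hτ w (by rw [hc.pow_eq_zero τ hτ]; rfl))

/-- The orthogonal sum of the forms of a finite family of blocks. -/
noncomputable def sumForm {κ : Type*} [Fintype κ] (s : κ → Block K) :
    LinearMap.BilinForm K (∀ i, (s i).Index → K) := piForm fun i => (s i).form

section SumForm

variable {κ : Type*} [Fintype κ] {s : κ → Block K}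

theorem sumForm_nondegenerate (hs : ∀ i, (s i).Valid) : (sumForm s).Nondegenerate :=
  piForm_nondegenerate fun i => (hs i).nondegenerate

theorem kerDim_sumForm (hs : ∀ i, (s i).Valid) {V : Type*} [AddCommGroup V] [Module K V]
    {f : LinearMap.BilinForm K V} {σ : Module.End K V}
    (hσ : IsAsymmetry f σ) (h : Isometric f (sumForm s)) (k : ℕ) (μ : K) :
    2 * kerDim σ μ (k + 1) =
      kerDim σ μ k + kerDim σ μ (k + 2) + ∑ i, (s i).jordanCount (k + 1) μ := by
  obtain ⟨φ, hφ⟩ := h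
  choose τ hτ using fun i => exists_isAsymmetry (hs i).nondegenerate
  have hint := hσ.eq_of_isometry (IsAsymmetry.piEnd hτ) (sumForm_nondegenerate hs) φ hφ
  simp only [kerDim_congr φ hint, kerDim_piEnd, Finset.mul_sum, ← Finset.sum_add_distrib]
  exact Finset.sum_congr rfl fun i _ => (hs i).kerDim (hτ i) k μ

/-- The presence of `B_{n+1}` thus becomes an isometry invariant, which Jordan counts alone do not
provide. -/
theorem isAlternatingAt_sumForm (hs : ∀ i, (s i).Valid) (h2 : ringChar K = 2) {n : ℕ} :
    IsAlternatingAt (sumForm s) n ↔ ∀ i, s i ≠ B (n + 1) := by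
  classical
  refine ⟨fun h i hi => ?_, fun h => IsAlternatingAt.piForm (fun i => (hs i).nondegenerate)
    fun i => (hs i).isAlternatingAt h2 (h i)⟩
  have hv := hs i
  have key : IsAlternatingAt (s i).form n := by
    intro τ' hτ' w hw
    choose τ hτ using fun i => exists_isAsymmetry (hs i).nondegenerate
    obtain rfl := hτ'.eq (hτ i) hv.nondegenerate
    have hpow : ∀ k, (shift (piEnd τ) 1 ^ k) (Pi.single i w) =
        Pi.single i ((shift (τ i) 1 ^ k) w) := fun k => funext fun j => by
      rw [shift_piEnd_pow]
      rcases eq_or_ne j i with rfl | hj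
      · simp
      · simp [Pi.single_eq_of_ne hj]
    have := h _ (IsAsymmetry.piEnd hτ) (Pi.single i w) (by rw [hpow, hw, Pi.single_zero])
    rw [hpow, sumForm, piForm_apply, Finset.sum_eq_single i] at this
    · simpa using this
    · intro j _ hj; simp [Pi.single_eq_of_ne hj]
    · simp
  rw [hi] at hv key
  exact hv.not_isAlternatingAt key

theorem admitsGramMatrix_directSum_iff {k : ℕ} {s : Fin k → Block K} {V : Type*} [AddCommGroup V]
    [Module K V] {f : LinearMap.BilinForm K V} :
    AdmitsGramMatrix f (directSum s) ↔ Isometric f (sumForm s) := by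
  have h := Isometric.blockDiagonal' fun i => (s i).matrix
  rw [admitsGramMatrix_iff]
  exact ⟨fun h' => h'.trans h, fun h' => h'.trans h.symm⟩

end SumForm

end Block

/-! ### Dual generalized eigenvectors of maximal height. -/

section DualPairs

variable {F : Type*} [Field F] {V : Type*} [AddCommGroup V] [Module F V]
  {f : LinearMap.BilinForm F V} {σ : Module.End F V}

/-- Generalized eigenvectors of maximal height for an eigenvalue `c` can be paired with generalized
eigenvectors for `c⁻¹`. -/
theorem IsAsymmetry.exists_dual_pair [FiniteDimensional F V] (h : IsAsymmetry f σ)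
    (hf : f.Nondegenerate) {lam μ : F} (hμ : μ * lam = 1) {v : V} (hv0 : v ≠ 0)
    (hv : σ v = lam • v) :
    ∃ (n : ℕ) (a b : V), (shift σ lam ^ (n + 1)) a = 0 ∧ (shift σ μ ^ (n + 1)) b = 0 ∧
      f b ((shift σ lam ^ n) a) ≠ 0 ∧
      ∀ x k, (shift σ lam ^ k) x = 0 → (shift σ lam ^ (n + 1)) x = 0 := by
  classical
  have hex : ∃ m, ∀ x k, (shift σ lam ^ k) x = 0 → (shift σ lam ^ m) x = 0 :=
    ⟨Module.finrank F V, fun x k hx => Module.End.ker_pow_le_ker_pow_finrank _ k hx⟩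
  have hmin := fun m => Nat.find_min hex (m := m)
  have hspec := Nat.find_spec hex
  set m := Nat.find hex
  obtain ⟨n, hn⟩ : ∃ n, m = n + 1 := by
    refine Nat.exists_eq_succ_of_ne_zero fun hm => hv0 ?_
    have := hspec v 1 (by simp [hv])
    rw [hm] at this
    simpa using this
  rw [hn] at hspec hmin
  obtain ⟨a, j, ha, ha'⟩ : ∃ a j, (shift σ lam ^ j) a = 0 ∧ (shift σ lam ^ n) a ≠ 0 := by
    have := hmin n (by omega)
    push Not at this
    exact this
  obtain ⟨x, hx⟩ : ∃ x, f x ((shift σ lam ^ n) a) ≠ 0 := by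
    by_contra! hx
    exact ha' (hf.2 _ hx)
  have ha1 := hspec a j ha
  -- Fitting decompositions for both eigenvalues with a common exponent. Replacing `x` by its
  -- generalized `μ`-eigencomponent `b` does not change the pairing with `N_λ^n a`.
  obtain ⟨M, ⟨hM1, hM2⟩, hM⟩ := ((((shift σ lam).eventually_isCompl_ker_pow_range_pow).and
    ((shift σ μ).eventually_isCompl_ker_pow_range_pow)).and
    (Filter.eventually_ge_atTop (n + 1))).exists
  have hdec : ∀ {N : Module.End F V}, IsCompl (LinearMap.ker (N ^ M)) (LinearMap.range (N ^ M)) →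
      ∀ x, ∃ y z, x = y + (N ^ M) z ∧ (N ^ M) y = 0 := by
    intro N hN x
    have : x ∈ LinearMap.ker (N ^ M) ⊔ LinearMap.range (N ^ M) := by
      rw [hN.sup_eq_top]; trivial
    obtain ⟨y, hy, _, ⟨z, rfl⟩, rfl⟩ := Submodule.mem_sup.mp this
    exact ⟨y, z, rfl, hy⟩
  obtain ⟨b, z, rfl, hb⟩ := hdec hM2 x
  refine ⟨n, a, b, ha1, ?_, ?_, hspec⟩
  -- `N_μ^(n+1) b` is orthogonal to the generalized `λ`-eigenspace by maximality of `n + 1`, and to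
  -- the Fitting complement because `N_μ^M b = 0`.
  · refine hf.1 _ fun y => ?_
    obtain ⟨y, w, rfl, hy⟩ := hdec hM1 y
    have e1 := h.pairing_eq_zero hμ (b := b) (hspec y M hy) (j := n + 1) (k := 0) (by omega)
    have e2 := h.pairing_eq_zero' hμ (a := w) hb (j := n + 1) (k := M) (by omega)
    rw [pow_zero, Module.End.one_apply] at e1
    rw [map_add, e1, e2, add_zero]
  · rw [map_add, LinearMap.add_apply, h.pairing_eq_zero hμ ha1 (by omega), add_zero] at hx
    exact hx

/-- Expanding `f (σ x) (σ y) = f x y` and inducting on the total height leaves `(λ² - 1) f x y = 0`.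
-/
theorem IsAsymmetry.apply_eq_zero_of_sq_ne_one (h : IsAsymmetry f σ) {lam : F}
    (hlam : lam * lam ≠ 1) : ∀ (i j : ℕ) (x y : V), (shift σ lam ^ i) x = 0 →
      (shift σ lam ^ j) y = 0 → f x y = 0 := by
  have key : ∀ (r i j : ℕ), i + j ≤ r → ∀ x y : V, (shift σ lam ^ i) x = 0 →
      (shift σ lam ^ j) y = 0 → f x y = 0 := by
    intro r
    induction r with
    | zero =>
      intro i j hij x y hx _
      obtain rfl : i = 0 := by omega
      rw [show x = 0 by simpa using hx]; simp
    | succ r ih =>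
      intro i j hij x y hx hy
      rcases i with _ | i
      · rw [show x = 0 by simpa using hx]; simp
      rcases j with _ | j
      · rw [show y = 0 by simpa using hy]; simp
      rw [pow_succ, Module.End.mul_apply] at hx hy
      have hx' := hx
      have hy' := hy
      rw [← Module.End.mul_apply, ← pow_succ] at hx' hy'
      have e1 := ih i (j + 1) (by omega) _ _ hx hy'
      have e2 := ih (i + 1) j (by omega) _ _ hx' hy
      have e3 := ih i j (by omega) _ _ hx hy
      have e4 := h.apply_apply x y
      rw [apply_eq_shift_add σ lam x, apply_eq_shift_add σ lam y] at e4
      simp only [map_add, map_smul, LinearMap.add_apply, LinearMap.smul_apply, smul_eq_mul, e1, e2,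
        e3] at e4
      have e5 : (lam * lam - 1) * f x y = 0 := by linear_combination e4
      exact (mul_eq_zero.mp e5).resolve_left (sub_ne_zero.mpr hlam)
  exact fun i j => key (i + j) i j le_rfl

/-- If the top form on vectors of height at most `n + 1` is alternating but not zero, then a
hyperbolic block embeds. -/
theorem IsAsymmetry.exists_hyperbolic_embedding_of_alternating (hF : QuadraticallyClosed F)
    (h : IsAsymmetry f σ) {ε : F} (hε : ε * ε = 1) {n : ℕ} {a b : V}
    (ha : (shift σ ε ^ (n + 1)) a = 0) (hb : (shift σ ε ^ (n + 1)) b = 0)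
    (hba : f b ((shift σ ε ^ n) a) ≠ 0)
    (halt : ∀ v, (shift σ ε ^ (n + 1)) v = 0 → f v ((shift σ ε ^ n) v) = 0) :
    ∃ φ : (Fin (n + 1) ⊕ Fin (n + 1) → F) →ₗ[F] V,
      (∀ x y, f (φ x) (φ y) = Matrix.toBilin' (hypBlock (n + 1) ε) x y) ∧
      ∀ x, σ (φ x) ∈ LinearMap.range φ := by
  have hε0 : ε ≠ 0 := left_ne_zero_of_mul_eq_one hε
  have hs : ε * (-1) ^ n ≠ 0 := mul_ne_zero hε0 (pow_ne_zero _ (by simp))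
  -- First `b` is made isotropic with the help of `a`, then `a` with the help of the new `b'`; the
  -- nonzero top pairing survives both corrections.
  obtain ⟨b', -, h1, h2, h3⟩ := h.exists_isotropic hF hε hb ha hba (halt b hb) ⊤ trivial
    fun _ _ => trivial
  obtain ⟨a', -, h4, h5, h6⟩ := h.exists_isotropic hF hε ha h1
    (by rw [h.top_swap hε h1] at h2; exact right_ne_zero_of_mul h2) (halt a ha) ⊤
    trivial fun _ _ => trivial
  refine h.exists_hyperbolic_embedding hε h4 h1 ?_
    (fun j k => h.self_pairing_eq_zero hε h4 (i := 0) (fun k _ => h6 k) (by omega))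
    (fun j k => h.self_pairing_eq_zero hε h1 (i := 0) (fun k _ => h3 k) (by omega))
  rw [h.top_swap hε h1]
  exact mul_ne_zero hs h5

end DualPairs

/-! ### The inductive step: splitting off an embedded block. -/

namespace Block

variable {F : Type*} [Field F] {V : Type*} [AddCommGroup V] [Module F V]
  {f : LinearMap.BilinForm F V} {σ : Module.End F V}

theorem Valid.finrank_pos {b : Block F} (hb : b.Valid) :
    0 < Module.finrank F (b.Index → F) := by
  rcases hb.cases with ⟨n, ε, h, -⟩ | ⟨n, c, -, ⟨φ, -⟩, -⟩
  · rw [h.finrank_eq]; omega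
  · rw [← φ.finrank_eq]; simp

theorem sumForm_elim {κ κ' : Type*} [Fintype κ] [Fintype κ'] (s : κ → Block F)
    (t : κ' → Block F) :
    Isometric (sumForm (Sum.elim s t)) (prodForm (sumForm s) (sumForm t)) :=
  Isometric.piForm_sum fun i => (Sum.elim s t i).form

/-- Existence of an admissible decomposition into canonical blocks. -/
def HasDecomposition (f : LinearMap.BilinForm F V) : Prop :=
  ∃ (κ : Type) (_ : Fintype κ) (s : κ → Block F), (∀ i, (s i).Valid) ∧
    (¬ ∃ l i j, s i = B l ∧ s j = E l) ∧ Isometric f (sumForm s)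

theorem Valid.exists_complement [FiniteDimensional F V] (hf : f.Nondegenerate)
    (h : IsAsymmetry f σ) {b : Block F} (hb : b.Valid) (φ : (b.Index → F) →ₗ[F] V)
    (hφ : ∀ x y, f (φ x) (φ y) = b.form x y) (hσ : ∀ x, σ (φ x) ∈ LinearMap.range φ) :
    ∃ (W : Submodule F V) (hW : ∀ v ∈ W, σ v ∈ W),
      (∀ x, ∀ v ∈ W, f (φ x) v = 0 ∧ f v (φ x) = 0) ∧ (∀ v, ∃ x, ∃ w ∈ W, v = φ x + w) ∧
      Module.finrank F W < Module.finrank F V ∧ (f.restrict W).Nondegenerate ∧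
      IsAsymmetry (f.restrict W) (LinearMap.restrict σ hW) ∧
      ∀ (κ : Type) (_ : Fintype κ) (s : κ → Block F), Isometric (f.restrict W) (sumForm s) →
        Isometric f (sumForm (Sum.elim (fun _ : Unit => b) s)) := by
  obtain ⟨W, hW, h1, h2, h3⟩ := h.exists_orthogonal_complement hf hb.nondegenerate φ hφ hσ
  refine ⟨W, hW, h1, h2, ?_, nondegenerate_of_prodForm_right (h3.nondegenerate hf),
    fun u v => h u v, fun κ _ s hs => ?_⟩
  · obtain ⟨ψ, -⟩ := h3
    rw [ψ.finrank_eq, Module.finrank_prod]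
    have := hb.finrank_pos
    omega
  · refine h3.trans (Isometric.trans ?_ (sumForm_elim _ _).symm)
    exact Isometric.prodForm (Isometric.piForm_unique fun _ : Unit => b.form).symm hs

/-- `IH` decomposes the complement. `hadm` isolates the one remaining obligation, that the new block
does not clash with that decomposition; it is void unless the block is `B` or `E`. -/
theorem hasDecomposition_of_embedding [FiniteDimensional F V] (hf : f.Nondegenerate)
    (h : IsAsymmetry f σ) {b : Block F} (hb : b.Valid) (φ : (b.Index → F) →ₗ[F] V)
    (hφ : ∀ x y, f (φ x) (φ y) = b.form x y) (hσ : ∀ x, σ (φ x) ∈ LinearMap.range φ)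
    (IH : ∀ (W : Submodule F V) (hW : ∀ v ∈ W, σ v ∈ W),
      Module.finrank F W < Module.finrank F V → (f.restrict W).Nondegenerate →
      IsAsymmetry (f.restrict W) (LinearMap.restrict σ hW) → HasDecomposition (f.restrict W))
    (hadm : ∀ (W : Submodule F V) (hW : ∀ v ∈ W, σ v ∈ W),
      (∀ x, ∀ v ∈ W, f (φ x) v = 0 ∧ f v (φ x) = 0) → (∀ v, ∃ x, ∃ w ∈ W, v = φ x + w) →
      (f.restrict W).Nondegenerate → IsAsymmetry (f.restrict W) (LinearMap.restrict σ hW) →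
      ∀ (κ : Type) (_ : Fintype κ) (s : κ → Block F), (∀ i, (s i).Valid) →
        (¬ ∃ l i j, s i = B l ∧ s j = E l) → Isometric (f.restrict W) (sumForm s) →
        ∀ l i, ¬ (b = B l ∧ s i = E l) ∧ ¬ (s i = B l ∧ b = E l)) :
    HasDecomposition f := by
  obtain ⟨W, hW, h1, h2, h3, h4, h5, h6⟩ := hb.exists_complement hf h φ hφ hσ
  obtain ⟨κ, _, s, hs, hs', his⟩ := IH W hW h3 h4 h5
  refine ⟨Unit ⊕ κ, inferInstance, Sum.elim (fun _ => b) s, ?_, ?_, h6 κ _ s his⟩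
  · rintro (i | i)
    · exact hb
    · exact hs i
  · have := hadm W hW h1 h2 h4 h5 κ _ s hs hs' his
    rintro ⟨l, i | i, j | j, hi, hj⟩
    · exact absurd (hi.symm.trans hj) (by simp)
    · exact (this l j).1 ⟨hi, hj⟩
    · exact (this l i).2 ⟨hi, hj⟩
    · exact hs' ⟨l, i, j, hi, hj⟩

/-- Otherwise the kernels would be stationary from `n` on, and the second difference counting blocks
of size `n + 1` would be zero. -/
theorem exists_top_of_jordanCount [FiniteDimensional F V] (h : IsAsymmetry f σ) {κ : Type*}
    [Fintype κ] {s : κ → Block F} (hs : ∀ i, (s i).Valid) (hfs : Isometric f (sumForm s))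
    {n : ℕ} {c : F} {i : κ} (hi : (s i).jordanCount (n + 1) c ≠ 0) :
    ∃ y, (shift σ c ^ (n + 1)) y = 0 ∧ (shift σ c ^ n) y ≠ 0 := by
  by_contra! hy
  have hker : LinearMap.ker (shift σ c ^ n) = LinearMap.ker (shift σ c ^ (n + 1)) :=
    le_antisymm (fun x hx => pow_apply_eq_zero_of_le hx (Nat.le_succ n)) fun x hx => hy x hx
  have e1 := Module.End.ker_pow_constant hker 2
  have e2 := kerDim_sumForm hs h hfs n c
  rw [kerDim, kerDim, kerDim, ← hker, ← e1] at e2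
  have : (s i).jordanCount (n + 1) c ≤ ∑ i, (s i).jordanCount (n + 1) c :=
    Finset.single_le_sum (f := fun i => (s i).jordanCount (n + 1) c)
      (fun i _ => Nat.zero_le _) (Finset.mem_univ i)
  omega

end Block

/-! ### Embedding a cyclic form together with its generator. -/

section CyclicEmbedding

variable {F : Type*} [Field F] {V W : Type*} [AddCommGroup V] [Module F V] [AddCommGroup W]
  [Module F W] {f : LinearMap.BilinForm F V} {σ : Module.End F V}

theorem IsCyclicForm.exists_embedding (hF : QuadraticallyClosed F) (h : IsAsymmetry f σ)
    {g : LinearMap.BilinForm F W} {ε : F} {n : ℕ} (hg : IsCyclicForm g ε n) (hε : ε * ε = 1)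
    {v : V} (hv : (shift σ ε ^ (n + 1)) v = 0) (hvv : f v ((shift σ ε ^ n) v) ≠ 0) :
    ∃ φ : W →ₗ[F] V, (∀ x y, f (φ x) (φ y) = g x y) ∧ (∀ x, σ (φ x) ∈ LinearMap.range φ) ∧
      ∃ (τ : Module.End F W) (w : W), shift τ ε ^ (n + 1) = 0 ∧ (∀ x, φ (τ x) = σ (φ x)) ∧
        (∀ S : Submodule F V, v ∈ S → (∀ x ∈ S, shift σ ε x ∈ S) → φ w ∈ S) ∧
        g w ((shift τ ε ^ n) w) ≠ 0 ∧
        ∀ y, g w ((shift τ ε ^ n) y) = 0 → (shift τ ε ^ n) y = 0 := by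
  have : FiniteDimensional F W := Module.finite_of_finrank_pos (by rw [hg.finrank_eq]; omega)
  obtain ⟨τ, hτ⟩ := exists_isAsymmetry hg.nondegenerate
  obtain ⟨w, hw⟩ := hg.exists_generator τ hτ
  have h0 := hg.pow_eq_zero τ hτ
  obtain ⟨φ, h1, h2, h3⟩ := h.exists_cyclic_embedding hF hτ hε hv hvv (w := w)
    (by rw [h0]; rfl) hw hg.finrank_eq
  refine ⟨φ, h1, fun x => ⟨_, h2 x⟩, τ, w, h0, h2, h3, hw, fun y hy => ?_⟩
  let L : W →ₗ[F] F := g w ∘ₗ (shift τ ε ^ n)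
  -- On a single Jordan block `N^n` has rank one, so its kernel is a hyperplane and equals that of
  -- the nonzero functional `L`.
  have hL : LinearMap.ker (shift τ ε ^ n) = LinearMap.ker L := by
    refine Submodule.eq_of_le_of_finrank_eq (fun x hx => ?_) ?_
    · rw [LinearMap.mem_ker] at hx ⊢
      rw [LinearMap.comp_apply, hx, map_zero]
    · have hsurj : LinearMap.range L = ⊤ := LinearMap.range_eq_top.mpr
        (LinearMap.surjective (fun hL0 => hw (LinearMap.congr_fun hL0 w)))
      have e1 := LinearMap.finrank_range_add_finrank_ker L
      rw [hsurj, finrank_top, Module.finrank_self, hg.finrank_eq] at e1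
      rw [finrank_ker_pow_of_single h0 (hg.pow_ne_zero hτ) hg.finrank_eq]
      omega
  have : y ∈ LinearMap.ker L := hy
  rwa [← hL] at this

end CyclicEmbedding

/-! ### Existence of an admissible decomposition. -/

namespace Block

variable {F : Type*} [Field F]

/-- The induction assumes `HasEigenvectors` rather than a split minimal polynomial because the
former visibly restricts to invariant subspaces. -/
theorem hasDecomposition_aux (hF : QuadraticallyClosed F) : ∀ (d : ℕ) {V : Type*} [AddCommGroup V]
    [Module F V] [FiniteDimensional F V] {f : LinearMap.BilinForm F V} {σ : Module.End F V},
    Module.finrank F V = d → f.Nondegenerate → IsAsymmetry f σ → HasEigenvectors σ →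
    HasDecomposition f := by
  intro d
  induction d using Nat.strong_induction_on with
  | _ d IHd =>
  intro V _ _ _ f σ hd hf h hσ
  have IH : ∀ (W : Submodule F V) (hW : ∀ v ∈ W, σ v ∈ W),
      Module.finrank F W < Module.finrank F V → (f.restrict W).Nondegenerate →
      IsAsymmetry (f.restrict W) (LinearMap.restrict σ hW) → HasDecomposition (f.restrict W) :=
    fun W hW h1 h2 h3 => IHd _ (hd ▸ h1) rfl h2 h3 (hσ.restrict W hW)
  clear IHd
  rcases subsingleton_or_nontrivial V with hV | hV
  · refine ⟨Empty, inferInstance, Empty.elim, fun i => i.elim, ?_, ?_⟩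
    · rintro ⟨_, i, -⟩
      exact i.elim
    · exact ⟨LinearEquiv.ofFinrankEq _ _ (by simp [Module.finrank_zero_of_subsingleton]),
        fun u v => by rw [Subsingleton.elim u 0]; simp⟩
  obtain ⟨c, v₀, -, hv₀, hc⟩ := hσ ⊤ (fun _ _ => trivial) top_ne_bot
  have hc0 : c ≠ 0 := by
    rintro rfl
    exact hv₀ (h.injective hf (by rw [hc]; simp))
  obtain ⟨n, a, b, ha, hb, hba, hmax⟩ :=
    h.exists_dual_pair hf (lam := c) (μ := c⁻¹) (inv_mul_cancel₀ hc0) hv₀ hc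
  by_cases hcc : c * c = 1
  swap
  · have hcc' : c⁻¹ * c⁻¹ ≠ 1 := fun h' => hcc (by
      rw [← mul_inv, inv_eq_one] at h'; exact h')
    have hpow : ∀ (μ : F) (x : V) (j : ℕ), (shift σ μ ^ (n + 1)) x = 0 →
        (shift σ μ ^ (n + 1)) ((shift σ μ ^ j) x) = 0 := fun μ x j hx => by
      rw [← Module.End.mul_apply, ← pow_add, pow_apply_eq_zero_of_le hx (by omega)]
    obtain ⟨φ, h1, h2⟩ := h.exists_hyperbolic_embedding (inv_mul_cancel₀ hc0) ha hb hba
      (fun j k => h.apply_eq_zero_of_sq_ne_one hcc _ _ _ _ (hpow c a j ha) (hpow c a k ha))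
      (fun j k => h.apply_eq_zero_of_sq_ne_one hcc' _ _ _ _ (hpow _ b j hb) (hpow _ b k hb))
    exact hasDecomposition_of_embedding (b := G (n + 1) c) hf h
      ⟨Nat.succ_pos n, hc0, by rwa [sq]⟩ φ h1 h2 IH (by simp)
  obtain hcinv : c⁻¹ = c := inv_eq_of_mul_eq_one_left hcc
  rw [hcinv] at hb
  by_cases halt : ∀ v, (shift σ c ^ (n + 1)) v = 0 → f v ((shift σ c ^ n) v) = 0
  · obtain ⟨φ, h1, h2⟩ := h.exists_hyperbolic_embedding_of_alternating hF hcc ha hb hba halt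
    by_cases hchar : ringChar F = 2
    · have h20 := two_eq_zero_of_ringChar hchar
      obtain rfl : c = 1 := by
        have : (c - 1) ^ 2 = 0 := by linear_combination hcc + (1 - c) * h20
        exact sub_eq_zero.mp (pow_eq_zero_iff (two_ne_zero) |>.mp this)
      rcases Nat.even_or_odd (n + 1) with hn | hn
      · exact hasDecomposition_of_embedding (b := D (n + 1)) hf h ⟨hn, Nat.succ_pos n⟩ φ h1 h2 IH
          (by simp)
      · refine hasDecomposition_of_embedding (b := E (n + 1)) hf h ⟨hn, hchar⟩ φ h1 h2 IH ?_
        intro W hW h3 h4 h5 h6 κ _ s hs hs' his l i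
        refine ⟨by simp, fun hl => ?_⟩
        obtain rfl : n + 1 = l := by simpa using hl.2
        -- Alternation at height `n + 1` passes to the complement, which therefore contains no
        -- `B_{n+1}`.
        have h7 : IsAlternatingAt (f.restrict W) n := by
          intro τ hτ v hv
          obtain rfl := hτ.eq h6 h5
          have hres := fun k => shift_pow_map (σ := LinearMap.restrict σ hW) (τ := σ) W.subtype
            (fun _ => rfl) 1 k v
          have e1 := halt v (by rw [← W.subtype_apply, ← hres, hv, map_zero])
          rw [← W.subtype_apply, ← hres] at e1
          exact e1
        exact (isAlternatingAt_sumForm hs hchar).mp (h7.congr his) i hl.1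
    · -- the characteristic is not two
      have h20 := two_ne_zero_of_ringChar hchar
      -- The top form is both alternating and `c(-1)^n`-symmetric, and it is not zero; so the parity
      -- of `n` determines `c`.
      have hsign : c * (-1) ^ n = -1 := by
        have e0 := h.top_swap hcc (a := b) ha
        have e1 := halt (a + b) (by rw [map_add, ha, hb, add_zero])
        simp only [map_add, LinearMap.add_apply, halt a ha, halt b hb, zero_add, add_zero, e0] at e1
        have : (c * (-1) ^ n + 1) * f b ((shift σ c ^ n) a) = 0 := by linear_combination e1
        exact eq_neg_of_add_eq_zero_left ((mul_eq_zero.mp this).resolve_right hba)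
      rcases Nat.even_or_odd (n + 1) with hn | hn
      · have hn' : Odd n := by
          rw [← Nat.not_even_iff_odd]; exact fun h' => Nat.not_odd_iff_even.mpr hn h'.add_one
        obtain rfl : c = 1 := by rw [hn'.neg_one_pow] at hsign; linear_combination -hsign
        exact hasDecomposition_of_embedding (b := D (n + 1)) hf h ⟨hn, Nat.succ_pos n⟩ φ h1 h2 IH
          (by simp)
      · have hn' : Even n := by
          rw [← Nat.not_odd_iff_even]; exact fun h' => Nat.not_even_iff_odd.mpr hn h'.add_one
        obtain rfl : c = -1 := by rw [hn'.neg_one_pow] at hsign; linear_combination hsign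
        exact hasDecomposition_of_embedding (b := Block.F (n + 1)) hf h ⟨hn, hchar⟩ φ h1 h2 IH (by simp)
  push Not at halt
  obtain ⟨v, hv, hvv⟩ := halt
  by_cases hchar : ringChar F = 2
  · have h20 := two_eq_zero_of_ringChar hchar
    obtain rfl : c = 1 := by
      have : (c - 1) ^ 2 = 0 := by linear_combination hcc + (1 - c) * h20
      exact sub_eq_zero.mp (pow_eq_zero_iff (two_ne_zero) |>.mp this)
    have hn : Even n := by
      by_contra hn
      exact hvv (h.self_odd hv (Nat.not_even_iff_odd.mp hn) fun k hk => by
        rw [pow_apply_eq_zero_of_le hv hk, map_zero])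
    have hcyc : IsCyclicForm (B (n + 1) : Block F).form 1 n := isCyclicForm_gamZero n hn
    have hval : (B (n + 1) : Block F).Valid := ⟨hn.add_one, hchar⟩
    -- To keep `E_{n+1}` out of the complement of the new `B_{n+1}`, the vector `v` is taken, if
    -- possible, with a top-orthogonal companion `x` that is also top-anisotropic.
    by_cases hpair : ∃ v x, (shift σ 1 ^ (n + 1)) v = 0 ∧ (shift σ 1 ^ (n + 1)) x = 0 ∧
        f v ((shift σ 1 ^ n) v) ≠ 0 ∧ f v ((shift σ 1 ^ n) x) = 0 ∧ f x ((shift σ 1 ^ n) x) ≠ 0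
    · obtain ⟨v, x, hv, hx, hvv, hvx, hxx⟩ := hpair
      obtain ⟨φ, h1, h2, τ, w, hτ0, hφτ, hφw, hww, hker⟩ := hcyc.exists_embedding hF h (one_mul 1)
        hv hvv
      refine hasDecomposition_of_embedding hf h hval φ h1 h2 IH ?_
      intro W hW h3 h4 h5 h6 κ _ s hs hs' his l i
      refine ⟨fun hl => ?_, by simp⟩
      obtain rfl : n + 1 = l := by simpa using hl.1
      -- If the complement were alternating at height `n + 1`, the component `z` of `x` in it would
      -- be top-isotropic, and the component `φ y` would contribute nothing, against `hxx`. So a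
      -- `B_{n+1}` occurs in it, and its admissibility excludes `E_{n+1}`.
      obtain ⟨j, hj⟩ : ∃ j, s j = B (n + 1) := by
        by_contra! hno
        have h7 := ((isAlternatingAt_sumForm hs hchar).mpr hno).congr his.symm
        obtain ⟨y, z, hz, rfl⟩ := h4 x
        have hφpow := fun k => shift_pow_map φ hφτ 1 k y
        have hres : ∀ k, ((shift (LinearMap.restrict σ hW) 1 ^ k) ⟨z, hz⟩ : V) =
            (shift σ 1 ^ k) z := fun k =>
          shift_pow_map (τ := σ) W.subtype (fun _ => rfl) 1 k ⟨z, hz⟩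
        have hres' : ∀ k, (shift σ 1 ^ k) z ∈ W := fun k => by
          rw [← hres]; exact Subtype.mem _
        have hz1 : (shift σ 1 ^ (n + 1)) z = 0 := by
          rw [map_add, ← hφpow, hτ0] at hx
          simpa using hx
        have hzz : f z ((shift σ 1 ^ n) z) = 0 := by
          rw [← hres]
          exact h7 _ h6 ⟨z, hz⟩ (Subtype.ext ((hres _).trans hz1))
        -- This invariant subspace contains `v`, hence the corrected generator `φ w`; thus
        -- top-orthogonality to `x` is inherited by `φ w`, and forces `N^n y = 0`.
        let S : Submodule F V :=
          { carrier := {s | ∀ j, f ((shift σ 1 ^ j) s) ((shift σ 1 ^ n) (φ y + z)) = 0}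
            add_mem' := fun {s t} hs ht j => by rw [map_add, map_add, LinearMap.add_apply, hs, ht,
              add_zero]
            zero_mem' := fun j => by simp
            smul_mem' := fun t s hs j => by rw [map_smul, map_smul, LinearMap.smul_apply, hs,
              smul_zero] }
        have hwS : φ w ∈ S := hφw S (fun j => by
          rcases Nat.eq_zero_or_pos j with rfl | hj
          · simpa using hvx
          · exact h.pairing_eq_zero (one_mul 1) hx (by omega)) fun s hs j => by
            have := hs (j + 1)
            rwa [pow_succ, Module.End.mul_apply] at this
        have hwy : (shift τ 1 ^ n) y = 0 := hker y (by
          have := hwS 0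
          rwa [pow_zero, Module.End.one_apply, map_add, map_add, ← hφpow, h1,
            (h3 _ _ (hres' n)).1, add_zero] at this)
        apply hxx
        simp only [map_add, LinearMap.add_apply, ← hφpow, hwy, (h3 _ _ (hres' n)).1, hzz, map_zero,
          add_zero]
      exact hs' ⟨n + 1, j, i, hj, hl.2⟩
    · obtain ⟨φ, h1, h2, τ, w, hτ0, hφτ, -, hww, -⟩ := hcyc.exists_embedding hF h (one_mul 1)
        hv hvv
      refine hasDecomposition_of_embedding hf h hval φ h1 h2 IH ?_
      intro W hW h3 h4 h5 h6 κ _ s hs hs' his l i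
      refine ⟨fun hl => hpair ?_, by simp⟩
      obtain rfl : n + 1 = l := by simpa using hl.1
      have hres := fun x k => shift_pow_map (σ := LinearMap.restrict σ hW) (τ := σ) W.subtype
            (fun _ => rfl) 1 k x
      have hres0 : ∀ x k, (shift (LinearMap.restrict σ hW) 1 ^ k) x = 0 ↔
          (shift σ 1 ^ k) x.1 = 0 := fun x k => by
        rw [← W.subtype_apply, ← hres, W.subtype_apply, Submodule.coe_eq_zero]
      obtain ⟨y, hy1, hy2⟩ := exists_top_of_jordanCount h6 hs his (n := n) (c := 1) (i := i) (by
        rw [hl.2]; simp [jordanCount, hypCount, singleCount])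
      obtain ⟨m, a, b, ha, hb, hba, hmax'⟩ := h6.exists_dual_pair h5 (one_mul 1) hy2 (by
        rw [apply_eq_shift_add _ 1, ← Module.End.mul_apply, ← pow_succ', hy1, zero_add])
      -- An `E_{n+1}` in the complement produces vectors of height `n + 1` there, and no greater
      -- height occurs because `n` is maximal in `V`.
      obtain rfl : n = m := by
        refine le_antisymm ?_ ?_
        · by_contra! hlt
          exact hy2 (pow_apply_eq_zero_of_le (hmax' y _ hy1) hlt)
        · by_contra! hlt
          have e1 := hmax a.1 _ ((hres0 _ _).mp ha)
          have e2 := pow_apply_eq_zero_of_le ((hres0 _ _).mpr e1) hlt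
          exact hba (by rw [e2, map_zero])
      have ha' := (hres0 _ _).mp ha
      have hb' := (hres0 _ _).mp hb
      have hbW : ∀ x : W, ∀ k, (shift σ 1 ^ k) x.1 ∈ W := fun x k => by
        rw [← W.subtype_apply, ← hres]; exact Subtype.mem _
      have hba' : f b.1 ((shift σ 1 ^ n) a.1) ≠ 0 := by
        rw [← W.subtype_apply a, ← hres]; exact hba
      have hφpow := fun k => shift_pow_map φ hφτ 1 k w
      have hv1 : (shift σ 1 ^ (n + 1)) (φ w) = 0 := by rw [← hφpow, hτ0]; simp
      have hv2 : f (φ w) ((shift σ 1 ^ n) (φ w)) ≠ 0 := by rwa [← hφpow, h1]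
      have hv3 : ∀ x : W, f (φ w) ((shift σ 1 ^ n) x.1) = 0 := fun x => (h3 _ _ (hbW x n)).1
      have hv4 : ∀ x : W, f x.1 ((shift σ 1 ^ n) (φ w)) = 0 := fun x => by
        rw [← hφpow]; exact (h3 _ _ x.2).2
      -- A top-anisotropic vector of the complement would form a pair with `φ w`.
      have hself : ∀ x : W, (shift σ 1 ^ (n + 1)) x.1 = 0 → f x.1 ((shift σ 1 ^ n) x.1) = 0 :=
        fun x hx => by
          by_contra hxx
          exact hpair ⟨φ w, x, hv1, hx, hv2, hv3 x, hxx⟩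
      set γ := f (φ w) ((shift σ 1 ^ n) (φ w)) with hγ
      -- As `a` and `b` are top-isotropic and top-orthogonal to `φ w`, both vectors keep the top
      -- value `γ`; the coefficient makes their mutual pairing `γ - γ = 0`.
      refine ⟨φ w + b.1, φ w - (γ / f b.1 ((shift σ 1 ^ n) a.1)) • a.1, ?_, ?_, ?_, ?_, ?_⟩
      · rw [map_add, hv1, hb', add_zero]
      · rw [map_sub, map_smul, hv1, ha', smul_zero, sub_zero]
      · simp only [map_add, LinearMap.add_apply, hv3, hv4, hself b hb', ← hγ, add_zero]
        exact hv2
      · simp only [map_add, LinearMap.add_apply, map_sub, map_smul, hv3, hv4, ← hγ, smul_eq_mul]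
        field_simp
        ring
      · simp only [map_sub, LinearMap.sub_apply, map_smul, LinearMap.smul_apply, hv3, hv4,
          hself a ha', ← hγ, smul_eq_mul, mul_zero, sub_zero]
        exact hv2
  · have hsign : c = (-1) ^ n := by
      have e1 := h.self_swap hcc (i := n) hv fun k hk => by
        rw [pow_apply_eq_zero_of_le hv hk, map_zero]
      have e2 : c * (-1) ^ n = 1 := (mul_right_cancel₀ hvv ((one_mul _).trans e1)).symm
      have e3 : ((-1 : F) ^ n) * (-1) ^ n = 1 := by rw [← mul_pow]; simp
      linear_combination (-1 : F) ^ n * e2 - c * e3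
    have hcyc := isCyclicForm_gam hchar n
    rw [← hsign] at hcyc
    obtain ⟨φ, h1, h2, -⟩ := hcyc.exists_embedding hF h hcc hv hvv
    rcases Nat.even_or_odd (n + 1) with hn | hn
    · exact hasDecomposition_of_embedding (b := C (n + 1)) hf h ⟨hn, Nat.succ_pos n, hchar⟩ φ h1 h2
        IH (by simp)
    · exact hasDecomposition_of_embedding (b := A (n + 1)) hf h ⟨hn, hchar⟩ φ h1 h2 IH (by simp)

end Block

/-! ### Congruence of matrices as isometry of forms. -/

section Congruence

variable {F : Type*} [Field F]

theorem isometric_toBilin'_of_isUnit {ι : Type*} [Fintype ι] [DecidableEq ι] (A X : Matrix ι ι F)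
    (hX : IsUnit X) :
    Isometric (Matrix.toBilin' (X.transpose * A * X)) (Matrix.toBilin' A) := by
  have hdet : IsUnit X.det := (Matrix.isUnit_iff_isUnit_det X).mp hX
  have hinj : Function.Injective (Matrix.toLin' X) := by
    rw [injective_iff_map_eq_zero]
    exact fun x hx => Matrix.eq_zero_of_mulVec_eq_zero hdet.ne_zero hx
  refine ⟨LinearEquiv.ofInjectiveEndo _ hinj, fun u v => ?_⟩
  rw [← Matrix.toBilin'_comp]; rfl

theorem isometric_toBilin'_reindex {ι κ : Type*} [Fintype ι] [DecidableEq ι] [Fintype κ]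
    [DecidableEq κ] (e : κ ≃ ι) (M : Matrix κ κ F) :
    Isometric (Matrix.toBilin' (Matrix.reindex e e M)) (Matrix.toBilin' M) :=
  admitsGramMatrix_iff.mp ⟨(Pi.basisFun F ι).reindex e.symm, fun i j => by
    simp [Matrix.toBilin'_single]⟩

theorem isometric_toBilin'_fromBlocks {ι κ : Type*} [Fintype ι] [DecidableEq ι] [Fintype κ]
    [DecidableEq κ] (B : Matrix ι ι F) (C : Matrix κ κ F) :
    Isometric (Matrix.toBilin' (Matrix.fromBlocks B 0 0 C))
      (prodForm (Matrix.toBilin' B) (Matrix.toBilin' C)) := by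
  refine Isometric.symm (admitsGramMatrix_iff.mp
    ⟨(Pi.basisFun F ι).prod (Pi.basisFun F κ), fun i j => ?_⟩)
  rcases i with i | i <;> rcases j with j | j <;> simp [Matrix.toBilin'_single]

end Congruence

/-! ### Indecomposability of the blocks. -/

namespace Block

variable {F : Type*} [Field F]

theorem sum_jordanCount {b : Block F} (hb : b.Valid) {κ : Type*} [Fintype κ] {s : κ → Block F}
    (hs : ∀ i, (s i).Valid) (h : Isometric b.form (sumForm s)) (k : ℕ) (μ : F) :
    ∑ i, (s i).jordanCount (k + 1) μ = b.jordanCount (k + 1) μ := by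
  obtain ⟨τ, hτ⟩ := exists_isAsymmetry hb.nondegenerate
  have h1 := hb.kerDim hτ k μ
  have h2 := kerDim_sumForm hs hτ h k μ
  omega

theorem Valid.exists_jordanCount {b : Block F} (hb : b.Valid) :
    ∃ n μ, 1 ≤ b.jordanCount (n + 1) μ := by
  rcases hb.cases with ⟨n, ε, -, h⟩ | ⟨n, c, -, -, h⟩
  · exact ⟨n, ε, by rw [h]; simp [singleCount]⟩
  · exact ⟨n, c, by rw [h]; simp [hypCount, singleCount]⟩

theorem one_ne_neg_one_of_ringChar (h : ringChar F ≠ 2) : (1 : F) ≠ -1 := fun h' =>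
  two_ne_zero_of_ringChar h (by linear_combination h')

theorem singleCount_self {K : Type*} (n : ℕ) (ε : K) : singleCount n ε n ε = 1 := if_pos ⟨rfl, rfl⟩

theorem singleCount_eq_zero {K : Type*} {n k : ℕ} {ε μ : K} (h : ¬ (k = n ∧ μ = ε)) :
    singleCount n ε k μ = 0 := if_neg h

theorem eq_of_singleCount_ne_zero {K : Type*} {n k : ℕ} {ε μ : K} (h : singleCount n ε k μ ≠ 0) :
    k = n ∧ μ = ε := by
  by_contra h'
  exact h (if_neg h')

theorem singleCount_le_one {K : Type*} (n k : ℕ) (ε μ : K) : singleCount n ε k μ ≤ 1 := by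
  unfold singleCount; split_ifs <;> omega

theorem hypCount_of_sq_eq_one {c : F} (hc : c ^ 2 = 1) (m k : ℕ) (μ : F) :
    hypCount m c k μ = 2 * singleCount m c k μ := by
  have hcc : c⁻¹ = c := inv_eq_of_mul_eq_one_left (by rw [← sq, hc])
  rw [hypCount, hcc, two_mul]

theorem singleCount_inv (m k : ℕ) (c μ : F) : singleCount m c k μ⁻¹ = singleCount m c⁻¹ k μ := by
  unfold singleCount
  by_cases h : μ⁻¹ = c
  · simp [h, ← inv_eq_iff_eq_inv]
  · rw [if_neg (fun h' => h h'.2), if_neg (fun h' => h (inv_eq_iff_eq_inv.mpr h'.2))]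

/-- A valid block whose asymmetry has exactly one Jordan block of size `k` for an eigenvalue
`μ = ± 1` has a cyclic form. -/
theorem Valid.eq_of_jordanCount_eq_one {b : Block F} (hb : b.Valid) {k : ℕ} {μ : F}
    (hμ : μ ^ 2 = 1) (h : b.jordanCount k μ = 1) :
    (b = A k ∧ μ = 1) ∨ (b = B k ∧ μ = 1) ∨ (b = C k ∧ μ = -1) := by
  rcases b with m | m | m | m | m | m | ⟨m, c⟩ <;> simp only [jordanCount] at h
  · obtain ⟨rfl, rfl⟩ := eq_of_singleCount_ne_zero (h.trans_ne one_ne_zero); simp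
  · obtain ⟨rfl, rfl⟩ := eq_of_singleCount_ne_zero (h.trans_ne one_ne_zero); simp
  · obtain ⟨rfl, rfl⟩ := eq_of_singleCount_ne_zero (h.trans_ne one_ne_zero); simp
  · rw [hypCount_of_sq_eq_one (by simp)] at h; omega
  · rw [hypCount_of_sq_eq_one (by simp)] at h; omega
  · rw [hypCount_of_sq_eq_one (by simp)] at h; omega
  · exfalso
    have : singleCount m c k μ ≠ 0 ∨ singleCount m c⁻¹ k μ ≠ 0 := by
      unfold hypCount at h; omega
    rcases this with h' | h' <;> obtain ⟨-, rfl⟩ := eq_of_singleCount_ne_zero h'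
    · exact hb.2.2 hμ
    · exact hb.2.2 (by simpa [inv_pow] using hμ)

theorem jordanCount_inv {b : Block F} {k : ℕ} {μ : F} (hμ : μ ^ 2 ≠ 1) :
    b.jordanCount k μ⁻¹ = b.jordanCount k μ := by
  have h1 : μ ≠ 1 := fun h => hμ (by rw [h]; simp)
  have h2 : μ ≠ -1 := fun h => hμ (by rw [h]; simp)
  have h3 : μ⁻¹ ≠ 1 := fun h => h1 (by simpa using h)
  have h4 : μ⁻¹ ≠ -1 := fun h => h2 (by rw [← inv_inv μ, h]; simp)
  rcases b with m | m | m | m | m | m | ⟨m, c⟩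
  case G =>
    simp only [jordanCount, hypCount, singleCount_inv, inv_inv]
    exact add_comm _ _
  all_goals simp [jordanCount, hypCount, singleCount, h1, h2, h3, h4]

/-- A splitting would decompose both parts into blocks whose Jordan counts add up to those of `b`. A
cyclic block has only one Jordan block to share, and for `c² ≠ 1` the eigenvalues `c` and `c⁻¹` must
go together. For `c = ±1` each part would get one Jordan block, hence contain a cyclic form; parity,
characteristic or alternation excludes it. -/
theorem Valid.isIndecomposable (hF : QuadraticallyClosed F) {b : Block F} (hb : b.Valid) :
    IsIndecomposable b.matrix := by
  refine ⟨?_, ?_⟩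
  · by_contra hne
    rw [not_nonempty_iff] at hne
    have := hb.finrank_pos
    rw [Module.finrank_fintype_fun_eq_card, Fintype.card_eq_zero] at this
    exact lt_irrefl 0 this
  rintro ⟨p, q, e, P, Q, X, hp, hq, hX, hXA⟩
  have hiso : Isometric b.form (prodForm (Matrix.toBilin' P) (Matrix.toBilin' Q)) := by
    have h1 := isometric_toBilin'_of_isUnit b.matrix X hX
    rw [hXA] at h1
    exact h1.symm.trans ((isometric_toBilin'_reindex e _).trans
      (isometric_toBilin'_fromBlocks P Q))
  have hnd := hiso.nondegenerate hb.nondegenerate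
  have hP := nondegenerate_of_prodForm_left hnd
  have hQ := nondegenerate_of_prodForm_right hnd
  obtain ⟨τ, hτ⟩ := exists_isAsymmetry hb.nondegenerate
  obtain ⟨α, hα⟩ := exists_isAsymmetry hP
  obtain ⟨β, hβ⟩ := exists_isAsymmetry hQ
  have hαβ : IsAsymmetry (prodForm (Matrix.toBilin' P) (Matrix.toBilin' Q)) (α.prodMap β) :=
    fun u v => by simp [hα u.1, hβ u.2]
  obtain ⟨φ, hφ⟩ := hiso
  have heig := hasEigenvectors_congr φ (hτ.eq_of_isometry hαβ hnd φ hφ) (hb.hasEigenvectors hτ)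
  obtain ⟨κ, _, s, hs, -, his⟩ := hasDecomposition_aux hF _ rfl hP hα
    (heig.of_injective (LinearMap.inl F _ _) LinearMap.inl_injective fun v => by simp)
  obtain ⟨κ', _, t, ht, -, hit⟩ := hasDecomposition_aux hF _ rfl hQ hβ
    (heig.of_injective (LinearMap.inr F _ _) LinearMap.inr_injective fun v => by simp)
  have hκ : ∀ {κ : Type} [Fintype κ] {p : ℕ} {M : Matrix (Fin p) (Fin p) F} {s : κ → Block F},
      0 < p → Isometric (Matrix.toBilin' M) (sumForm s) → Nonempty κ := by
    intro κ _ p M s hp ⟨ψ, _⟩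
    by_contra hne
    rw [not_nonempty_iff] at hne
    have := ψ.finrank_eq
    rw [Module.finrank_fintype_fun_eq_card, Fintype.card_fin,
      Module.finrank_zero_of_subsingleton] at this
    omega
  obtain ⟨i⟩ := hκ hp his
  obtain ⟨j⟩ := hκ hq hit
  have htot : Isometric b.form (sumForm (Sum.elim s t)) :=
    Isometric.trans ⟨φ, hφ⟩ ((Isometric.prodForm his hit).trans (sumForm_elim s t).symm)
  have hval : ∀ x, (Sum.elim s t x).Valid := by
    rintro (x | x)
    · exact hs x
    · exact ht x
  have hcount : ∀ k μ, (s i).jordanCount (k + 1) μ + (t j).jordanCount (k + 1) μ ≤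
      b.jordanCount (k + 1) μ := fun k μ => by
    rw [← sum_jordanCount hb hval htot, Fintype.sum_sum_type]
    exact add_le_add
      (Finset.single_le_sum (f := fun x => (s x).jordanCount (k + 1) μ)
        (fun _ _ => Nat.zero_le _) (Finset.mem_univ i))
      (Finset.single_le_sum (f := fun x => (t x).jordanCount (k + 1) μ)
        (fun _ _ => Nat.zero_le _) (Finset.mem_univ j))
  obtain ⟨n₁, μ₁, h₁⟩ := (hs i).exists_jordanCount
  obtain ⟨n₂, μ₂, h₂⟩ := (ht j).exists_jordanCount
  have c₁ := hcount n₁ μ₁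
  have c₂ := hcount n₂ μ₂
  rcases hb.cases with ⟨n, ε, -, h⟩ | ⟨n, c, hc0, -, h⟩
  · simp only [h, singleCount] at c₁ c₂
    split_ifs at c₁ c₂ with d₁ d₂
    · obtain ⟨rfl, rfl⟩ : n₁ = n₂ ∧ μ₁ = μ₂ := ⟨by omega, d₁.2.trans d₂.2.symm⟩
      omega
    all_goals omega
  · by_cases hc : c ^ 2 = 1
    · simp only [h, hypCount_of_sq_eq_one hc] at c₁ c₂
      obtain ⟨d₁, rfl⟩ := eq_of_singleCount_ne_zero (n := n + 1) (k := n₁ + 1) (ε := c) (μ := μ₁)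
        (by omega)
      obtain ⟨d₂, rfl⟩ := eq_of_singleCount_ne_zero (n := n + 1) (k := n₂ + 1) (ε := μ₁) (μ := μ₂)
        (by omega)
      obtain rfl : n₁ = n := by omega
      obtain rfl : n₂ = n₁ := by omega
      rw [singleCount_self] at c₁
      have e₁ := (hs i).eq_of_jordanCount_eq_one hc (k := n₂ + 1) (by omega)
      have hsi := hs i
      -- This settles the block `E`, whose parity and characteristic would allow a splitting into
      -- two copies of `B`.
      have hnB : (∀ l, b ≠ B l) → s i ≠ B (n₂ + 1) := fun hbB hB => by
        have hch : ringChar F = 2 := by rw [hB] at hsi; exact hsi.2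
        have := (isAlternatingAt_sumForm hval hch).mp
          ((hb.isAlternatingAt hch (n := n₂) (hbB _)).congr htot) (Sum.inl i)
        exact this hB
      have hJ := congrFun (congrFun h (n₂ + 1)) μ₂
      rw [hypCount_of_sq_eq_one hc, singleCount_self] at hJ
      clear hcount h₁ h₂ c₁ c₂ h htot hval
      rcases b with m | m | m | m | m | m | ⟨m, c⟩ <;> simp only [jordanCount] at hJ
      · have := singleCount_le_one m (n₂ + 1) (1 : F) μ₂
        omega
      · have := singleCount_le_one m (n₂ + 1) (1 : F) μ₂
        omega
      · have := singleCount_le_one m (n₂ + 1) (-1 : F) μ₂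
        omega
      · rw [hypCount_of_sq_eq_one (by simp)] at hJ
        obtain ⟨rfl, rfl⟩ := eq_of_singleCount_ne_zero
          (n := m) (k := n₂ + 1) (ε := (1 : F)) (μ := μ₂) (by omega)
        rcases e₁ with ⟨e, -⟩ | ⟨e, -⟩ | ⟨e, e'⟩ <;> rw [e] at hsi
        · exact Nat.not_even_iff_odd.mpr hsi.1 hb.1
        · exact Nat.not_even_iff_odd.mpr hsi.1 hb.1
        · exact one_ne_neg_one_of_ringChar hsi.2.2 e'
      · rcases e₁ with ⟨e, -⟩ | ⟨e, -⟩ | ⟨e, e'⟩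
        · rw [e] at hsi; exact hsi.2 hb.2
        · exact hnB (by simp) e
        · rw [e] at hsi; exact hsi.2.2 hb.2
      · rw [hypCount_of_sq_eq_one (by simp)] at hJ
        obtain ⟨rfl, rfl⟩ := eq_of_singleCount_ne_zero
          (n := m) (k := n₂ + 1) (ε := (-1 : F)) (μ := μ₂) (by omega)
        rcases e₁ with ⟨e, e'⟩ | ⟨e, -⟩ | ⟨e, -⟩ <;> rw [e] at hsi
        · exact one_ne_neg_one_of_ringChar hsi.2 e'.symm
        · exact hb.2 hsi.2
        · exact Nat.not_even_iff_odd.mpr hb.1 hsi.1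
      · have : singleCount m c (n₂ + 1) μ₂ ≠ 0 ∨ singleCount m c⁻¹ (n₂ + 1) μ₂ ≠ 0 := by
          unfold hypCount at hJ; omega
        rcases this with h' | h' <;> obtain ⟨-, rfl⟩ := eq_of_singleCount_ne_zero h'
        · exact hb.2.2 hc
        · exact hb.2.2 (by simpa [inv_pow] using hc)
    -- Counts are invariant under `μ ↦ μ⁻¹` when `μ² ≠ 1`, so each of the two parts would contribute
    -- to the eigenvalue `c` itself, which has only one Jordan block.
    · have key : ∀ {x : Block F} {m : ℕ} {μ : F}, 1 ≤ x.jordanCount (m + 1) μ →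
          hypCount (n + 1) c (m + 1) μ ≠ 0 → 1 ≤ x.jordanCount (n + 1) c := by
        intro x m μ hx hμ
        have : singleCount (n + 1) c (m + 1) μ ≠ 0 ∨ singleCount (n + 1) c⁻¹ (m + 1) μ ≠ 0 := by
          unfold hypCount at hμ; omega
        rcases this with h' | h' <;> obtain ⟨h1, rfl⟩ := eq_of_singleCount_ne_zero h'
        · rwa [h1] at hx
        · rwa [jordanCount_inv hc, h1] at hx
      have hne : ¬ (n + 1 = n + 1 ∧ c = c⁻¹) := fun h' => hc (by
        rw [sq]; nth_rewrite 2 [h'.2]; exact mul_inv_cancel₀ hc0)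
      rw [h] at c₁ c₂
      have e₁ := key h₁ (by omega)
      have e₂ := key h₂ (by omega)
      have e₃ := hcount n c
      rw [h, hypCount, singleCount_self, singleCount_eq_zero hne] at e₃
      omega

end Block

/-! ### Uniqueness: recovering multiplicities from the invariants. -/

namespace Block

variable {F : Type*} [Field F]

theorem Interchangeable.symm {b b' : Block F} (h : Interchangeable b b') :
    Interchangeable b' b := by
  rcases h with rfl | ⟨m, c, rfl, rfl⟩
  · exact Or.inl rfl
  · exact Or.inr ⟨m, c⁻¹, rfl, by rw [inv_inv]⟩

theorem Interchangeable.trans {b b' b'' : Block F} (h : Interchangeable b b')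
    (h' : Interchangeable b' b'') : Interchangeable b b'' := by
  rcases h with rfl | ⟨m, c, rfl, rfl⟩
  · exact h'
  · rcases h' with rfl | ⟨m', c', h1, rfl⟩
    · exact Or.inr ⟨m, c, rfl, rfl⟩
    · obtain ⟨rfl, rfl⟩ : m = m' ∧ c⁻¹ = c' := by simpa using h1
      exact Or.inl (by rw [inv_inv])

/-- Interchangeability as an equivalence relation. -/
def interchangeSetoid (F : Type*) [Field F] : Setoid (Block F) where
  r := Interchangeable
  iseqv := ⟨fun _ => Or.inl rfl, fun h => h.symm, fun h h' => h.trans h'⟩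

theorem interchangeable_iff {b b' : Block F} (h : ∀ m c, b ≠ G m c) :
    Interchangeable b b' ↔ b' = b := by
  refine ⟨fun h' => ?_, fun h' => Or.inl h'.symm⟩
  rcases h' with rfl | ⟨m, c, rfl, -⟩
  · rfl
  · exact absurd rfl (h m c)

theorem interchangeable_G_iff {m : ℕ} {c : F} {b' : Block F} :
    Interchangeable (G m c) b' ↔ b' = G m c ∨ b' = G m c⁻¹ := by
  constructor
  · rintro (h | ⟨m', c', h, rfl⟩)
    · exact Or.inl h.symm
    · obtain ⟨rfl, rfl⟩ : m = m' ∧ c = c' := by simpa using h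
      exact Or.inr rfl
  · rintro (rfl | rfl)
    · exact Or.inl rfl
    · exact Or.inr ⟨m, c, rfl, rfl⟩

theorem Valid.of_interchangeable {b b' : Block F} (hb : b.Valid) (h : Interchangeable b b') :
    b'.Valid := by
  rcases h with rfl | ⟨m, c, rfl, rfl⟩
  · exact hb
  · exact ⟨hb.1, inv_ne_zero hb.2.1, fun h => hb.2.2 (by simpa [inv_pow] using h)⟩

theorem Interchangeable.isometric {b b' : Block F} (h : Interchangeable b b') (hb : b.Valid) :
    Isometric b.form b'.form := by
  rcases h with rfl | ⟨m, c, rfl, rfl⟩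
  · exact Isometric.refl _
  · obtain ⟨n, rfl⟩ : ∃ n, m = n + 1 := ⟨m - 1, by have := hb.1; omega⟩
    exact (hypBlock_inv_isometric n hb.2.1).symm

section Counting

open Classical in
/-- The indicator function of interchangeability. -/
noncomputable def indicator (b b' : Block F) : ℕ := if Interchangeable b b' then 1 else 0

theorem indicator_of {b b' : Block F} (h : Interchangeable b b') : indicator b b' = 1 := if_pos h

theorem indicator_of_not {b b' : Block F} (h : ¬ Interchangeable b b') : indicator b b' = 0 :=
  if_neg h

theorem singleCount_eq_indicator {b t : Block F} {n k : ℕ} {ε μ : F}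
    (h : Interchangeable b t ↔ k = n ∧ μ = ε) : singleCount n ε k μ = indicator b t := by
  by_cases h' : Interchangeable b t
  · rw [indicator_of h']; exact if_pos (h.mp h')
  · rw [indicator_of_not h']; exact if_neg fun h'' => h' (h.mpr h'')

/-- Except for the blocks `B` and `E`, the number of Jordan blocks of a suitable size and eigenvalue
counts the blocks interchangeable with a given one. -/
theorem Valid.exists_jordanCount_eq {b : Block F} (hb : b.Valid) (hB : ∀ l, b ≠ B l)
    (hE : ∀ l, b ≠ E l) : ∃ (k : ℕ) (μ : F) (w : ℕ), 0 < w ∧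
      ∀ t : Block F, t.Valid → t.jordanCount (k + 1) μ = w * indicator b t := by
  have sq1 : (1 : F) ^ 2 = 1 := one_pow 2
  have sq2 : (-1 : F) ^ 2 = 1 := by simp
  rcases b with m | m | m | m | m | m | ⟨m, c⟩
  · obtain ⟨n, rfl⟩ : ∃ n, m = n + 1 := ⟨m - 1, by have := hb.1.pos; omega⟩
    have h1 := one_ne_neg_one_of_ringChar hb.2
    have hodd := Nat.not_even_iff_odd.mpr hb.1
    refine ⟨n, 1, 1, one_pos, fun t ht => ?_⟩
    have hI : Interchangeable (A (n + 1)) t ↔ t = A (n + 1) := interchangeable_iff (by simp)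
    rcases t with m | m | m | m | m | m | ⟨m, c⟩ <;> simp only [jordanCount, one_mul]
    · exact singleCount_eq_indicator (by rw [hI]; simp [eq_comm])
    · exact absurd ht.2 hb.2
    · rw [indicator_of_not (by rw [hI]; simp), singleCount_eq_zero (by simp [h1])]
    · rw [indicator_of_not (by rw [hI]; simp), hypCount_of_sq_eq_one sq1,
        singleCount_eq_zero fun h => hodd (by rw [h.1]; exact ht.1)]
    · exact absurd ht.2 hb.2
    · rw [indicator_of_not (by rw [hI]; simp), hypCount_of_sq_eq_one sq2,
        singleCount_eq_zero (by simp [h1])]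
    · rw [indicator_of_not (by rw [hI]; simp), hypCount,
        singleCount_eq_zero fun h => ht.2.2 (by rw [← h.2, sq1]),
        singleCount_eq_zero fun h => ht.2.2 (by rw [← inv_inv c, ← h.2]; simp)]
  · exact absurd rfl (hB m)
  · obtain ⟨n, rfl⟩ : ∃ n, m = n + 1 := ⟨m - 1, by have := hb.2.1; omega⟩
    have h1 := (one_ne_neg_one_of_ringChar hb.2.2).symm
    have hodd := Nat.not_odd_iff_even.mpr hb.1
    refine ⟨n, -1, 1, one_pos, fun t ht => ?_⟩
    have hI : Interchangeable (C (n + 1)) t ↔ t = C (n + 1) := interchangeable_iff (by simp)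
    rcases t with m | m | m | m | m | m | ⟨m, c⟩ <;> simp only [jordanCount, one_mul]
    · rw [indicator_of_not (by rw [hI]; simp), singleCount_eq_zero fun h => h1 h.2]
    · rw [indicator_of_not (by rw [hI]; simp), singleCount_eq_zero fun h => h1 h.2]
    · exact singleCount_eq_indicator (by rw [hI]; simp [eq_comm])
    · rw [indicator_of_not (by rw [hI]; simp), hypCount_of_sq_eq_one sq1,
        singleCount_eq_zero fun h => h1 h.2]
    · rw [indicator_of_not (by rw [hI]; simp), hypCount_of_sq_eq_one sq1,
        singleCount_eq_zero fun h => h1 h.2]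
    · rw [indicator_of_not (by rw [hI]; simp), hypCount_of_sq_eq_one sq2,
        singleCount_eq_zero fun h => hodd (by rw [h.1]; exact ht.1)]
    · rw [indicator_of_not (by rw [hI]; simp), hypCount,
        singleCount_eq_zero fun h => ht.2.2 (by rw [← h.2, sq2]),
        singleCount_eq_zero fun h => ht.2.2 (by rw [← inv_inv c, ← h.2]; simp)]
  · obtain ⟨n, rfl⟩ : ∃ n, m = n + 1 := ⟨m - 1, by have := hb.2; omega⟩
    have hodd := Nat.not_odd_iff_even.mpr hb.1
    refine ⟨n, 1, 2, two_pos, fun t ht => ?_⟩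
    have hI : Interchangeable (D (n + 1)) t ↔ t = D (n + 1) := interchangeable_iff (by simp)
    rcases t with m | m | m | m | m | m | ⟨m, c⟩ <;> simp only [jordanCount]
    · rw [indicator_of_not (by rw [hI]; simp),
        singleCount_eq_zero fun h => hodd (by rw [h.1]; exact ht.1)]
    · rw [indicator_of_not (by rw [hI]; simp),
        singleCount_eq_zero fun h => hodd (by rw [h.1]; exact ht.1)]
    · rw [indicator_of_not (by rw [hI]; simp),
        singleCount_eq_zero fun h => one_ne_neg_one_of_ringChar ht.2.2 h.2]
    · rw [hypCount_of_sq_eq_one sq1]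
      congr 1
      exact singleCount_eq_indicator (by rw [hI]; simp [eq_comm])
    · rw [indicator_of_not (by rw [hI]; simp), hypCount_of_sq_eq_one sq1,
        singleCount_eq_zero fun h => hodd (by rw [h.1]; exact ht.1)]
    · rw [indicator_of_not (by rw [hI]; simp), hypCount_of_sq_eq_one sq2,
        singleCount_eq_zero fun h => hodd (by rw [h.1]; exact ht.1)]
    · rw [indicator_of_not (by rw [hI]; simp), hypCount,
        singleCount_eq_zero fun h => ht.2.2 (by rw [← h.2, sq1]),
        singleCount_eq_zero fun h => ht.2.2 (by rw [← inv_inv c, ← h.2]; simp)]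
  · exact absurd rfl (hE m)
  · obtain ⟨n, rfl⟩ : ∃ n, m = n + 1 := ⟨m - 1, by have := hb.1.pos; omega⟩
    have h1 := (one_ne_neg_one_of_ringChar hb.2).symm
    have hodd := Nat.not_even_iff_odd.mpr hb.1
    refine ⟨n, -1, 2, two_pos, fun t ht => ?_⟩
    have hI : Interchangeable (Block.F (n + 1)) t ↔ t = Block.F (n + 1) :=
      interchangeable_iff (by simp)
    rcases t with m | m | m | m | m | m | ⟨m, c⟩ <;> simp only [jordanCount]
    · rw [indicator_of_not (by rw [hI]; simp), singleCount_eq_zero fun h => h1 h.2]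
    · rw [indicator_of_not (by rw [hI]; simp), singleCount_eq_zero fun h => h1 h.2]
    · rw [indicator_of_not (by rw [hI]; simp),
        singleCount_eq_zero fun h => hodd (by rw [h.1]; exact ht.1)]
    · rw [indicator_of_not (by rw [hI]; simp), hypCount_of_sq_eq_one sq1,
        singleCount_eq_zero fun h => h1 h.2]
    · rw [indicator_of_not (by rw [hI]; simp), hypCount_of_sq_eq_one sq1,
        singleCount_eq_zero fun h => h1 h.2]
    · rw [hypCount_of_sq_eq_one sq2]
      congr 1
      exact singleCount_eq_indicator (by rw [hI]; simp [eq_comm])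
    · rw [indicator_of_not (by rw [hI]; simp), hypCount,
        singleCount_eq_zero fun h => ht.2.2 (by rw [← h.2, sq2]),
        singleCount_eq_zero fun h => ht.2.2 (by rw [← inv_inv c, ← h.2]; simp)]
  · obtain ⟨n, rfl⟩ : ∃ n, m = n + 1 := ⟨m - 1, by have := hb.1; omega⟩
    have h1 : c ≠ 1 := fun h => hb.2.2 (by rw [h, sq1])
    have h2 : c ≠ -1 := fun h => hb.2.2 (by rw [h, sq2])
    have h3 : c ≠ c⁻¹ := fun h' => hb.2.2 (by
      rw [sq]; nth_rewrite 2 [h']; exact mul_inv_cancel₀ hb.2.1)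
    refine ⟨n, c, 1, one_pos, fun t ht => ?_⟩
    rcases t with m | m | m | m | m | m | ⟨m, d⟩ <;> simp only [jordanCount, one_mul]
    case G =>
      by_cases h : Interchangeable (G (n + 1) c) (G m d)
      · rw [indicator_of h]
        rw [interchangeable_G_iff] at h
        rcases h with h | h
        · obtain ⟨rfl, rfl⟩ : m = n + 1 ∧ d = c := by simpa using h
          rw [hypCount, singleCount_self, singleCount_eq_zero fun h => h3 h.2]
        · obtain ⟨rfl, rfl⟩ : m = n + 1 ∧ d = c⁻¹ := by simpa using h
          rw [hypCount, inv_inv, singleCount_self, singleCount_eq_zero fun h => h3 h.2]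
      · rw [indicator_of_not h]
        rw [interchangeable_G_iff] at h
        rw [hypCount, singleCount_eq_zero fun h' => h (Or.inl (by rw [h'.1, h'.2])),
          singleCount_eq_zero fun h' => h (Or.inr (by rw [h'.1, h'.2, inv_inv]))]
    all_goals rw [indicator_of_not (by rw [interchangeable_G_iff]; simp)]
    · exact singleCount_eq_zero fun h => h1 h.2
    · exact singleCount_eq_zero fun h => h1 h.2
    · exact singleCount_eq_zero fun h => h2 h.2
    · rw [hypCount_of_sq_eq_one sq1, singleCount_eq_zero fun h => h1 h.2]
    · rw [hypCount_of_sq_eq_one sq1, singleCount_eq_zero fun h => h1 h.2]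
    · rw [hypCount_of_sq_eq_one sq2, singleCount_eq_zero fun h => h2 h.2]

theorem Valid.jordanCount_of_odd {t : Block F} (ht : t.Valid) (h2 : ringChar F = 2) {n : ℕ}
    (hn : Odd n) : t.jordanCount n 1 = indicator (B n) t + 2 * indicator (E n) t := by
  have sq1 : (1 : F) ^ 2 = 1 := one_pow 2
  have hodd := Nat.not_even_iff_odd.mpr hn
  have hI : Interchangeable (B n) t ↔ t = B n := interchangeable_iff (by simp)
  have hI' : Interchangeable (E n) t ↔ t = E n := interchangeable_iff (by simp)
  rcases t with m | m | m | m | m | m | ⟨m, c⟩ <;> simp only [jordanCount]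
  · exact absurd h2 ht.2
  · rw [indicator_of_not (b := E n) (by rw [hI']; simp)]
    exact singleCount_eq_indicator (by rw [hI]; simp [eq_comm])
  · exact absurd h2 ht.2.2
  · rw [indicator_of_not (by rw [hI]; simp), indicator_of_not (by rw [hI']; simp),
      hypCount_of_sq_eq_one sq1, singleCount_eq_zero fun h => hodd (by rw [h.1]; exact ht.1)]
  · rw [indicator_of_not (by rw [hI]; simp), hypCount_of_sq_eq_one sq1, zero_add]
    congr 1
    exact singleCount_eq_indicator (by rw [hI']; simp [eq_comm])
  · exact absurd h2 ht.2
  · rw [indicator_of_not (by rw [hI]; simp), indicator_of_not (by rw [hI']; simp), hypCount,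
      singleCount_eq_zero fun h => ht.2.2 (by rw [← h.2, sq1]),
      singleCount_eq_zero fun h => ht.2.2 (by rw [← inv_inv c, ← h.2]; simp)]

variable {κ κ' : Type*} [Fintype κ] [Fintype κ'] {s : κ → Block F} {t : κ' → Block F}

theorem sum_indicator_eq_zero_iff {b : Block F} :
    ∑ i, indicator b (s i) = 0 ↔ ∀ i, ¬ Interchangeable b (s i) := by
  simp only [Finset.sum_eq_zero_iff, Finset.mem_univ, true_implies]
  refine forall_congr' fun i => ⟨fun h h' => ?_, indicator_of_not⟩
  rw [indicator_of h'] at h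
  exact one_ne_zero h

/-- Apart from `B` and `E`, a Jordan count is a fixed positive multiple of the multiplicity. For
these two, `#B + 2 #E` agrees on both sides, alternation decides whether `#B = 0`, and admissibility
makes one of the two numbers zero. -/
theorem sum_indicator_eq {V : Type*} [AddCommGroup V] [Module F V]
    {f : LinearMap.BilinForm F V} {σ : Module.End F V} (hσ : IsAsymmetry f σ)
    (hs : ∀ i, (s i).Valid) (hs' : ¬ ∃ l i j, s i = B l ∧ s j = E l)
    (ht : ∀ i, (t i).Valid) (ht' : ¬ ∃ l i j, t i = B l ∧ t j = E l)
    (hfs : Isometric f (sumForm s)) (hft : Isometric f (sumForm t)) {b : Block F} (hb : b.Valid) :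
    ∑ i, indicator b (s i) = ∑ j, indicator b (t j) := by
  have hcount : ∀ k μ, ∑ i, (s i).jordanCount (k + 1) μ = ∑ j, (t j).jordanCount (k + 1) μ :=
    fun k μ => by
      have h1 := kerDim_sumForm hs hσ hfs k μ
      have h2 := kerDim_sumForm ht hσ hft k μ
      omega
  by_cases hBE : (∀ l, b ≠ B l) ∧ ∀ l, b ≠ E l
  · obtain ⟨k, μ, w, hw, h⟩ := hb.exists_jordanCount_eq hBE.1 hBE.2
    have h1 := hcount k μ
    simp only [h _ (hs _), h _ (ht _), ← Finset.mul_sum] at h1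
    exact Nat.eq_of_mul_eq_mul_left hw h1
  · obtain ⟨n, hn, hch, hbn⟩ : ∃ n, Odd (n + 1) ∧ ringChar F = 2 ∧
        (b = B (n + 1) ∨ b = E (n + 1)) := by
      rw [not_and_or] at hBE
      push Not at hBE
      rcases hBE with ⟨l, rfl⟩ | ⟨l, rfl⟩ <;>
      obtain ⟨n, rfl⟩ : ∃ n, l = n + 1 := ⟨l - 1, by have := hb.1.pos; omega⟩
      · exact ⟨n, hb.1, hb.2, Or.inl rfl⟩
      · exact ⟨n, hb.1, hb.2, Or.inr rfl⟩
    have hIB : ∀ x : Block F, Interchangeable (B (n + 1)) x ↔ x = B (n + 1) := fun x =>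
      interchangeable_iff (by simp)
    have hIE : ∀ x : Block F, Interchangeable (E (n + 1)) x ↔ x = E (n + 1) := fun x =>
      interchangeable_iff (by simp)
    have h1 := hcount n 1
    simp only [(hs _).jordanCount_of_odd hch hn, (ht _).jordanCount_of_odd hch hn,
      Finset.sum_add_distrib, ← Finset.mul_sum] at h1
    have hsB : ∑ i, indicator (B (n + 1)) (s i) = 0 ↔ ∑ j, indicator (B (n + 1)) (t j) = 0 := by
      simp only [sum_indicator_eq_zero_iff, hIB]
      exact (isAlternatingAt_sumForm hs hch).symm.trans
        (Iff.trans ⟨fun h => h.congr (hfs.symm.trans hft), fun h => h.congr (hft.symm.trans hfs)⟩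
          (isAlternatingAt_sumForm ht hch))
    have hs0 : ∑ i, indicator (B (n + 1)) (s i) = 0 ∨ ∑ i, indicator (E (n + 1)) (s i) = 0 := by
      simp only [sum_indicator_eq_zero_iff, hIB, hIE]
      by_contra! h
      obtain ⟨⟨i, hi⟩, j, hj⟩ := h
      exact hs' ⟨n + 1, i, j, hi, hj⟩
    have ht0 : ∑ i, indicator (B (n + 1)) (t i) = 0 ∨ ∑ i, indicator (E (n + 1)) (t i) = 0 := by
      simp only [sum_indicator_eq_zero_iff, hIB, hIE]
      by_contra! h
      obtain ⟨⟨i, hi⟩, j, hj⟩ := h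
      exact ht' ⟨n + 1, i, j, hi, hj⟩
    rcases hbn with rfl | rfl <;> omega

open Classical in
theorem sum_indicator_eq_card {ι : Type*} [Fintype ι] (s : ι → Block F) (b : Block F) :
    ∑ i, indicator b (s i) = Fintype.card {i // Interchangeable (s i) b} := by
  rw [Fintype.card_subtype, Finset.card_eq_sum_ones, Finset.sum_filter]
  refine Finset.sum_congr rfl fun i _ => ?_
  by_cases hi : Interchangeable b (s i)
  · rw [indicator_of hi, if_pos hi.symm]
  · rw [indicator_of_not hi, if_neg fun h => hi h.symm]

/-- The families are matched fibre by fibre over the classes of interchangeable blocks. -/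
theorem exists_equiv_of_sum_indicator_eq (hs : ∀ i, (s i).Valid) (ht : ∀ i, (t i).Valid)
    (h : ∀ b : Block F, b.Valid → ∑ i, indicator b (s i) = ∑ j, indicator b (t j)) :
    ∃ e : κ ≃ κ', ∀ i, Interchangeable (s i) (t (e i)) := by
  classical
  let q : Block F → Quotient (interchangeSetoid F) := Quotient.mk _
  have hq : ∀ b b', q b = q b' ↔ Interchangeable b b' := fun b b' => Quotient.eq
  have hsum : ∀ b : Block F, ∑ i, indicator b (s i) = ∑ j, indicator b (t j) := by
    intro b
    by_cases hb : b.Valid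
    · exact h b hb
    · rw [sum_indicator_eq_zero_iff.mpr fun i h => hb ((hs i).of_interchangeable h.symm),
        sum_indicator_eq_zero_iff.mpr fun i h => hb ((ht i).of_interchangeable h.symm)]
  have hfib : ∀ x, Nonempty ({i // q (s i) = x} ≃ {j // q (t j) = x}) := by
    intro x
    obtain ⟨b, rfl⟩ := Quotient.exists_rep x
    refine Fintype.card_eq.mp ?_
    have h1 := sum_indicator_eq_card s b
    have h2 := sum_indicator_eq_card t b
    simp only [← hq] at h1 h2
    rw [← h1, ← h2, hsum]
  let φ := fun x => (hfib x).some
  let e := ((Equiv.sigmaFiberEquiv fun i => q (s i)).symm.trans (Equiv.sigmaCongrRight φ)).trans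
    (Equiv.sigmaFiberEquiv fun j => q (t j))
  exact ⟨e, fun i => ((hq _ _).mp (φ (q (s i)) ⟨i, rfl⟩).2).symm⟩

end Counting

end Block

end BilinNormalForm

/-! ### The main theorem. -/

theorem mainTheorem3 {F : Type*} [Field F] (hF : BilinNormalForm.QuadraticallyClosed F)
    {V : Type*} [AddCommGroup V] [Module F V] [FiniteDimensional F V]
    (f : LinearMap.BilinForm F V) (hf : f.Nondegenerate)
    (hsplit : BilinNormalForm.IsSplit f hf) :
    (∃ (k : ℕ) (s : Fin k → BilinNormalForm.Block F),
      BilinNormalForm.Block.Admissible s ∧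
      (∀ i, BilinNormalForm.IsIndecomposable (s i).matrix) ∧
      BilinNormalForm.AdmitsGramMatrix f (BilinNormalForm.Block.directSum s)) ∧
    (∀ (k : ℕ) (s : Fin k → BilinNormalForm.Block F), BilinNormalForm.Block.Admissible s →
      BilinNormalForm.AdmitsGramMatrix f (BilinNormalForm.Block.directSum s) →
      ∀ (k' : ℕ) (t : Fin k' → BilinNormalForm.Block F), BilinNormalForm.Block.Admissible t →
        (BilinNormalForm.AdmitsGramMatrix f (BilinNormalForm.Block.directSum t) ↔
          ∃ e : Fin k ≃ Fin k',
            ∀ i, BilinNormalForm.Block.Interchangeable (s i) (t (e i)))) := by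
  have hσ : BilinNormalForm.IsAsymmetry f (BilinNormalForm.asymmetry f hf).toLinearMap :=
    fun u v => (BilinNormalForm.apply_asymmetry f hf u v).symm
  constructor
  · obtain ⟨κ, _, s, hs, hs', his⟩ := BilinNormalForm.Block.hasDecomposition_aux hF _ rfl hf hσ
      (BilinNormalForm.hasEigenvectors_of_splits hsplit)
    let e := (Fintype.equivFin κ).symm
    refine ⟨Fintype.card κ, s ∘ e, ⟨fun i => hs _, ?_⟩, fun i => (hs _).isIndecomposable hF, ?_⟩
    · rintro ⟨l, i, j, hi, hj⟩
      exact hs' ⟨l, e i, e j, hi, hj⟩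
    · exact BilinNormalForm.Block.admitsGramMatrix_directSum_iff.mpr
        (his.trans (BilinNormalForm.Isometric.piForm_reindex e fun i => (s i).form).symm)
  · intro k s hs hfs k' t ht
    rw [BilinNormalForm.Block.admitsGramMatrix_directSum_iff] at hfs ⊢
    constructor
    · intro hft
      exact BilinNormalForm.Block.exists_equiv_of_sum_indicator_eq hs.1 ht.1 fun b hb =>
        BilinNormalForm.Block.sum_indicator_eq hσ hs.1 hs.2 ht.1 ht.2 hfs hft hb
    · rintro ⟨e, he⟩
      exact hfs.trans ((BilinNormalForm.Isometric.piForm fun i => (he i).isometric (hs.1 i)).trans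
        (BilinNormalForm.Isometric.piForm_reindex e fun i => (t i).form))
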